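/- **Setup.** Let $\overline{\omega_0}=s_{i_1}\cdots s_{i_N}$, $N=n(n+1)/2$, be a reduced decomposition of the longest element of $S_{n+1}$. Its string diagram has $n+1$ strings $U_1,\dots,U_{n+1}$, numbered from left to right at the top; going down, the $m$-th crossing $t_m$ exchanges the strings in positions $i_m$ and $i_m+1$ (it lies in column $i_m$). *String inequalities.* For $1\le k\le n$ orient $U_1,\dots,U_k$ upward and the other strings downward. A rigorous path is an oriented path in the diagram from the lower end of $U_k$ to the lower end of $U_{k+1}$ which meets no vertex twice and which never goes straight through a crossing, from right to left, when both strings there are oriented upward or both are oriented downward. It gives the string inequality $\sum_m c_m x_m\ge 0$, where $c_m=1$ (resp. $-1$) if at $t_m$ the path switches from $U_p$ to $U_q$ with $p<q$ (resp. $p>q$), and $c_m=0$ otherwise. *$\lambda$-inequalities.* For $1\le m\le N$, $\lambda_m$ is the inequality $x_m\le 2+\sum_{l>m}c_lx_l$, where $c_l=-2$ if $t_l$ is in the column of $t_m$, $c_l=1$ if it is in a neighbouring column, and $c_l=0$ otherwise. *Hypersurfaces.* Let $d$ run over all these (string and $\lambda$-) inequalities, written as $\sum_m M_{d,m}x_m\le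 0$ or $\le 2$, and put $T^{M_d}=\prod_m t_m^{M_{d,m}}$. For a vector $a=(a_d)$ of nonzero complex numbers let $$f_{\overline{\omega_0},a}=1-\sum_d a_dT^{M_d},$$ and let $Z_{\overline{\omega_0},a}$ be the hypersurface $f_{\overline{\omega_0},a}=0$ in the torus $T=\operatorname{Spec}\mathbb C[t_1^{\pm1},\dots,t_N^{\pm1}]$. *Box equations.* A box is a pair of consecutive crossings $t_{\rm top}$, $t_{\rm bot}$ of the same column, $t_{\rm top}$ being the upper one. Let $P_{\overline{\omega_0}}$ be the set of vectors $a$ of nonzero complex numbers such that $a_{p_1}a_{\lambda_{\rm top}}=a_{p_2}a_{\lambda_{\rm bot}}$ for every box and all string inequalities $p_1,p_2$ with $T^{p_1}T^{\lambda_{\rm top}}=T^{p_2}T^{\lambda_{\rm bot}}$ such that $t_{\rm top}$ has exponent $-1$ in $T^{p_1}$ and $t_{\rm bot}$ has exponent $1$ in $T^{p_2}$. (Here $T^{d}$ abbreviates $T^{M_d}$.) *The rational map.* Let $\overline{\omega_0}'$ arise from $\overline{\omega_0}$ by a 3-move at the consecutive crossings $i,j,k$, that is, by replacing a subword $(s_c,s_e,s_c)$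 with $(s_e,s_c,s_e)$, $|c-e|=1$. For $a\in P_{\overline{\omega_0}}$ put $C=a_{\lambda_k}/a_{\lambda_i}$ and define $h_a:T'\dashrightarrow T$, where $T'$ is the torus with coordinates $t'_1,\dots,t'_N$, by $$(t_i,t_j,t_k)=\left(\frac{t_i't_k'+Ct_j'}{t_i'},\ \frac{t_i't_k'}{C},\ \frac{Ct_i't_j'}{t_i't_k'+Ct_j'}\right),\qquad t_q=t_q'\ \text{ for } q\notin\{i,j,k\}.$$ **Proposition.** For every $a\in P_{\overline{\omega_0}}$ there is $a'\in P_{\overline{\omega_0}'}$ such that $$h_a^*(f_{\overline{\omega_0},a})=f_{\overline{\omega_0}',a'}$$ as rational functions on $T'$, where $f_{\overline{\omega_0}',a'}$ is written in the coordinates $t'$. Moreover $h_a$ induces a birational map $Z_{\overline{\omega_0}',a'}\dashrightarrow Z_{\overline{\omega_0},a}$: it restricts to an isomorphism from a dense open subscheme of $Z_{\overline{\omega_0}',a'}$ onto a dense open subscheme of $Z_{\overline{\omega_0},a}$. -/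

import Mathlib

noncomputable section

open CategoryTheory AlgebraicGeometry

namespace StringMirror

/-! ### Reduced decompositions and string diagrams -/

/-- A word `s_{i_1} ⋯ s_{i_N}` in the simple transpositions of `S_{n+1}`. Columns are numbered
from `0`: the letter `c : Fin n` exchanges the positions `c` and `c + 1`. -/
abbrev Word (n N : ℕ) := Fin N → Fin n

/-- The simple transposition exchanging the positions `c` and `c + 1`. -/
def simpleTransposition {n : ℕ} (c : Fin n) : Equiv.Perm (Fin (n + 1)) :=
  Equiv.swap c.castSucc c.succ

/-- `w` is a reduced decomposition of the longest element `ω₀ : i ↦ n - i` of `S_{n+1}`,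
whose length is `n (n + 1) / 2`. -/
structure IsReducedLongest {n N : ℕ} (w : Word n N) : Prop where
  length_eq : N = n * (n + 1) / 2
  prod_eq : ((List.ofFn w).map simpleTransposition).prod = Fin.revPerm

/-- `arrangement w m p` is the string which is in position `p` just below the first `m` crossings
of the string diagram of `w`. Strings are numbered `0, …, n` from left to right at the top. -/
def arrangement {n N : ℕ} (w : Word n N) (m : ℕ) : Equiv.Perm (Fin (n + 1)) :=
  (((List.ofFn w).take m).map simpleTransposition).prod

/-- The string entering the crossing `t_v` from the upper left; it leaves to the lower right. -/
def upperLeft {n N : ℕ} (w : Word n N) (v : Fin N) : Fin (n + 1) :=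
  arrangement w v (w v).castSucc

/-- The string entering the crossing `t_v` from the upper right; it leaves to the lower left. -/
def upperRight {n N : ℕ} (w : Word n N) (v : Fin N) : Fin (n + 1) :=
  arrangement w v (w v).succ

/-- The string `s` passes through the crossing `t_v`. -/
def Meets {n N : ℕ} (w : Word n N) (v : Fin N) (s : Fin (n + 1)) : Prop :=
  s = upperLeft w v ∨ s = upperRight w v

/-- `t_v` and `t_u` are consecutive crossings on the string `s`, with `t_v` above `t_u`. -/
def ConsecutiveOn {n N : ℕ} (w : Word n N) (s : Fin (n + 1)) (v u : Fin N) : Prop :=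
  v < u ∧ Meets w v s ∧ Meets w u s ∧ ∀ x, v < x → x < u → ¬ Meets w x s

/-- `t_v` is the lowest crossing on the string `s`, so it is joined by a segment of `s` to the
lower end of `s`. -/
def IsLowestOn {n N : ℕ} (w : Word n N) (s : Fin (n + 1)) (v : Fin N) : Prop :=
  Meets w v s ∧ ∀ x, v < x → ¬ Meets w x s

/-! ### Rigorous paths -/

/-- For the orientation attached to `k`, the strings `0, …, k` are oriented upward and the
remaining ones downward. -/
def IsUp {n : ℕ} (k : Fin n) (s : Fin (n + 1)) : Prop := s ≤ k.castSucc

/-- There is an oriented edge from `t_v` to `t_u` along the string `s`. -/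
def OrientedEdge {n N : ℕ} (w : Word n N) (k : Fin n) (s : Fin (n + 1)) (v u : Fin N) : Prop :=
  (IsUp k s ∧ ConsecutiveOn w s u v) ∨ (¬ IsUp k s ∧ ConsecutiveOn w s v u)

/-- A passage of a path through the crossing `t_vertex`, arriving on the string `inS` and leaving
on the string `outS`. -/
structure Passage (n N : ℕ) where
  vertex : Fin N
  inS : Fin (n + 1)
  outS : Fin (n + 1)

/-- The two bad fragments: the path stays on its string while crossing, from right to left, a
string which has the same vertical orientation. -/
def IsBad {n N : ℕ} (w : Word n N) (k : Fin n) (q : Passage n N) : Prop :=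
  q.inS = q.outS ∧
    ((q.inS = upperLeft w q.vertex ∧
        IsUp k (upperLeft w q.vertex) ∧ IsUp k (upperRight w q.vertex)) ∨
      (q.inS = upperRight w q.vertex ∧
        ¬ IsUp k (upperLeft w q.vertex) ∧ ¬ IsUp k (upperRight w q.vertex)))

/-- `p` is (the list of passages of) a rigorous path from the lower end of the string `k` to the
lower end of the string `k + 1`. -/
structure IsRigorousPath {n N : ℕ} (w : Word n N) (k : Fin n) (p : List (Passage n N)) :
    Prop where
  meets : ∀ q ∈ p, Meets w q.vertex q.inS ∧ Meets w q.vertex q.outS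
  start : ∃ q ∈ p.head?, q.inS = k.castSucc ∧ IsLowestOn w k.castSucc q.vertex
  finish : ∃ q ∈ p.getLast?, q.outS = k.succ ∧ IsLowestOn w k.succ q.vertex
  chain : p.IsChain fun q r => r.inS = q.outS ∧ OrientedEdge w k q.outS q.vertex r.vertex
  nodup : (p.map Passage.vertex).Nodup
  not_bad : ∀ q ∈ p, ¬ IsBad w k q

/-- `1` if the path switches to a string of larger index, `-1` if it switches to a string of
smaller index, and `0` if it does not switch strings. -/
def switchSign {n N : ℕ} (q : Passage n N) : ℤ :=
  if q.inS < q.outS then 1 else if q.outS < q.inS then -1 else 0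

/-- The coefficient of `x_v` in the string inequality `0 ≤ ∑ v, stringCoeff p v * x_v` of the
path `p`. -/
def stringCoeff {n N : ℕ} (p : List (Passage n N)) (v : Fin N) : ℤ :=
  (p.map fun q => if q.vertex = v then switchSign q else 0).sum

/-! ### The defining inequalities and the hypersurfaces -/

/-- The coefficient vectors `M` of the string inequalities, written as `∑ v, M v * x_v ≤ 0`. -/
def stringVectors {n N : ℕ} (w : Word n N) : Set (Fin N → ℤ) :=
  {M | ∃ (k : Fin n) (p : List (Passage n N)), IsRigorousPath w k p ∧ M = fun v => -stringCoeff p v}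

/-- The coefficient vector of the `λ`-inequality `x_v - ∑ u > v, c_u * x_u ≤ 2`, where `c_u` is
`-2` if `t_u` is in the column of `t_v`, `1` if it is in a neighbouring column, `0` otherwise. -/
def lambdaVector {n N : ℕ} (w : Word n N) (v : Fin N) : Fin N → ℤ := fun u =>
  if u = v then 1
  else if v < u then
    if w u = w v then 2
    else if (w u : ℕ) + 1 = w v ∨ (w v : ℕ) + 1 = w u then -1 else 0
  else 0

/-- The defining inequalities: the `λ`-inequality of each crossing, and the string inequalities. -/
abbrev Inequality {n N : ℕ} (w : Word n N) := Fin N ⊕ stringVectors w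

/-- The coefficient vector `M_d` of a defining inequality. -/
def vectorOf {n N : ℕ} (w : Word n N) : Inequality w → Fin N → ℤ :=
  Sum.elim (lambdaVector w) Subtype.val

theorem stringVectors_finite {n N : ℕ} (w : Word n N) : (stringVectors w).Finite := by
  classical
  have hfin : Finite (Passage n N) :=
    Finite.of_injective (fun q : Passage n N => (q.vertex, q.inS, q.outS)) (by
      rintro ⟨a, b, c⟩ ⟨a', b', c'⟩ h
      simp_all)
  have := Fintype.ofFinite (Passage n N)
  have h1 : {l : List (Passage n N) | l.Nodup}.Finite :=
    Set.finite_coe_iff.mp (inferInstanceAs (Finite {l : List (Passage n N) // l.Nodup}))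
  refine (h1.image fun p => fun v => -stringCoeff p v).subset ?_
  rintro M ⟨k, p, hp, rfl⟩
  exact ⟨p, hp.nodup.of_map, rfl⟩

instance {n N : ℕ} (w : Word n N) : Fintype (stringVectors w) :=
  (stringVectors_finite w).fintype

/-- The Laurent polynomial ring `ℂ[t_v, t_v⁻¹ : v]`, as the group algebra of `ℤ^N`. -/
abbrev Laurent (N : ℕ) := AddMonoidAlgebra ℂ (Fin N → ℤ)

/-- The monomial `T^M`. -/
def monomial {N : ℕ} (M : Fin N → ℤ) : Laurent N := AddMonoidAlgebra.single M 1

/-- The Laurent polynomial `f_{w,a} = 1 - ∑ d, a_d T^{M_d}`. -/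
def laurentPoly {n N : ℕ} (w : Word n N) (a : Inequality w → ℂˣ) : Laurent N :=
  1 - ∑ d, (a d : ℂ) • monomial (vectorOf w d)

/-- The torus `Spec ℂ[t_v, t_v⁻¹ : v]`. -/
def torus (N : ℕ) : Scheme.{0} := Spec (CommRingCat.of (Laurent N))

/-- The hypersurface `Z_{w,a}`, given by `f_{w,a} = 0` in the torus. -/
def hypersurface {n N : ℕ} (w : Word n N) (a : Inequality w → ℂˣ) : Scheme.{0} :=
  Spec (CommRingCat.of (Laurent N ⧸ Ideal.span {laurentPoly w a}))

/-- The closed immersion of `Z_{w,a}` in the torus. -/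
def hypersurfaceι {n N : ℕ} (w : Word n N) (a : Inequality w → ℂˣ) :
    hypersurface w a ⟶ torus N :=
  Spec.map (CommRingCat.ofHom (Ideal.Quotient.mk (Ideal.span {laurentPoly w a})))

/-! ### Combinatorial box equations -/

/-- The crossings `t_top` and `t_bot` bound a box from above and from below: they are consecutive
crossings of the same column. -/
def IsBox {n N : ℕ} (w : Word n N) (top bot : Fin N) : Prop :=
  top < bot ∧ w top = w bot ∧ ∀ x, top < x → x < bot → w x ≠ w top

/-- The parameter space `P_w` (its complex points): the vectors of nonzero coefficients that
satisfy all combinatorial box equations. -/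
def parameterSpace {n N : ℕ} (w : Word n N) : Set (Inequality w → ℂˣ) :=
  {a | ∀ (top bot : Fin N) (p₁ p₂ : stringVectors w), IsBox w top bot →
    p₁.1 + lambdaVector w top = p₂.1 + lambdaVector w bot →
    p₁.1 top = -1 → p₂.1 bot = 1 →
    a (Sum.inr p₁) * a (Sum.inl top) = a (Sum.inr p₂) * a (Sum.inl bot)}

/-! ### The braid move and the rational map -/

/-- `w'` arises from `w` by a 3-move at the consecutive crossings `i`, `j`, `k`. -/
structure IsThreeMove {n N : ℕ} (w w' : Word n N) (i j k : Fin N) : Prop where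
  hij : (j : ℕ) = i + 1
  hjk : (k : ℕ) = j + 1
  adjacent : (w i : ℕ) + 1 = w j ∨ (w j : ℕ) + 1 = w i
  hki : w k = w i
  hi' : w' i = w j
  hj' : w' j = w i
  hk' : w' k = w j
  hq' : ∀ q, q ≠ i → q ≠ j → q ≠ k → w' q = w q

/-- The constant `C = a_{λ_k} / a_{λ_i}`. -/
def ratioC {n N : ℕ} {w : Word n N} (a : Inequality w → ℂˣ) (i k : Fin N) : ℂˣ :=
  a (Sum.inl k) / a (Sum.inl i)

/-- The coordinate `t_v`, a unit of the Laurent polynomial ring. -/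
def coord {N : ℕ} (v : Fin N) : (Laurent N)ˣ where
  val := monomial (Pi.single v 1)
  inv := monomial (-Pi.single v 1)
  val_inv := by
    simp [monomial, AddMonoidAlgebra.single_mul_single, AddMonoidAlgebra.one_def]
  inv_val := by
    simp [monomial, AddMonoidAlgebra.single_mul_single, AddMonoidAlgebra.one_def]

/-- The polynomial `t_i t_k + C t_j`. -/
def denom {N : ℕ} (C : ℂˣ) (i j k : Fin N) : Laurent N :=
  (coord i : Laurent N) * (coord k : Laurent N) + (C : ℂ) • (coord j : Laurent N)

theorem denom_ne_zero {N : ℕ} (C : ℂˣ) (i j k : Fin N) : denom C i j k ≠ 0 := by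
  intro h
  have hne : (Pi.single i 1 + Pi.single k 1 : Fin N → ℤ) ≠ Pi.single j 1 := by
    intro h'
    have := congrArg (fun m : Fin N → ℤ => ∑ v, m v) h'
    simp [Finset.sum_add_distrib] at this
  have h2 := congrArg (fun x : Laurent N => x.coeff (Pi.single j 1)) h
  simp [denom, coord, monomial, AddMonoidAlgebra.single_mul_single, hne] at h2

/-- The ring of regular functions on the open set of the torus where `t_i t_k + C t_j` does not
vanish. -/
abbrev LocalizedLaurent {N : ℕ} (C : ℂˣ) (i j k : Fin N) := Localization.Away (denom C i j k)

/-- The coordinate `t_v` as a unit of the localized ring. -/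
def coordLoc {N : ℕ} (C : ℂˣ) (i j k : Fin N) (v : Fin N) : (LocalizedLaurent C i j k)ˣ :=
  Units.map (algebraMap (Laurent N) (LocalizedLaurent C i j k)).toMonoidHom (coord v)

/-- `t_i t_k + C t_j` as a unit of the localized ring. -/
def denomLoc {N : ℕ} (C : ℂˣ) (i j k : Fin N) : (LocalizedLaurent C i j k)ˣ :=
  (IsLocalization.Away.algebraMap_isUnit (S := LocalizedLaurent C i j k) (denom C i j k)).unit

/-- The constant `C` as a unit of the localized ring. -/
def constLoc {N : ℕ} (C : ℂˣ) (i j k : Fin N) : (LocalizedLaurent C i j k)ˣ :=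
  Units.map (algebraMap ℂ (LocalizedLaurent C i j k)).toMonoidHom C

/-- The components of the rational map `h_a`: `t_i = (t_i' t_k' + C t_j') / t_i'`,
`t_j = t_i' t_k' / C`, `t_k = C t_i' t_j' / (t_i' t_k' + C t_j')`, and `t_q = t_q'` otherwise. -/
def hComponent {N : ℕ} (C : ℂˣ) (i j k : Fin N) (v : Fin N) : (LocalizedLaurent C i j k)ˣ :=
  if v = i then denomLoc C i j k / coordLoc C i j k i
  else if v = j then coordLoc C i j k i * coordLoc C i j k k / constLoc C i j k
  else if v = k then
    constLoc C i j k * coordLoc C i j k i * coordLoc C i j k j / denomLoc C i j k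
  else coordLoc C i j k v

/-- The exponentiation `M ↦ ∏ v, (u v) ^ (M v)` by a family of units. -/
def unitMonomial {N : ℕ} {R : Type} [CommRing R] (u : Fin N → Rˣ) :
    Multiplicative (Fin N → ℤ) →* R where
  toFun M := ((∏ v, u v ^ (Multiplicative.toAdd M v) : Rˣ) : R)
  map_one' := by simp
  map_mul' M M' := by simp [zpow_add, Finset.prod_mul_distrib]

/-- The pullback `h_a^*` of regular functions on the torus: substitution of the components of
`h_a` for the coordinates. -/
def hPullback {N : ℕ} (C : ℂˣ) (i j k : Fin N) : Laurent N →ₐ[ℂ] LocalizedLaurent C i j k :=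
  AddMonoidAlgebra.lift ℂ (LocalizedLaurent C i j k) (Fin N → ℤ)
    (unitMonomial (hComponent C i j k))

theorem dense_basicOpen {N : ℕ} (C : ℂˣ) (i j k : Fin N) :
    Dense ((PrimeSpectrum.basicOpen (denom C i j k) :
      TopologicalSpace.Opens (PrimeSpectrum (Laurent N))) : Set (PrimeSpectrum (Laurent N))) := by
  have : IsDomain (Laurent N) := {}
  refine (PrimeSpectrum.basicOpen (denom C i j k)).isOpen.dense ?_
  rw [Set.nonempty_iff_ne_empty]
  intro h
  have h' : PrimeSpectrum.basicOpen (denom C i j k) = ⊥ := TopologicalSpace.Opens.ext h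
  rw [PrimeSpectrum.basicOpen_eq_bot_iff] at h'
  exact denom_ne_zero C i j k h'.eq_zero

/-- The rational map `h_a` from the torus to itself, defined on the dense open set where
`t_i t_k + C t_j` does not vanish. -/
def hMap {N : ℕ} (C : ℂˣ) (i j k : Fin N) : (torus N).PartialMap (torus N) where
  domain := PrimeSpectrum.basicOpen (R := Laurent N) (denom C i j k)
  dense_domain := dense_basicOpen C i j k
  hom := (basicOpenIsoSpecAway (R := CommRingCat.of (Laurent N)) (denom C i j k)).hom ≫
    Spec.map (CommRingCat.ofHom (hPullback C i j k).toRingHom)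

/-- The partial map `h : X' ⇢ X` induces a birational map from `Z'` to `Z`, where `ι' : Z' ⟶ X'`
and `ι : Z ⟶ X`: there is an isomorphism from a dense open subscheme of `Z'`, which is mapped
into the domain of `h`, to a dense open subscheme of `Z`, and this isomorphism is given by `h`. -/
def InducesBirationalMap {X' X Z' Z : Scheme.{0}} (h : X'.PartialMap X) (ι' : Z' ⟶ X')
    (ι : Z ⟶ X) : Prop :=
  ∃ (φ : Z'.PartialIso Z) (κ : φ.source.toScheme ⟶ h.domain.toScheme),
    κ ≫ h.domain.ι = φ.source.ι ≫ ι' ∧ κ ≫ h.hom = φ.iso.hom ≫ φ.target.ι ≫ ι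

end StringMirror

end

open StringMirror

noncomputable section

open CategoryTheory AlgebraicGeometry

namespace StringMirror

/-! ### Positions of the strings -/

section Positions

variable {n N : ℕ}

/-! Write D = t_i t_k + C t_j. Substituting the components of the map gives h_a^*(T^M) = C^(M_k -
M_j) D^(M_i - M_k) T^(M*), where M* has the exponents (M_j + M_k - M_i, M_k, M_j) at i, j, k and
agrees with M elsewhere (`prod_hComponent`). So everything depends on M_i - M_k: for 0 a monomial
goes to a monomial, for 1 it splits into two, and for -1 a factor 1/D appears, which disappears only
when two suitable monomials occur with coefficients in the ratio C (`hPullback_merge`). For the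
λ-terms, λ_j splits into λ'_i and λ'_k, while λ_i and λ_k merge into λ'_j; the value C =
a_{λ_k}/a_{λ_i} is the one that makes this merging work. For the string terms three things are
needed: the exponents at i, j, k are among those of `moveTable`; the vectors which the table
produces are again string vectors of the new word (`stringVectors_exchange`); and partners have
coefficients in the ratio C, which is the box equation of the box bounded by i and k
(`stringCoef_pair`).

The exchange of string inequalities is local. The three crossings of the move form a triangle of
three strings, and a rigorous path passes through it in at most one contiguous fragment
(`Triangle.decompose`). This rests on `no_return`, and that on a monotonicity principle
(`side_monotone`): if a walk uses, besides u, only upward strings smaller than u and downward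
strings larger than u, then it crosses u only from right to left. Removing upward strings from the
largest one down makes the principle available for one string after the other. What a path may do
inside the triangle is a finite matter (`triPathsFrom_exchange`), and a fragment can be replaced by
one of the moved triangle with the same ends (`isRigorousPath_replace`).

For the box equations after the move, each box of the new word is compared with a box of the old
one; only the box bounded by i and k is treated separately. The local exponents are again compared
by finite checks. A single combination fails, for a box that the triangle touches from the side, and
it never occurs (`not_box_pair`): a telescoping weight shows that both paths belong to the same k
(`bend_eq_of_box`), and monotonicity shows that a path which turns at the end of a box in the
prescribed way avoids certain crossings beside it.

Finally h_a^* fixes D and squares to the identity, so it extends to an involution of the ring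
localized at D which maps f to f'. On the divisor D = 0, itself a torus, both f and f' have constant
term 1; hence D is a nonzerodivisor modulo each of them, the open sets D ≠ 0 are dense in the two
hypersurfaces, and the involution identifies them. -/

/-- The position of the string `s` just below the first `m` crossings. -/
def pos (w : Word n N) (m : ℕ) (s : Fin (n + 1)) : ℕ := ((arrangement w m).symm s : Fin (n + 1))

theorem arrangement_zero (w : Word n N) : arrangement w 0 = 1 := by
  simp [arrangement]

theorem arrangement_succ (w : Word n N) (v : Fin N) :
    arrangement w (v + 1) = arrangement w v * simpleTransposition (w v) := by
  unfold arrangement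
  simp [List.take_add_one]

theorem arrangement_length (w : Word n N) :
    arrangement w N = ((List.ofFn w).map simpleTransposition).prod := by
  unfold arrangement
  rw [List.take_of_length_le (by simp)]

theorem pos_zero (w : Word n N) (s : Fin (n + 1)) : pos w 0 s = s := by
  simp only [pos, arrangement_zero]
  rfl

theorem pos_injective (w : Word n N) (m : ℕ) : Function.Injective (pos w m) :=
  Fin.val_injective.comp (Equiv.injective _)

theorem pos_inj (w : Word n N) (m : ℕ) {s t : Fin (n + 1)} : pos w m s = pos w m t ↔ s = t :=
  (pos_injective w m).eq_iff

theorem pos_arrangement (w : Word n N) (m : ℕ) (p : Fin (n + 1)) :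
    pos w m (arrangement w m p) = p := by
  simp [pos]

theorem pos_upperLeft (w : Word n N) (v : Fin N) : pos w v (upperLeft w v) = w v := by
  simp [upperLeft, pos_arrangement]

theorem pos_upperRight (w : Word n N) (v : Fin N) : pos w v (upperRight w v) = w v + 1 := by
  simp [upperRight, pos_arrangement]

theorem pos_succ (w : Word n N) (v : Fin N) (s : Fin (n + 1)) :
    pos w (v + 1) s = (simpleTransposition (w v) ((arrangement w v).symm s) : Fin (n + 1)) := by
  unfold pos
  rw [arrangement_succ]
  congr 1

theorem pos_succ_upperLeft (w : Word n N) (v : Fin N) :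
    pos w (v + 1) (upperLeft w v) = w v + 1 := by
  simp [pos_succ, upperLeft, simpleTransposition]

theorem pos_succ_upperRight (w : Word n N) (v : Fin N) :
    pos w (v + 1) (upperRight w v) = w v := by
  simp [pos_succ, upperRight, simpleTransposition]

theorem upperLeft_ne_upperRight (w : Word n N) (v : Fin N) : upperLeft w v ≠ upperRight w v := by
  intro h
  have h1 := pos_upperLeft w v
  have h2 := pos_upperRight w v
  rw [h] at h1
  omega

theorem pos_succ_of_not_meets (w : Word n N) (v : Fin N) {s : Fin (n + 1)}
    (h : ¬ Meets w v s) : pos w (v + 1) s = pos w v s := by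
  unfold Meets at h
  push Not at h
  rw [pos_succ, simpleTransposition, Equiv.swap_apply_of_ne_of_ne]
  · rfl
  · rw [Ne, Equiv.symm_apply_eq]; exact h.1
  · rw [Ne, Equiv.symm_apply_eq]; exact h.2

theorem pos_ne_of_not_meets (w : Word n N) (v : Fin N) {s : Fin (n + 1)} (h : ¬ Meets w v s) :
    pos w v s ≠ w v ∧ pos w v s ≠ w v + 1 := by
  unfold Meets at h
  push Not at h
  rw [← pos_upperRight, ← pos_upperLeft, Ne, Ne, pos_inj, pos_inj]
  exact h

/-- A string which passes through a crossing is on one of its two sides. -/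
theorem Meets.pos_cases {w : Word n N} {v : Fin N} {s : Fin (n + 1)} (h : Meets w v s) :
    (s = upperLeft w v ∧ pos w v s = w v ∧ pos w (v + 1) s = w v + 1) ∨
      (s = upperRight w v ∧ pos w v s = w v + 1 ∧ pos w (v + 1) s = w v) := by
  rcases h with rfl | rfl
  · exact Or.inl ⟨rfl, pos_upperLeft w v, pos_succ_upperLeft w v⟩
  · exact Or.inr ⟨rfl, pos_upperRight w v, pos_succ_upperRight w v⟩

theorem meets_iff_pos (w : Word n N) (v : Fin N) (s : Fin (n + 1)) :
    Meets w v s ↔ pos w v s = w v ∨ pos w v s = w v + 1 := by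
  constructor
  · intro h
    rcases h.pos_cases with h | h <;> simp [h.2.1]
  · intro h
    by_contra hm
    have := pos_ne_of_not_meets w v hm
    tauto

/-- The relative order of two strings only changes at a common crossing. -/
theorem pos_lt_succ_iff (w : Word n N) (v : Fin N) {s t : Fin (n + 1)}
    (h : ¬ (Meets w v s ∧ Meets w v t)) :
    pos w (v + 1) s < pos w (v + 1) t ↔ pos w v s < pos w v t := by
  by_cases hs : Meets w v s
  · have ht : ¬ Meets w v t := fun ht => h ⟨hs, ht⟩
    have h1 := pos_ne_of_not_meets w v ht
    rw [pos_succ_of_not_meets w v ht]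
    rcases hs.pos_cases with h2 | h2 <;> omega
  · have h1 := pos_ne_of_not_meets w v hs
    rw [pos_succ_of_not_meets w v hs]
    by_cases ht : Meets w v t
    · rcases ht.pos_cases with h2 | h2 <;> omega
    · rw [pos_succ_of_not_meets w v ht]

/-- Two words which agree from the crossing `a` to the crossing `b` move the strings in the same
way there. -/
theorem arrangement_congr {w w' : Word n N} {a b : ℕ} (hab : a ≤ b) (hb : b ≤ N)
    (h : ∀ v : Fin N, a ≤ v → (v : ℕ) < b → w' v = w v)
    (ha : arrangement w' a = arrangement w a) : arrangement w' b = arrangement w b := by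
  induction b, hab using Nat.le_induction with
  | base => exact ha
  | succ b hab ih =>
    have hb' : b < N := hb
    rw [arrangement_succ w ⟨b, hb'⟩, arrangement_succ w' ⟨b, hb'⟩, h ⟨b, hb'⟩ hab (by simp)]
    simp only
    rw [ih (by omega) (fun v h1 h2 => h v h1 (by omega))]

end Positions

/-! ### Reduced words -/

section Reduced

variable {n N : ℕ} {w : Word n N}

theorem pos_last (hw : IsReducedLongest w) (s : Fin (n + 1)) : pos w N s = n - s := by
  unfold pos
  rw [arrangement_length, hw.prod_eq]
  have : (Fin.revPerm (n := n + 1)).symm s = s.rev := by simp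
  rw [this, Fin.val_rev]
  omega

/-- Two strings meet in some crossing. -/
theorem exists_crossing (hw : IsReducedLongest w) {s t : Fin (n + 1)} (hst : s < t) :
    ∃ v : Fin N, Meets w v s ∧ Meets w v t := by
  by_contra! hno
  -- Without a common crossing the order at the top would persist to the bottom, where `pos_last`
  -- reverses it.
  have key : ∀ m ≤ N, pos w m s < pos w m t := by
    intro m
    induction m with
    | zero => intro _; simpa [pos_zero] using hst
    | succ m ih =>
      intro hm
      have := pos_lt_succ_iff w ⟨m, hm⟩ (s := s) (t := t) (by
        rintro ⟨h1, h2⟩; exact hno _ h1 h2)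
      exact this.2 (ih (by omega))
  have := key N le_rfl
  rw [pos_last hw, pos_last hw] at this
  have h1 : (s : ℕ) < t := hst
  omega

/-- The unordered pair of the strings which meet in a crossing. -/
def crossingPair (w : Word n N) (v : Fin N) : Finset (Fin (n + 1)) :=
  {upperLeft w v, upperRight w v}

/-- Every pair of strings meets, so the crossings map onto the two-element sets of strings. Both
sets have n(n+1)/2 elements, so this surjection is injective; here the length of the word enters. -/
theorem crossingPair_injective (hw : IsReducedLongest w) :
    Function.Injective (crossingPair w) := by
  have hmaps : ∀ v ∈ (Finset.univ : Finset (Fin N)), crossingPair w v ∈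
      Finset.powersetCard 2 (Finset.univ : Finset (Fin (n + 1))) := by
    intro v _
    rw [Finset.mem_powersetCard]
    exact ⟨Finset.subset_univ _, Finset.card_pair (upperLeft_ne_upperRight w v)⟩
  have hsurj : Set.SurjOn (crossingPair w) (Finset.univ : Finset (Fin N))
      (Finset.powersetCard 2 (Finset.univ : Finset (Fin (n + 1)))) := by
    intro P hP
    rw [Finset.mem_coe, Finset.mem_powersetCard, Finset.card_eq_two] at hP
    obtain ⟨-, s, t, hst, rfl⟩ := hP
    wlog hlt : s < t generalizing s t
    · rw [Finset.pair_comm]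
      exact this t s hst.symm (lt_of_le_of_ne (not_lt.1 hlt) hst.symm)
    obtain ⟨v, hs, ht⟩ := exists_crossing hw hlt
    refine ⟨v, by simp, ?_⟩
    unfold crossingPair
    rcases hs with rfl | rfl <;> rcases ht with rfl | rfl
    · exact absurd rfl hst
    · rfl
    · rw [Finset.pair_comm]
    · exact absurd rfl hst
  have hcard : (Finset.univ : Finset (Fin N)).card ≤
      (Finset.powersetCard 2 (Finset.univ : Finset (Fin (n + 1)))).card := by
    rw [Finset.card_powersetCard, Finset.card_univ, Finset.card_univ, Fintype.card_fin,
      Fintype.card_fin, Nat.choose_two_right, hw.length_eq, Nat.mul_comm]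
    simp
  have := Finset.injOn_of_surjOn_of_card_le (crossingPair w) hmaps hsurj hcard
  simpa using this

/-- Two different strings meet only once. -/
theorem crossing_unique (hw : IsReducedLongest w) {s t : Fin (n + 1)} (hst : s ≠ t) {v u : Fin N}
    (hvs : Meets w v s) (hvt : Meets w v t) (hus : Meets w u s) (hut : Meets w u t) : v = u := by
  apply crossingPair_injective hw
  have : ∀ x, Meets w x s → Meets w x t → crossingPair w x = {s, t} := by
    intro x hs ht
    unfold crossingPair
    rcases hs with rfl | rfl <;> rcases ht with rfl | rfl
    · exact absurd rfl hst
    · rfl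
    · rw [Finset.pair_comm]
    · exact absurd rfl hst
  rw [this v hvs hvt, this u hus hut]

/-- If the larger string arrived on the left, the two would have exchanged their initial order at an
earlier crossing, against `crossing_unique`. -/
theorem upperLeft_lt_upperRight (hw : IsReducedLongest w) (v : Fin N) :
    upperLeft w v < upperRight w v := by
  by_contra! hle
  have hlt : upperRight w v < upperLeft w v :=
    lt_of_le_of_ne hle (upperLeft_ne_upperRight w v).symm
  have key : ∀ m ≤ (v : ℕ), pos w m (upperRight w v) < pos w m (upperLeft w v) := by
    intro m
    induction m with
    | zero => intro _; simpa [pos_zero] using hlt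
    | succ m ih =>
      intro hm
      have hmN : m < N := by omega
      refine (pos_lt_succ_iff w ⟨m, hmN⟩ ?_).2 (ih (by omega))
      rintro ⟨h1, h2⟩
      have := crossing_unique hw hlt.ne h1 h2 (Or.inr rfl) (Or.inl rfl)
      rw [← this] at hm
      simp at hm
  have := key v le_rfl
  rw [pos_upperLeft, pos_upperRight] at this
  omega

/-- Once the string `s` has crossed the larger string `t`, it stays on the right of it. -/
theorem pos_lt_of_succ (hw : IsReducedLongest w) (v : Fin N) {s t : Fin (n + 1)} (hst : s < t)
    (h : pos w (v + 1) s < pos w (v + 1) t) : pos w v s < pos w v t := by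
  by_cases hm : Meets w v s ∧ Meets w v t
  · obtain ⟨h1, h2⟩ := hm
    have := upperLeft_lt_upperRight hw v
    rcases h1 with rfl | rfl <;> rcases h2 with rfl | rfl
    · exact absurd hst (lt_irrefl _)
    · rw [pos_upperLeft, pos_upperRight]; omega
    · exact absurd hst this.not_gt
    · exact absurd hst (lt_irrefl _)
  · exact (pos_lt_succ_iff w v hm).1 h

/-- A pair of strings reverses its order exactly once. Hence increasing order propagates upward and,
in `pos_gt_of_le`, reversed order propagates downward. -/
theorem pos_lt_of_le (hw : IsReducedLongest w) {a b : ℕ} (hab : a ≤ b) (hb : b ≤ N)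
    {s t : Fin (n + 1)} (hst : s < t) (h : pos w b s < pos w b t) : pos w a s < pos w a t := by
  induction b, hab using Nat.le_induction with
  | base => exact h
  | succ b hab ih => exact ih (by omega) (pos_lt_of_succ hw ⟨b, hb⟩ hst h)

theorem pos_gt_of_le (hw : IsReducedLongest w) {a b : ℕ} (hab : a ≤ b) (hb : b ≤ N)
    {s t : Fin (n + 1)} (hst : s < t) (h : pos w a t < pos w a s) : pos w b t < pos w b s := by
  by_contra! hle
  have hne : pos w b s ≠ pos w b t := fun h' => hst.ne ((pos_inj w b).1 h')
  have := pos_lt_of_le hw hab hb hst (lt_of_le_of_ne hle hne)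
  omega

end Reduced

/-! ### Walks along oriented strings -/

section Walks

variable {n N : ℕ} {w : Word n N} {k : Fin n}

theorem IsUp.lt {s t : Fin (n + 1)} (hs : IsUp k s) (ht : ¬ IsUp k t) : s < t :=
  lt_of_le_of_lt hs (not_le.1 ht)

theorem IsUp.of_le {s t : Fin (n + 1)} (ht : IsUp k t) (h : s ≤ t) : IsUp k s := h.trans ht

theorem isUp_castSucc (k : Fin n) : IsUp k k.castSucc := le_rfl

theorem not_isUp_succ (k : Fin n) : ¬ IsUp k k.succ := by
  unfold IsUp
  rw [not_le]
  exact Fin.castSucc_lt_succ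

instance (k : Fin n) (s : Fin (n + 1)) : Decidable (IsUp k s) :=
  inferInstanceAs (Decidable (s ≤ k.castSucc))

/-- The side of the string `u` on which the string `s` is just below the first `m` crossings:
`0` on the right, `2` on the left, and `1` if the strings agree. -/
def side (w : Word n N) (u s : Fin (n + 1)) (m : ℕ) : ℕ :=
  if s = u then 1 else if pos w m s < pos w m u then 2 else 0

/-- The level between crossings from which a passage arrives. -/
def inLevel (k : Fin n) (q : Passage n N) : ℕ :=
  if IsUp k q.inS then q.vertex + 1 else q.vertex

/-- The level between crossings to which a passage leaves. -/
def outLevel (k : Fin n) (q : Passage n N) : ℕ :=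
  if IsUp k q.outS then q.vertex else q.vertex + 1

/-- The side of the string `u` from which a passage arrives. -/
def inSide (w : Word n N) (k : Fin n) (u : Fin (n + 1)) (q : Passage n N) : ℕ :=
  side w u q.inS (inLevel k q)

/-- The side of the string `u` to which a passage leaves. -/
def outSide (w : Word n N) (k : Fin n) (u : Fin (n + 1)) (q : Passage n N) : ℕ :=
  side w u q.outS (outLevel k q)

/-- A passage is followed by another one along an oriented edge of a string in `S`. -/
def Step (w : Word n N) (k : Fin n) (S : Set (Fin (n + 1))) (q r : Passage n N) : Prop :=
  q.outS ∈ S ∧ r.inS = q.outS ∧ OrientedEdge w k q.outS q.vertex r.vertex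

theorem OrientedEdge.meets_left {s : Fin (n + 1)} {v u : Fin N} (h : OrientedEdge w k s v u) :
    Meets w v s := by
  rcases h with ⟨-, h⟩ | ⟨-, h⟩
  · exact h.2.2.1
  · exact h.2.1

theorem OrientedEdge.meets_right {s : Fin (n + 1)} {v u : Fin N} (h : OrientedEdge w k s v u) :
    Meets w u s := by
  rcases h with ⟨-, h⟩ | ⟨-, h⟩
  · exact h.2.1
  · exact h.2.2.1

/-- A string smaller than `u` is left of `u` above their crossing and right of it below, and by `hS`
it is travelled upward; a larger string is right of `u` above and left below, and is travelled
downward. In both cases an edge crosses `u` only from right to left, the direction in which `side`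
grows. -/
theorem Step.outSide_le_inSide (hw : IsReducedLongest w) {S : Set (Fin (n + 1))}
    {q r : Passage n N} (h : Step w k S q r) {u : Fin (n + 1)}
    (hS : ∀ s ∈ S, s ≠ u → (IsUp k s ↔ s < u)) : outSide w k u q ≤ inSide w k u r := by
  obtain ⟨h1, h2, h3⟩ := h
  unfold outSide inSide side inLevel outLevel
  rw [h2]
  by_cases hu : q.outS = u
  · simp [hu]
  have hSu := hS _ h1 hu
  rcases h3 with ⟨hup, h3⟩ | ⟨hup, h3⟩
  · simp only [hu, hup, if_true, if_false]
    split_ifs with h4 h5 <;> try simp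
    exact absurd (pos_lt_of_le hw (Nat.succ_le_of_lt h3.1) q.vertex.2.le (hSu.1 hup) h4) h5
  · simp only [hu, hup, if_false]
    have : u < q.outS := lt_of_le_of_ne (not_lt.1 fun h => hup (hSu.2 h)) (Ne.symm hu)
    split_ifs with h4 h5 <;> try simp
    exact absurd (pos_gt_of_le hw (Nat.succ_le_of_lt h3.1) r.vertex.2.le this h4) h5

/-- The vertex version of the same fact. A path can turn onto `u` only from its right and off `u`
only to its left; staying on one string behaves like an edge; and a turn between two strings other
than `u` happens at a crossing that `u` does not meet. -/
theorem inSide_le_outSide (hw : IsReducedLongest w) {S : Set (Fin (n + 1))}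
    {q : Passage n N} (hin : q.inS ∈ S) (hout : q.outS ∈ S) (hmin : Meets w q.vertex q.inS)
    (hmout : Meets w q.vertex q.outS) {u : Fin (n + 1)}
    (hS : ∀ s ∈ S, s ≠ u → (IsUp k s ↔ s < u)) : inSide w k u q ≤ outSide w k u q := by
  obtain ⟨v, s, t⟩ := q
  simp only [inSide, outSide, inLevel, outLevel, side] at *
  have hlt := upperLeft_lt_upperRight hw v
  have hs := hS s hin
  have ht := hS t hout
  have hdn : ∀ x ∈ S, x ≠ u → ¬ IsUp k x → u < x := fun x hx hne hup =>
    lt_of_le_of_ne (not_lt.1 fun h => hup ((hS x hx hne).2 h)) (Ne.symm hne)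
  by_cases hsu : s = u <;> by_cases htu : t = u
  · simp [hsu, htu]
  · simp only [hsu, htu, if_true, if_false]
    subst hsu
    have : pos w (if IsUp k t then (v : ℕ) else v + 1) t <
        pos w (if IsUp k t then (v : ℕ) else v + 1) s := by
      split_ifs with hup
      · have h1 := (ht htu).1 hup
        rcases hmin.pos_cases with ⟨rfl, h2⟩ | ⟨rfl, h2⟩ <;>
          rcases hmout.pos_cases with ⟨rfl, h3⟩ | ⟨rfl, h3⟩ <;> omega
      · have h1 := hdn t hout htu hup
        rcases hmin.pos_cases with ⟨rfl, h2⟩ | ⟨rfl, h2⟩ <;>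
          rcases hmout.pos_cases with ⟨rfl, h3⟩ | ⟨rfl, h3⟩ <;> omega
    rw [if_pos this]
    simp
  · simp only [hsu, htu, if_true, if_false]
    subst htu
    have : ¬ pos w (if IsUp k s then (v : ℕ) + 1 else v) s <
        pos w (if IsUp k s then (v : ℕ) + 1 else v) t := by
      split_ifs with hup
      · have h1 := (hs hsu).1 hup
        rcases hmin.pos_cases with ⟨rfl, h2⟩ | ⟨rfl, h2⟩ <;>
          rcases hmout.pos_cases with ⟨rfl, h3⟩ | ⟨rfl, h3⟩ <;> omega
      · have h1 := hdn s hin hsu hup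
        rcases hmin.pos_cases with ⟨rfl, h2⟩ | ⟨rfl, h2⟩ <;>
          rcases hmout.pos_cases with ⟨rfl, h3⟩ | ⟨rfl, h3⟩ <;> omega
    rw [if_neg this]
    simp
  · simp only [hsu, htu, if_false]
    suffices h : pos w (if IsUp k s then (v : ℕ) + 1 else v) s <
        pos w (if IsUp k s then (v : ℕ) + 1 else v) u →
        pos w (if IsUp k t then (v : ℕ) else v + 1) t <
        pos w (if IsUp k t then (v : ℕ) else v + 1) u by
      by_cases h4 : pos w (if IsUp k s then (v : ℕ) + 1 else v) s <
        pos w (if IsUp k s then (v : ℕ) + 1 else v) u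
      · simp [h4, h h4]
      · rw [if_neg h4]; simp
    by_cases hst : s = t
    · subst hst
      split_ifs with hup
      · exact pos_lt_of_succ hw v ((hs hsu).1 hup)
      · exact pos_gt_of_le hw (Nat.le_succ _) v.2 (hdn s hin hsu hup)
    · have hum : ¬ Meets w v u := by
        rintro (rfl | rfl) <;> rcases hmin with rfl | rfl <;> rcases hmout with rfl | rfl <;> tauto
      have h1 := pos_ne_of_not_meets w v hum
      have h2 := pos_succ_of_not_meets w v hum
      rcases hmin.pos_cases with h3 | h3 <;> rcases hmout.pos_cases with h4 | h4 <;>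
        split_ifs <;> omega

theorem Step.mono {S T : Set (Fin (n + 1))} {q r : Passage n N} (h : Step w k S q r)
    (hST : q.outS ∈ S → q.outS ∈ T) : Step w k T q r := ⟨hST h.1, h.2⟩

theorem Step.transGen_mono {S T : Set (Fin (n + 1))} {q r : Passage n N}
    (hST : ∀ a b, Step w k S a b → Step w k T a b) (h : Relation.TransGen (Step w k S) q r) :
    Relation.TransGen (Step w k T) q r := by
  induction h with
  | single h => exact .single (hST _ _ h)
  | tail _ h ih => exact ih.tail (hST _ _ h)

theorem transGen_out_mem {S : Set (Fin (n + 1))} {q r : Passage n N}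
    (h : Relation.TransGen (Step w k S) q r) : q.outS ∈ S := by
  induction h using Relation.TransGen.head_induction_on with
  | single h => exact h.1
  | head h _ _ => exact h.1

/-- Along a walk the side of `u` never decreases; if it does not change, then the walk avoids
`u`. -/
theorem side_monotone (hw : IsReducedLongest w) {S : Set (Fin (n + 1))} {u : Fin (n + 1)}
    (hS : ∀ s ∈ S, s ≠ u → (IsUp k s ↔ s < u)) {q r : Passage n N}
    (h : Relation.TransGen (Step w k S) q r) :
    outSide w k u q ≤ inSide w k u r ∧
      (outSide w k u q = inSide w k u r → outSide w k u q ≠ 1 →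
        Relation.TransGen (Step w k (S \ {u})) q r) := by
  have hne : ∀ q : Passage n N, outSide w k u q ≠ 1 → q.outS ≠ u := by
    intro q h h'
    exact h (by simp [outSide, side, h'])
  induction h with
  | single h =>
    exact ⟨h.outSide_le_inSide hw hS, fun _ h1 =>
      Relation.TransGen.single (h.mono fun h2 => ⟨h2, hne _ h1⟩)⟩
  | @tail r r' h1 h2 ih =>
    obtain ⟨q', hq'⟩ : ∃ q', Step w k S q' r := by
      cases h1 with
      | single h => exact ⟨_, h⟩
      | tail _ h => exact ⟨_, h⟩
    have e1 : inSide w k u r ≤ outSide w k u r :=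
      inSide_le_outSide hw (hq'.2.1 ▸ hq'.1) h2.1 (hq'.2.1 ▸ hq'.2.2.meets_right)
        h2.2.2.meets_left hS
    have e2 := h2.outSide_le_inSide hw hS
    -- Equal sides at the two ends force a constant side in between. As it differs from 1, no
    -- passage leaves along `u`.
    refine ⟨by omega, fun e3 e4 => ?_⟩
    refine (ih.2 (by omega) e4).tail (h2.mono fun h3 => ⟨h3, hne _ ?_⟩)
    omega

/-- A walk which starts and ends on `u` stays on `u`. -/
theorem stays_on (hw : IsReducedLongest w) {S : Set (Fin (n + 1))} {u : Fin (n + 1)}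
    (hS : ∀ s ∈ S, s ≠ u → (IsUp k s ↔ s < u)) {q r : Passage n N}
    (h : Relation.TransGen (Step w k S) q r) (hq : q.outS = u) (hr : r.inS = u) :
    Relation.TransGen (Step w k {u}) q r := by
  induction h using Relation.TransGen.head_induction_on with
  | single h => exact .single (h.mono fun _ => hq)
  | @head q q' h1 h2 ih =>
    refine .head (h1.mono fun _ => hq) (ih ?_)
    have hin : q'.inS = u := h1.2.1.trans hq
    have hout := transGen_out_mem h2
    have hmeets : Meets w q'.vertex q'.outS := by
      cases h2 using Relation.TransGen.head_induction_on with
      | single h => exact h.2.2.meets_left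
      | head h _ _ => exact h.2.2.meets_left
    have e1 : inSide w k u q' ≤ outSide w k u q' :=
      inSide_le_outSide hw (h1.2.1 ▸ h1.1) hout (h1.2.1 ▸ h1.2.2.meets_right) hmeets hS
    have e2 := (side_monotone hw hS h2).1
    have e3 : inSide w k u q' = 1 := by simp [inSide, side, hin]
    have e4 : inSide w k u r = 1 := by simp [inSide, side, hr]
    -- Leaving `u` raises the side from 1 to 2, and by monotonicity it could not be 1 again at `r`.
    by_contra hne
    have e5 : outSide w k u q' ≠ 1 := by
      simp only [outSide, side, hne, if_false]
      split_ifs <;> simp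
    omega

/-- A walk between two places on the same side of all upward strings outside of `T` avoids
these strings, if `T` is an initial segment. -/
theorem avoids_up (hw : IsReducedLongest w) {q r : Passage n N} {u₀ : ℕ}
    (h : Relation.TransGen (Step w k Set.univ) q r)
    (hu : ∀ u : Fin (n + 1), IsUp k u → u₀ ≤ (u : ℕ) →
      outSide w k u q = inSide w k u r ∧ outSide w k u q ≠ 1) :
    Relation.TransGen (Step w k {s | IsUp k s → (s : ℕ) < u₀}) q r := by
  -- Upward strings are removed one at a time, from the largest one, `k`, down to `u₀`. Once those
  -- above `t` are gone, the other upward strings in use are smaller than `t` and all downward ones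
  -- are larger, so `side_monotone` applies to the string `t`.
  have key : ∀ d : ℕ, ∀ t : ℕ, t + d = k + 1 → u₀ ≤ t →
      Relation.TransGen (Step w k {s | IsUp k s → (s : ℕ) < t}) q r := by
    intro d
    induction d with
    | zero =>
      intro t ht _
      refine Step.transGen_mono (fun a b hab => hab.mono fun _ => ?_) h
      intro h1
      have : (a.outS : ℕ) ≤ k := h1
      omega
    | succ d ih =>
      intro t ht htu
      have h1 := ih (t + 1) (by omega) (by omega)
      have htk : t ≤ (k : ℕ) := by omega
      let u : Fin (n + 1) := ⟨t, by omega⟩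
      have huu : IsUp k u := htk
      obtain ⟨e1, e2⟩ := hu u huu htu
      have h2 := (side_monotone hw (u := u) ?_ h1).2 e1 e2
      · refine Step.transGen_mono (fun a b hab => hab.mono ?_) h2
        rintro ⟨h3, h4⟩ h5
        have h6 := h3 h5
        have h7 : (a.outS : ℕ) ≠ t := fun h => h4 (Fin.ext h)
        omega
      · intro s hs hsu
        constructor
        · intro h3
          have h4 := hs h3
          have h7 : (s : ℕ) ≠ t := fun h => hsu (Fin.ext h)
          show (s : ℕ) < t
          omega
        · intro h3
          exact huu.of_le h3.le
  by_cases hle : u₀ ≤ k + 1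
  · exact key (k + 1 - u₀) u₀ (by omega) le_rfl
  · refine Step.transGen_mono (fun a b hab => hab.mono fun _ => ?_) h
    intro h1
    have : (a.outS : ℕ) ≤ k := h1
    omega

/-- The analogue of `avoids_up` for the downward strings. -/
theorem avoids_down (hw : IsReducedLongest w) {q r : Passage n N} {u₀ : ℕ}
    (h : Relation.TransGen (Step w k Set.univ) q r)
    (hu : ∀ u : Fin (n + 1), ¬ IsUp k u → (u : ℕ) < u₀ →
      outSide w k u q = inSide w k u r ∧ outSide w k u q ≠ 1) :
    Relation.TransGen (Step w k {s | ¬ IsUp k s → u₀ ≤ (s : ℕ)}) q r := by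
  -- Downward strings are removed in increasing order, starting with `k + 1`.
  have key : ∀ d : ℕ, k + 1 + d ≤ u₀ → k + 1 + d ≤ n + 1 →
      Relation.TransGen (Step w k {s | ¬ IsUp k s → k + 1 + d ≤ (s : ℕ)}) q r := by
    intro d
    induction d with
    | zero =>
      intro _ _
      refine Step.transGen_mono (fun a b hab => hab.mono fun _ => ?_) h
      intro h1
      have : ¬ (a.outS : ℕ) ≤ k := h1
      omega
    | succ d ih =>
      intro htu htn
      have h1 := ih (by omega) (by omega)
      let u : Fin (n + 1) := ⟨k + 1 + d, by omega⟩
      have huu : ¬ IsUp k u := by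
        intro h
        have : k + 1 + d ≤ (k : ℕ) := h
        omega
      obtain ⟨e1, e2⟩ := hu u huu (by show k + 1 + d < u₀; omega)
      have h2 := (side_monotone hw (u := u) ?_ h1).2 e1 e2
      · refine Step.transGen_mono (fun a b hab => hab.mono ?_) h2
        rintro ⟨h3, h4⟩ h5
        have h6 := h3 h5
        have h7 : (a.outS : ℕ) ≠ k + 1 + d := fun h => h4 (Fin.ext h)
        omega
      · intro s hs hsu
        constructor
        · intro h3
          exact h3.lt huu
        · intro h3
          by_contra h4
          have h5 : k + 1 + d ≤ (s : ℕ) := hs h4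
          have h6 : (s : ℕ) < k + 1 + d := h3
          omega
  by_cases hle : k + 1 ≤ u₀
  -- The bound `u₀` may exceed the number of strings; the removal then stops at `n + 1`.
  · have hmin : k + 1 + (min u₀ (n + 1) - (k + 1)) = min u₀ (n + 1) := by omega
    have := key (min u₀ (n + 1) - (k + 1)) (by omega) (by omega)
    by_cases hn : u₀ ≤ n + 1
    · rw [hmin, min_eq_left hn] at this
      exact this
    · rw [hmin, min_eq_right (by omega)] at this
      refine Step.transGen_mono (fun a b hab => hab.mono fun h3 h4 => ?_) this
      have := h3 h4
      omega
  · refine Step.transGen_mono (fun a b hab => hab.mono fun _ => ?_) h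
    intro h1
    have : ¬ (a.outS : ℕ) ≤ k := h1
    omega

/-- Walks on downward strings go down. -/
theorem vertex_lt_of_down {q r : Passage n N}
    (h : Relation.TransGen (Step w k {s | ¬ IsUp k s}) q r) : q.vertex < r.vertex := by
  have h1 : ∀ a b, Step w k {s | ¬ IsUp k s} a b → a.vertex < b.vertex := by
    rintro a b ⟨h1, -, h3⟩
    rcases h3 with ⟨h4, -⟩ | ⟨-, h4⟩
    · exact absurd h4 h1
    · exact h4.1
  induction h with
  | single h => exact h1 _ _ h
  | tail _ h ih => exact ih.trans (h1 _ _ h)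

/-- Walks on upward strings go up. -/
theorem vertex_lt_of_up {q r : Passage n N}
    (h : Relation.TransGen (Step w k {s | IsUp k s}) q r) : r.vertex < q.vertex := by
  have h1 : ∀ a b, Step w k {s | IsUp k s} a b → b.vertex < a.vertex := by
    rintro a b ⟨h1, -, h3⟩
    rcases h3 with ⟨-, h4⟩ | ⟨h4, -⟩
    · exact h4.1
    · exact absurd h1 h4
  induction h with
  | single h => exact h1 _ _ h
  | tail _ h ih => exact (h1 _ _ h).trans ih

end Walks

/-! ### Three consecutive crossings of three strings -/

/-- The left strings at three consecutive crossings of three strings, in both possible orders. -/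
def triLeft (ty : Bool) : Fin 3 → Fin 3 := if ty then ![0, 0, 1] else ![1, 0, 0]

/-- The right strings at three consecutive crossings of three strings, in both possible orders. -/
def triRight (ty : Bool) : Fin 3 → Fin 3 := if ty then ![1, 2, 2] else ![2, 2, 1]

/-- The strings `st 0 < st 1 < st 2` cross each other in the consecutive crossings `vx 0`, `vx 1`,
`vx 2`. -/
structure Triangle {n N : ℕ} (w : Word n N) (vx : Fin 3 → Fin N) (st : Fin 3 → Fin (n + 1))
    (ty : Bool) : Prop where
  vx_eq : ∀ x, (vx x : ℕ) = vx 0 + x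
  st_mono : StrictMono st
  upperLeft_eq : ∀ x, upperLeft w (vx x) = st (triLeft ty x)
  upperRight_eq : ∀ x, upperRight w (vx x) = st (triRight ty x)

section Triangle

variable {n N : ℕ} {w : Word n N} {vx : Fin 3 → Fin N} {st : Fin 3 → Fin (n + 1)} {ty : Bool}
  {k : Fin n}

/-- Beyond its passage through `vx x`, the string `s` meets none of the crossings `vx`. -/
def IsExit (w : Word n N) (vx : Fin 3 → Fin N) (k : Fin n) (s : Fin (n + 1)) (x : Fin 3) : Prop :=
  ∀ y, Meets w (vx y) s → if IsUp k s then x ≤ y else y ≤ x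

/-- Before its passage through `vx x`, the string `s` meets none of the crossings `vx`. -/
def IsEntry (w : Word n N) (vx : Fin 3 → Fin N) (k : Fin n) (s : Fin (n + 1)) (x : Fin 3) : Prop :=
  ∀ y, Meets w (vx y) s → if IsUp k s then y ≤ x else x ≤ y

namespace Triangle

theorem vx_le (T : Triangle w vx st ty) {x y : Fin 3} : vx x ≤ vx y ↔ x ≤ y := by
  rw [Fin.le_def, Fin.le_def, T.vx_eq x, T.vx_eq y]
  omega

theorem vx_lt (T : Triangle w vx st ty) {x y : Fin 3} : vx x < vx y ↔ x < y := by
  rw [Fin.lt_def, Fin.lt_def, T.vx_eq x, T.vx_eq y]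
  omega

theorem vx_injective (T : Triangle w vx st ty) : Function.Injective vx := by
  intro x y h
  have := congrArg Fin.val h
  rw [T.vx_eq x, T.vx_eq y] at this
  exact Fin.ext (by omega)

theorem mem_range (T : Triangle w vx st ty) {v : Fin N} :
    v ∈ Set.range vx ↔ vx 0 ≤ v ∧ v ≤ vx 2 := by
  have h2 := T.vx_eq 2
  constructor
  · rintro ⟨x, rfl⟩
    exact ⟨T.vx_le.2 (Fin.zero_le x), T.vx_le.2 (Fin.le_last x)⟩
  · rintro ⟨h3, h4⟩
    rw [Fin.le_def] at h3 h4
    rw [h2] at h4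
    refine ⟨⟨v - vx 0, by simp at h4; omega⟩, Fin.ext ?_⟩
    rw [T.vx_eq]
    simp
    omega

theorem meets_iff (T : Triangle w vx st ty) {x : Fin 3} {s : Fin (n + 1)} :
    Meets w (vx x) s ↔ s = st (triLeft ty x) ∨ s = st (triRight ty x) := by
  unfold Meets
  rw [T.upperLeft_eq, T.upperRight_eq]

theorem mem_range_of_meets (T : Triangle w vx st ty) {x : Fin 3} {s : Fin (n + 1)}
    (h : Meets w (vx x) s) : s ∈ Set.range st := by
  rcases T.meets_iff.1 h with rfl | rfl <;> exact ⟨_, rfl⟩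

/-- Two of the strings meet in one of the crossings. -/
theorem exists_meets (T : Triangle w vx st ty) {a b : Fin 3} (hab : a ≠ b) :
    ∃ x, Meets w (vx x) (st a) ∧ Meets w (vx x) (st b) := by
  have : ∀ ty : Bool, ∀ a b : Fin 3, a ≠ b → ∃ x, (a = triLeft ty x ∨ a = triRight ty x) ∧
      (b = triLeft ty x ∨ b = triRight ty x) := by decide
  obtain ⟨x, h1, h2⟩ := this ty a b hab
  refine ⟨x, T.meets_iff.2 ?_, T.meets_iff.2 ?_⟩
  · rcases h1 with rfl | rfl <;> simp
  · rcases h2 with rfl | rfl <;> simp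

theorem exists_meets_one (T : Triangle w vx st ty) (a : Fin 3) :
    ∃ x, Meets w (vx x) (st a) := by
  obtain ⟨b, hb⟩ : ∃ b, a ≠ b := ⟨a + 1, by revert a; decide⟩
  exact (T.exists_meets hb).imp fun _ h => h.1

/-- Another string is on the same side of all three crossings. -/
theorem left_iff (T : Triangle w vx st ty) {u : Fin (n + 1)} (hu : u ∉ Set.range st)
    {x y : Fin 3} {s t : Fin (n + 1)} (hs : Meets w (vx x) s) (ht : Meets w (vx y) t) {a b : ℕ}
    (ha : a = vx x ∨ a = vx x + 1) (hb : b = vx y ∨ b = vx y + 1) :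
    pos w a s < pos w a u ↔ pos w b t < pos w b u := by
  have hum : ∀ x, ¬ Meets w (vx x) u := fun x h => hu (T.mem_range_of_meets h)
  -- At a single crossing the two strings are neighbours just above and just below it, so a third
  -- string has both on one side. Successive crossings of the triangle share a string and the level
  -- between them, and this links the three.
  have key : ∀ x s t, Meets w (vx x) s → Meets w (vx x) t → ∀ a b,
      (a = (vx x : ℕ) ∨ a = vx x + 1) → (b = (vx x : ℕ) ∨ b = vx x + 1) →
      (pos w a s < pos w a u ↔ pos w b t < pos w b u) := by
    intro x s t hs ht a b ha hb
    have h1 := pos_ne_of_not_meets w _ (hum x)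
    have h2 := pos_succ_of_not_meets w _ (hum x)
    rcases hs.pos_cases with h3 | h3 <;> rcases ht.pos_cases with h4 | h4 <;>
      rcases ha with rfl | rfl <;> rcases hb with rfl | rfl <;> omega
  have e1 : (vx 1 : ℕ) = vx 0 + 1 := by simpa using T.vx_eq 1
  have e2 : (vx 2 : ℕ) = vx 1 + 1 := by rw [e1]; simpa using T.vx_eq 2
  have h01 : ∃ s, Meets w (vx 0) s ∧ Meets w (vx 1) s := by
    cases ty
    · exact ⟨st 2, T.meets_iff.2 (Or.inr rfl), T.meets_iff.2 (Or.inr rfl)⟩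
    · exact ⟨st 0, T.meets_iff.2 (Or.inl rfl), T.meets_iff.2 (Or.inl rfl)⟩
  have h12 : ∃ s, Meets w (vx 1) s ∧ Meets w (vx 2) s := by
    cases ty
    · exact ⟨st 0, T.meets_iff.2 (Or.inl rfl), T.meets_iff.2 (Or.inl rfl)⟩
    · exact ⟨st 2, T.meets_iff.2 (Or.inr rfl), T.meets_iff.2 (Or.inr rfl)⟩
  obtain ⟨s1, h1, h1'⟩ := h01
  obtain ⟨s2, h2, h2'⟩ := h12
  have ref : ∀ x s, Meets w (vx x) s → ∀ a, (a = (vx x : ℕ) ∨ a = vx x + 1) →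
      (pos w a s < pos w a u ↔ pos w (vx 1) s1 < pos w (vx 1) u) := by
    intro x s hs a ha
    match x with
    | 0 => exact key 0 s s1 hs h1 a (vx 1) ha (Or.inr e1)
    | 1 => exact key 1 s s1 hs h1' a (vx 1) ha (Or.inl rfl)
    | 2 =>
      rw [key 2 s s2 hs h2' a (vx 2) ha (Or.inl rfl)]
      exact key 1 s2 s1 h2 h1' (vx 2) (vx 1) (Or.inr e2) (Or.inl rfl)
  rw [ref x s hs a ha, ref y t ht b hb]

theorem inLevel_cases (q : Passage n N) :
    inLevel k q = q.vertex ∨ inLevel k q = q.vertex + 1 := by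
  unfold inLevel
  split_ifs <;> simp

theorem outLevel_cases (q : Passage n N) :
    outLevel k q = q.vertex ∨ outLevel k q = q.vertex + 1 := by
  unfold outLevel
  split_ifs <;> simp

/-- On leaving the triangle, a walk is to the left of the upward string `u` of the triangle. -/
theorem outSide_eq_two (hw : IsReducedLongest w) (T : Triangle w vx st ty) {q : Passage n N}
    {x b : Fin 3} (hq : q.vertex = vx x) (hm : Meets w q.vertex q.outS)
    (hexit : IsExit w vx k q.outS x) (hne : q.outS ≠ st b) (hup : IsUp k (st b))
    (hmax : IsUp k q.outS → q.outS < st b) : outSide w k (st b) q = 2 := by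
  obtain ⟨a, ha⟩ := T.mem_range_of_meets (hq ▸ hm)
  obtain ⟨z, hz1, hz2⟩ := T.exists_meets (a := a) (b := b) (fun h => hne (h ▸ ha.symm))
  rw [ha] at hz1
  have hlt := upperLeft_lt_upperRight hw (vx z)
  unfold outSide side outLevel
  rw [if_neg hne, if_pos]
  rw [hq]
  -- At an exit the crossing `z` with `st b` is not ahead on the string `q.outS`. If that string
  -- goes up, it is smaller than `st b` and is now above `z`; if it goes down, it is larger and is
  -- now below `z`. Either way it is on the left of `st b`.
  have h1 := hexit z hz1
  split_ifs at h1 ⊢ with h2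
  · have h3 := hmax h2
    refine pos_lt_of_le hw (Fin.le_def.1 (T.vx_le.2 h1)) (vx z).2.le h3 ?_
    rcases hz1.pos_cases with ⟨e1, h5⟩ | ⟨e1, h5⟩ <;>
      rcases hz2.pos_cases with ⟨e2, h6⟩ | ⟨e2, h6⟩ <;>
      first
      | exact absurd (e1.trans e2.symm) hne
      | omega
  · have h3 := hup.lt h2
    refine pos_gt_of_le hw (Nat.add_le_add_right (Fin.le_def.1 (T.vx_le.2 h1)) 1) (vx x).2 h3 ?_
    rcases hz1.pos_cases with ⟨e1, h5⟩ | ⟨e1, h5⟩ <;>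
      rcases hz2.pos_cases with ⟨e2, h6⟩ | ⟨e2, h6⟩ <;>
      first
      | exact absurd (e1.trans e2.symm) hne
      | omega

/-- On entering the triangle, a walk is to the right of the upward string `u` of the triangle. -/
theorem inSide_eq_zero (hw : IsReducedLongest w) (T : Triangle w vx st ty) {q : Passage n N}
    {x b : Fin 3} (hq : q.vertex = vx x) (hm : Meets w q.vertex q.inS)
    (hentry : IsEntry w vx k q.inS x) (hne : q.inS ≠ st b) (hup : IsUp k (st b))
    (hmax : IsUp k q.inS → q.inS < st b) : inSide w k (st b) q = 0 := by
  obtain ⟨a, ha⟩ := T.mem_range_of_meets (hq ▸ hm)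
  obtain ⟨z, hz1, hz2⟩ := T.exists_meets (a := a) (b := b) (fun h => hne (h ▸ ha.symm))
  rw [ha] at hz1
  have hlt := upperLeft_lt_upperRight hw (vx z)
  unfold inSide side inLevel
  rw [if_neg hne, if_neg]
  rw [hq]
  -- At an entry the crossing `z` is not yet passed, which by the same comparison puts the incoming
  -- string on the right of `st b`.
  have h1 := hentry z hz1
  split_ifs at h1 ⊢ with h2
  · have h3 := hmax h2
    refine (pos_gt_of_le hw (Nat.add_le_add_right (Fin.le_def.1 (T.vx_le.2 h1)) 1) (vx x).2 h3 ?_).not_gt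
    rcases hz1.pos_cases with ⟨e1, h5⟩ | ⟨e1, h5⟩ <;>
      rcases hz2.pos_cases with ⟨e2, h6⟩ | ⟨e2, h6⟩ <;>
      first
      | exact absurd (e1.trans e2.symm) hne
      | omega
  · have h3 := hup.lt h2
    refine (pos_lt_of_le hw (Fin.le_def.1 (T.vx_le.2 h1)) (vx z).2.le h3 ?_).not_gt
    rcases hz1.pos_cases with ⟨e1, h5⟩ | ⟨e1, h5⟩ <;>
      rcases hz2.pos_cases with ⟨e2, h6⟩ | ⟨e2, h6⟩ <;>
      first
      | exact absurd (e1.trans e2.symm) hne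
      | omega

/-- A walk which has left the triangle does not return to it. -/
theorem no_return (hw : IsReducedLongest w) (T : Triangle w vx st ty) {q r : Passage n N}
    {x y : Fin 3} (hq : q.vertex = vx x) (hr : r.vertex = vx y) (hqm : Meets w q.vertex q.outS)
    (hrm : Meets w r.vertex r.inS) (hexit : IsExit w vx k q.outS x)
    (hentry : IsEntry w vx k r.inS y) (h : Relation.TransGen (Step w k Set.univ) q r) : False := by
  have other : ∀ u, u ∉ Set.range st → outSide w k u q = inSide w k u r ∧ outSide w k u q ≠ 1 := by
    intro u hu
    have h1 : q.outS ≠ u := fun h => hu (h ▸ T.mem_range_of_meets (hq ▸ hqm))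
    have h2 : r.inS ≠ u := fun h => hu (h ▸ T.mem_range_of_meets (hr ▸ hrm))
    have h3 := T.left_iff hu (hq ▸ hqm) (hr ▸ hrm) (hq ▸ outLevel_cases (k := k) q)
      (hr ▸ inLevel_cases (k := k) r)
    unfold outSide inSide side
    rw [if_neg h1, if_neg h2]
    constructor
    · simp only [h3]
    · split_ifs <;> simp
  by_cases hloc : ∃ b, IsUp k (st b)
  -- Let `st b` be the largest upward string of the triangle. Larger upward strings lie outside the
  -- triangle and are avoided, so the side of `st b` is monotone along the walk. But the walk leaves
  -- the triangle on `st b` or to its left, and returns on `st b` or to its right.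
  · obtain ⟨b, hb, hmax⟩ : ∃ b, IsUp k (st b) ∧ ∀ a, IsUp k (st a) → a ≤ b := by
      have hne : (Finset.univ.filter fun b => IsUp k (st b)).Nonempty := by
        obtain ⟨b, hb⟩ := hloc
        exact ⟨b, by simpa using hb⟩
      refine ⟨_, (Finset.mem_filter.1 (Finset.max'_mem _ hne)).2, fun a ha => ?_⟩
      exact Finset.le_max' _ _ (by simpa using ha)
    have hmax' : ∀ s, s ∈ Set.range st → s ≠ st b → IsUp k s → s < st b := by
      rintro _ ⟨a, rfl⟩ hne hup
      exact T.st_mono (lt_of_le_of_ne (hmax a hup) fun h => hne (h ▸ rfl))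
    have h1 := avoids_up hw (u₀ := (st b : ℕ) + 1) h (fun u hu hlt => other u (by
      rintro ⟨a, rfl⟩
      have h2 := Fin.le_def.1 (T.st_mono.monotone (hmax a hu))
      omega))
    have hS : ∀ s ∈ {s : Fin (n + 1) | IsUp k s → (s : ℕ) < st b + 1}, s ≠ st b →
        (IsUp k s ↔ s < st b) := by
      intro s hs hne
      constructor
      · intro h3
        exact lt_of_le_of_ne (Nat.lt_succ_iff.1 (hs h3)) hne
      · intro h3
        exact hb.of_le h3.le
    have h2 := (side_monotone hw hS h1).1
    have hqr := T.mem_range_of_meets (hq ▸ hqm)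
    have hrr := T.mem_range_of_meets (hr ▸ hrm)
    by_cases h3 : r.inS = st b
    · by_cases h4 : q.outS = st b
      -- The remaining case: both ends are on `st b`. The walk then climbs along `st b`, which meets
      -- no further crossing of the triangle after the exit.
      · have h5 := stays_on hw hS h1 h4 h3
        have h6 := vertex_lt_of_up (Step.transGen_mono (T := {s | IsUp k s})
          (fun a c hac => hac.mono fun h => by
            rw [Set.mem_singleton_iff] at h
            simpa [h] using hb) h5)
        have h7 := hexit y (by rw [h4, ← h3, ← hr]; exact hrm)
        rw [if_pos (h4 ▸ hb)] at h7
        rw [hq, hr, T.vx_lt] at h6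
        exact absurd h6 h7.not_gt
      · have h5 := T.outSide_eq_two hw hq hqm hexit h4 hb (hmax' _ hqr h4)
        have h6 : inSide w k (st b) r = 1 := by simp [inSide, side, h3]
        omega
    · have h5 := T.inSide_eq_zero hw hr hrm hentry h3 hb (hmax' _ hrr h3)
      by_cases h4 : q.outS = st b
      · have h6 : outSide w k (st b) q = 1 := by simp [outSide, side, h4]
        omega
      · have h6 := T.outSide_eq_two hw hq hqm hexit h4 hb (hmax' _ hqr h4)
        omega
  -- Now no string of the triangle goes up, every upward string is avoided, and the walk descends.
  -- Its first crossing after `q` lies between two crossings of the triangle, hence belongs to it,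
  -- contrary to `hexit`.
  · push Not at hloc
    have h1 := avoids_up hw (u₀ := 0) h (fun u hu _ => other u (by
      rintro ⟨a, rfl⟩
      exact hloc a hu))
    have h2 : Relation.TransGen (Step w k {s | ¬ IsUp k s}) q r :=
      Step.transGen_mono (S := {s | IsUp k s → (s : ℕ) < 0}) (fun a c hac => hac.mono fun h hup => Nat.not_lt_zero _ (h hup)) h1
    have h3 := transGen_out_mem h2
    have h4 : ∃ q', Step w k {s | ¬ IsUp k s} q q' ∧ q'.vertex ≤ r.vertex := by
      cases h2 using Relation.TransGen.head_induction_on with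
      | single h => exact ⟨_, h, le_rfl⟩
      | head h h' _ => exact ⟨_, h, (vertex_lt_of_down h').le⟩
    obtain ⟨q', h5, h6⟩ := h4
    have h7 : q.vertex < q'.vertex := vertex_lt_of_down (.single h5)
    have h8 : q'.vertex ∈ Set.range vx := by
      rw [T.mem_range]
      refine ⟨?_, h6.trans ?_⟩
      · refine le_trans ?_ h7.le
        rw [hq, T.vx_le]
        exact Fin.zero_le x
      · rw [hr, T.vx_le]
        exact Fin.le_last y
    obtain ⟨z, hz⟩ := h8
    have h9 := hexit z (by rw [hz]; exact h5.2.2.meets_right)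
    rw [if_neg h3] at h9
    rw [hq, ← hz, T.vx_lt] at h7
    exact absurd h7 h9.not_gt

end Triangle

end Triangle

/-- The words `w` and `w'` differ by a 3-move at the crossings `vx` of the strings `st`. -/
structure TriangleMove {n N : ℕ} (w w' : Word n N) (vx : Fin 3 → Fin N)
    (st : Fin 3 → Fin (n + 1)) (ty : Bool) : Prop where
  source : Triangle w vx st ty
  target : Triangle w' vx st (!ty)
  upperLeft_eq : ∀ v ∉ Set.range vx, upperLeft w' v = upperLeft w v
  upperRight_eq : ∀ v ∉ Set.range vx, upperRight w' v = upperRight w v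

theorem IsThreeMove.symm {n N : ℕ} {w w' : Word n N} {i j k : Fin N}
    (h : IsThreeMove w w' i j k) : IsThreeMove w' w i j k where
  hij := h.hij
  hjk := h.hjk
  adjacent := by rw [h.hi', h.hj']; exact h.adjacent.symm
  hki := by rw [h.hk', h.hi']
  hi' := h.hj'.symm
  hj' := h.hi'.symm
  hk' := by rw [h.hj', h.hki]
  hq' q h1 h2 h3 := (h.hq' q h1 h2 h3).symm

/-! ### The braid relation and the triangle of strings at a 3-move. -/

section ThreeMove

variable {n N : ℕ}

/-- Both products are the transposition of the two outer positions. -/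
theorem simpleTransposition_braid {c e : Fin n} (h : (c : ℕ) + 1 = e) :
    simpleTransposition c * simpleTransposition e * simpleTransposition c =
      simpleTransposition e * simpleTransposition c * simpleTransposition e := by
  have hce : e.castSucc = c.succ := Fin.ext (by simp [← h])
  have h1 : c.castSucc ≠ c.succ := Fin.castSucc_lt_succ.ne
  have h2 : c.succ ≠ e.succ := fun h' => by
    have := congrArg Fin.val h'
    simp at this
    omega
  have h3 : c.castSucc ≠ e.succ := fun h' => by
    have := congrArg Fin.val h'
    simp at this
    omega
  unfold simpleTransposition
  rw [hce, Equiv.swap_mul_swap_mul_swap h1 h3, Equiv.swap_comm c.succ e.succ,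
    Equiv.swap_comm c.castSucc c.succ, Equiv.swap_mul_swap_mul_swap h2.symm h3.symm,
    Equiv.swap_comm]

/-- The strings at three consecutive crossings in the columns `c`, `c + 1`, `c`. -/
theorem triangle_true {w : Word n N} (hw : IsReducedLongest w) {i j k : Fin N}
    (hij : (j : ℕ) = i + 1) (hjk : (k : ℕ) = j + 1) (h : (w i : ℕ) + 1 = w j) (hki : w k = w i) :
    Triangle w ![i, j, k] ![arrangement w i (w i).castSucc, arrangement w i (w i).succ,
      arrangement w i (w j).succ] true := by
  have hce : (w j).castSucc = (w i).succ := Fin.ext (by simp [← h])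
  have n1 : (w i).castSucc ≠ (w i).succ := Fin.castSucc_lt_succ.ne
  have n2 : (w i).succ ≠ (w j).succ := fun h' => by
    have := congrArg Fin.val h'
    simp at this
    omega
  have n3 : (w i).castSucc ≠ (w j).succ := fun h' => by
    have := congrArg Fin.val h'
    simp at this
    omega
  have a1 : arrangement w j = arrangement w i * simpleTransposition (w i) := by
    rw [hij, arrangement_succ]
  have a2 : arrangement w k = arrangement w j * simpleTransposition (w j) := by
    rw [hjk, arrangement_succ]
  have l1 : upperLeft w i = arrangement w i (w i).castSucc := rfl
  have r1 : upperRight w i = arrangement w i (w i).succ := rfl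
  have l2 : upperLeft w j = arrangement w i (w i).castSucc := by
    simp [upperLeft, a1, simpleTransposition, hce]
  have r2 : upperRight w j = arrangement w i (w j).succ := by
    simp [upperRight, a1, simpleTransposition, Equiv.swap_apply_of_ne_of_ne n3.symm n2.symm]
  have l3 : upperLeft w k = arrangement w i (w i).succ := by
    simp [upperLeft, a2, a1, simpleTransposition, hki, hce,
      Equiv.swap_apply_of_ne_of_ne n1 n3]
  have r3 : upperRight w k = arrangement w i (w j).succ := by
    simp [upperRight, a2, a1, simpleTransposition, hki, hce,
      Equiv.swap_apply_of_ne_of_ne n3.symm n2.symm]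
  constructor
  · intro x
    fin_cases x
    · simp
    · simp [hij]
    · simp [hij, hjk]
  · rw [Fin.strictMono_iff_lt_succ]
    intro x
    fin_cases x
    · exact upperLeft_lt_upperRight hw i
    · have := upperLeft_lt_upperRight hw k
      rw [l3, r3] at this
      exact this
  · intro x
    fin_cases x
    · exact l1
    · exact l2
    · exact l3
  · intro x
    fin_cases x
    · exact r1
    · exact r2
    · exact r3

/-- The strings at three consecutive crossings in the columns `c + 1`, `c`, `c + 1`. -/
theorem triangle_false {w : Word n N} (hw : IsReducedLongest w) {i j k : Fin N}
    (hij : (j : ℕ) = i + 1) (hjk : (k : ℕ) = j + 1) (h : (w j : ℕ) + 1 = w i) (hki : w k = w i) :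
    Triangle w ![i, j, k] ![arrangement w i (w j).castSucc, arrangement w i (w j).succ,
      arrangement w i (w i).succ] false := by
  have hce : (w i).castSucc = (w j).succ := Fin.ext (by simp [← h])
  have n1 : (w j).castSucc ≠ (w j).succ := Fin.castSucc_lt_succ.ne
  have n2 : (w j).succ ≠ (w i).succ := fun h' => by
    have := congrArg Fin.val h'
    simp at this
    omega
  have n3 : (w j).castSucc ≠ (w i).succ := fun h' => by
    have := congrArg Fin.val h'
    simp at this
    omega
  have a1 : arrangement w j = arrangement w i * simpleTransposition (w i) := by
    rw [hij, arrangement_succ]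
  have a2 : arrangement w k = arrangement w j * simpleTransposition (w j) := by
    rw [hjk, arrangement_succ]
  have l1 : upperLeft w i = arrangement w i (w j).succ := by
    simp [upperLeft, hce]
  have r1 : upperRight w i = arrangement w i (w i).succ := rfl
  have l2 : upperLeft w j = arrangement w i (w j).castSucc := by
    simp [upperLeft, a1, simpleTransposition, hce, Equiv.swap_apply_of_ne_of_ne n1 n3]
  have r2 : upperRight w j = arrangement w i (w i).succ := by
    simp [upperRight, a1, simpleTransposition, hce]
  have l3 : upperLeft w k = arrangement w i (w j).castSucc := by
    simp [upperLeft, a2, a1, simpleTransposition, hki, hce,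
      Equiv.swap_apply_of_ne_of_ne n1 n3]
  have r3 : upperRight w k = arrangement w i (w j).succ := by
    simp [upperRight, a2, a1, simpleTransposition, hki, hce,
      Equiv.swap_apply_of_ne_of_ne n3.symm n2.symm]
  constructor
  · intro x
    fin_cases x
    · simp
    · simp [hij]
    · simp [hij, hjk]
  · rw [Fin.strictMono_iff_lt_succ]
    intro x
    fin_cases x
    · have := upperLeft_lt_upperRight hw k
      rw [l3, r3] at this
      exact this
    · have := upperLeft_lt_upperRight hw i
      rw [l1, r1] at this
      exact this
  · intro x
    fin_cases x
    · exact l1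
    · exact l2
    · exact l3
  · intro x
    fin_cases x
    · exact r1
    · exact r2
    · exact r3

namespace IsThreeMove

variable {w w' : Word n N} {i j k : Fin N}

theorem arrangement_eq_above (h : IsThreeMove w w' i j k) {m : ℕ} (hm : m ≤ i) :
    arrangement w' m = arrangement w m := by
  refine arrangement_congr (Nat.zero_le m) (by omega) (fun v _ hv => ?_) ?_
  · have h1 := h.hij
    have h2 := h.hjk
    refine h.hq' v ?_ ?_ ?_ <;> rintro rfl <;> omega
  · rw [arrangement_zero, arrangement_zero]

theorem arrangement_eq_below (h : IsThreeMove w w' i j k) {m : ℕ} (hm : (k : ℕ) < m)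
    (hmN : m ≤ N) : arrangement w' m = arrangement w m := by
  have h1 := h.hij
  have h2 := h.hjk
  refine arrangement_congr (a := k + 1) hm hmN (fun v hv _ => ?_) ?_
  · refine h.hq' v ?_ ?_ ?_ <;> rintro rfl <;> omega
  · have e : ∀ u : Word n N, arrangement u (k + 1) = arrangement u i *
        (simpleTransposition (u i) * simpleTransposition (u j) * simpleTransposition (u k)) := by
      intro u
      rw [arrangement_succ, h2, arrangement_succ, h1, arrangement_succ]
      group
    rw [e w, e w', h.arrangement_eq_above le_rfl, h.hi', h.hj', h.hk', h.hki]
    rcases h.adjacent with h3 | h3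
    · rw [simpleTransposition_braid h3]
    · rw [simpleTransposition_braid h3]

theorem isReducedLongest (h : IsThreeMove w w' i j k) (hw : IsReducedLongest w) :
    IsReducedLongest w' where
  length_eq := hw.length_eq
  prod_eq := by
    rw [← arrangement_length, h.arrangement_eq_below k.2 le_rfl, arrangement_length, hw.prod_eq]

theorem exists_triangleMove (h : IsThreeMove w w' i j k) (hw : IsReducedLongest w) :
    ∃ st ty, TriangleMove w w' ![i, j, k] st ty := by
  have hw' := h.isReducedLongest hw
  have hij := h.hij
  have hjk := h.hjk
  have out : ∀ v ∉ Set.range ![i, j, k],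
      upperLeft w' v = upperLeft w v ∧ upperRight w' v = upperRight w v := by
    intro v hv
    have hi : v ≠ i := fun h => hv ⟨0, h.symm⟩
    have hj : v ≠ j := fun h => hv ⟨1, h.symm⟩
    have hk : v ≠ k := fun h => hv ⟨2, h.symm⟩
    have harr : arrangement w' v = arrangement w v := by
      by_cases hlt : (v : ℕ) ≤ i
      · exact h.arrangement_eq_above hlt
      · refine h.arrangement_eq_below ?_ v.2.le
        have h1 := Fin.val_ne_of_ne hj
        have h2 := Fin.val_ne_of_ne hk
        omega
    unfold upperLeft upperRight
    rw [harr, h.hq' v hi hj hk]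
    exact ⟨rfl, rfl⟩
  have harr : arrangement w' i = arrangement w i := h.arrangement_eq_above le_rfl
  rcases h.adjacent with h3 | h3
  · refine ⟨_, _, triangle_true hw hij hjk h3 h.hki, ?_, fun v hv => (out v hv).1,
      fun v hv => (out v hv).2⟩
    have := triangle_false hw' hij hjk (by rw [h.hi', h.hj']; exact h3) (by rw [h.hk', h.hi'])
    rw [harr, h.hi', h.hj'] at this
    exact this
  · refine ⟨_, _, triangle_false hw hij hjk h3 h.hki, ?_, fun v hv => (out v hv).1,
      fun v hv => (out v hv).2⟩
    have := triangle_true hw' hij hjk (by rw [h.hi', h.hj']; exact h3) (by rw [h.hk', h.hi'])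
    rw [harr, h.hi', h.hj'] at this
    exact this

end IsThreeMove

end ThreeMove

/-! ### The finite model of a triangle -/

/-- A passage through one of three crossings of three strings: the crossing, the string on which
the path arrives, and the string on which it leaves. -/
abbrev TriPassage := Fin 3 × Fin 3 × Fin 3

/-- The string `s` passes through the crossing `x`. -/
def TriMeets (ty : Bool) (x s : Fin 3) : Prop := s = triLeft ty x ∨ s = triRight ty x

instance (ty : Bool) (x s : Fin 3) : Decidable (TriMeets ty x s) :=
  inferInstanceAs (Decidable (_ ∨ _))

/-- The first `b` strings are oriented upward. -/
def TriUp (b : Fin 4) (s : Fin 3) : Prop := (s : ℕ) < b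

instance (b : Fin 4) (s : Fin 3) : Decidable (TriUp b s) := inferInstanceAs (Decidable (_ < _))

/-- The bad passages. -/
def TriBad (ty : Bool) (b : Fin 4) (q : TriPassage) : Prop :=
  q.2.1 = q.2.2 ∧
    ((q.2.1 = triLeft ty q.1 ∧ TriUp b (triLeft ty q.1) ∧ TriUp b (triRight ty q.1)) ∨
      (q.2.1 = triRight ty q.1 ∧ ¬ TriUp b (triLeft ty q.1) ∧ ¬ TriUp b (triRight ty q.1)))

instance (ty : Bool) (b : Fin 4) (q : TriPassage) : Decidable (TriBad ty b q) :=
  inferInstanceAs (Decidable (_ ∧ _))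

/-- The oriented edges between the three crossings. -/
def TriEdge (ty : Bool) (b : Fin 4) (s x y : Fin 3) : Prop :=
  (TriUp b s ∧ y < x ∧ TriMeets ty y s ∧ TriMeets ty x s ∧
      ∀ z, y < z → z < x → ¬ TriMeets ty z s) ∨
    (¬ TriUp b s ∧ x < y ∧ TriMeets ty x s ∧ TriMeets ty y s ∧
      ∀ z, x < z → z < y → ¬ TriMeets ty z s)

instance (ty : Bool) (b : Fin 4) (s x y : Fin 3) : Decidable (TriEdge ty b s x y) :=
  inferInstanceAs (Decidable (_ ∨ _))

/-- The crossing `x` is the last one on the string `s`. -/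
def TriExit (ty : Bool) (b : Fin 4) (s x : Fin 3) : Prop :=
  ∀ y, TriMeets ty y s → if TriUp b s then x ≤ y else y ≤ x

/-- The crossing `x` is the first one on the string `s`. -/
def TriEntry (ty : Bool) (b : Fin 4) (s x : Fin 3) : Prop :=
  ∀ y, TriMeets ty y s → if TriUp b s then y ≤ x else x ≤ y

instance (ty : Bool) (b : Fin 4) (s x : Fin 3) : Decidable (TriExit ty b s x) :=
  inferInstanceAs (Decidable (∀ y, TriMeets ty y s → if TriUp b s then x ≤ y else y ≤ x))

instance (ty : Bool) (b : Fin 4) (s x : Fin 3) : Decidable (TriEntry ty b s x) :=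
  inferInstanceAs (Decidable (∀ y, TriMeets ty y s → if TriUp b s then y ≤ x else x ≤ y))

/-- The continuations of a path which arrives at the crossing `x` on the string `s`, up to the
point where it leaves the triangle, with at most `fuel` passages. -/
def triPaths (ty : Bool) (b : Fin 4) : ℕ → Fin 3 → Fin 3 → List (List TriPassage)
  | 0, _, _ => []
  | fuel + 1, s, x => [triLeft ty x, triRight ty x].flatMap fun t =>
      if TriBad ty b (x, s, t) then []
      else if TriExit ty b t x then [[(x, s, t)]]
      else ((List.finRange 3).filter fun y => TriEdge ty b t x y).flatMap fun y =>
        (triPaths ty b fuel t y).map ((x, s, t) :: ·)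

/-- The sign of the switch in a passage. -/
def triSign (q : TriPassage) : ℤ :=
  if q.2.1 < q.2.2 then 1 else if q.2.2 < q.2.1 then -1 else 0

/-- The coefficient of a path at a crossing. -/
def triCoeff (l : List TriPassage) (x : Fin 3) : ℤ :=
  (l.map fun q => if q.1 = x then triSign q else 0).sum

/-- The exponents of the terms into which the rational map transforms a monomial with given
exponents at the three crossings, for the exponents which occur in string inequalities. -/
def moveTable (a b c : ℤ) : List (ℤ × ℤ × ℤ) :=
  if (a, b, c) = (0, 0, 0) then [(0, 0, 0)]
  else if (a, b, c) = (0, 1, 0) then [(1, 0, 1)]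
  else if (a, b, c) = (0, -1, 0) then [(-1, 0, -1)]
  else if (a, b, c) = (1, 0, 1) then [(0, 1, 0)]
  else if (a, b, c) = (-1, 0, -1) then [(0, -1, 0)]
  else if (a, b, c) = (1, -1, 1) then [(-1, 1, -1)]
  else if (a, b, c) = (-1, 1, -1) then [(1, -1, 1)]
  else if (a, b, c) = (1, 0, 0) then [(0, 0, 1), (-1, 1, 0)]
  else if (a, b, c) = (0, 0, -1) then [(0, -1, 1), (-1, 0, 0)]
  else if (a, b, c) = (-1, 0, 0) then [(0, 0, -1)]
  else if (a, b, c) = (0, -1, 1) then [(0, 0, -1)]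
  else if (a, b, c) = (-1, 1, 0) then [(1, 0, 0)]
  else if (a, b, c) = (0, 0, 1) then [(1, 0, 0)]
  else []

/-- The conditions on a path through a triangle, between its entrance and its exit. -/
def IsTriFragment (ty : Bool) (b : Fin 4) (l : List TriPassage) : Prop :=
  l ≠ [] ∧ (∀ q ∈ l, TriMeets ty q.1 q.2.1 ∧ TriMeets ty q.1 q.2.2 ∧ ¬ TriBad ty b q) ∧
    (l.IsChain fun q r => r.2.1 = q.2.2 ∧ TriEdge ty b q.2.2 q.1 r.1) ∧
    (l.map Prod.fst).Nodup ∧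
    (∀ q ∈ l.head?, TriEntry ty b q.2.1 q.1) ∧ (∀ q ∈ l.getLast?, TriExit ty b q.2.2 q.1)

instance (ty : Bool) (b : Fin 4) (l : List TriPassage) : Decidable (IsTriFragment ty b l) :=
  inferInstanceAs (Decidable (_ ∧ _))

/-- The enumeration stops at the first exit. This loses nothing, because a passage followed by an
edge inside the triangle is never an exit (`h6`). -/
theorem triPaths_complete (ty : Bool) (b : Fin 4) (l : List TriPassage) : ∀ (fuel : ℕ)
    (s x t : Fin 3) (_ : ((x, s, t) :: l).length ≤ fuel)
    (_ : ∀ q ∈ (x, s, t) :: l, TriMeets ty q.1 q.2.1 ∧ TriMeets ty q.1 q.2.2 ∧ ¬ TriBad ty b q)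
    (_ : ((x, s, t) :: l).IsChain fun q r => r.2.1 = q.2.2 ∧ TriEdge ty b q.2.2 q.1 r.1)
    (_ : ∀ q ∈ ((x, s, t) :: l).getLast?, TriExit ty b q.2.2 q.1),
    (x, s, t) :: l ∈ triPaths ty b fuel s x := by
  induction l with
  | nil =>
    intro fuel s x t hlen hq _ hexit
    obtain ⟨fuel, rfl⟩ : ∃ f, fuel = f + 1 := ⟨fuel - 1, by simp at hlen; omega⟩
    have h1 := hq _ (List.mem_singleton_self _)
    have h2 : TriExit ty b t x := hexit (x, s, t) (by simp)
    rw [triPaths, List.mem_flatMap]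
    refine ⟨t, by simpa [TriMeets] using h1.2.1, ?_⟩
    simp [h1.2.2, h2]
  | cons r l ih =>
    intro fuel s x t hlen hq hchain hexit
    obtain ⟨y, s', t'⟩ := r
    obtain ⟨fuel, rfl⟩ : ∃ f, fuel = f + 1 := ⟨fuel - 1, by simp at hlen; omega⟩
    have h1 := hq (x, s, t) (by simp)
    rw [List.isChain_cons_cons] at hchain
    obtain ⟨⟨h2, h3⟩, h4⟩ := hchain
    simp only at h2 h3
    subst h2
    have h5 := ih fuel s' y t' (by simpa using hlen) (fun q h => hq q (List.mem_cons_of_mem _ h)) h4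
      (by simpa using hexit)
    have h6 : ¬ TriExit ty b s' x := by
      have : ∀ ty b s x y, TriEdge ty b s x y → ¬ TriExit ty b s x := by decide
      exact this _ _ _ _ _ h3
    rw [triPaths, List.mem_flatMap]
    refine ⟨s', by simpa [TriMeets] using h1.2.1, ?_⟩
    rw [if_neg h1.2.2, if_neg h6, List.mem_flatMap]
    exact ⟨y, by simpa using h3, List.mem_map.2 ⟨_, h5, rfl⟩⟩

/-- The vector of the coefficients of a path, with the signs of a defining inequality. -/
def triVector (l : List TriPassage) : ℤ × ℤ × ℤ := (-triCoeff l 0, -triCoeff l 1, -triCoeff l 2)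

/-- The path `l'` arrives and leaves on the same strings as `l`. -/
def TriSameEnds (l l' : List TriPassage) : Prop :=
  l'.head?.map (·.2.1) = l.head?.map (·.2.1) ∧ l'.getLast?.map (·.2.2) = l.getLast?.map (·.2.2)

instance (l l' : List TriPassage) : Decidable (TriSameEnds l l') :=
  inferInstanceAs (Decidable (_ ∧ _))

/-- All paths through the triangle which arrive on the string `s`. -/
def triPathsFrom (ty : Bool) (b : Fin 4) (s : Fin 3) : List (List TriPassage) :=
  ((List.finRange 3).filter fun x => TriMeets ty x s ∧ TriEntry ty b s x).flatMap
    (triPaths ty b 3 s)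

-- The combinatorial core of the exchange, settled by enumeration over the two orders of the
-- crossings, the number of upward strings and the string of arrival. The exponents of a local path
-- determine its table entries, and each of them is realized in the triangle of the other order by a
-- path with the same end strings, so that it can be inserted in place of the old one.
set_option maxRecDepth 100000 in
theorem triPathsFrom_exchange : ∀ (ty : Bool) (b : Fin 4) (s : Fin 3),
    ∀ l ∈ triPathsFrom ty b s,
      moveTable (triVector l).1 (triVector l).2.1 (triVector l).2.2 ≠ [] ∧
      ∀ t ∈ moveTable (triVector l).1 (triVector l).2.1 (triVector l).2.2,
        ∃ l' ∈ triPathsFrom (!ty) b s,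
          IsTriFragment (!ty) b l' ∧ TriSameEnds l l' ∧ triVector l' = t := by
  decide

/-! ### Fragments of paths in a triangle -/

/-- A piece of a rigorous path which passes through the crossings `vx` only, between its entrance
and its exit. -/
structure IsFragment {n N : ℕ} (w : Word n N) (vx : Fin 3 → Fin N) (k : Fin n)
    (f : List (Passage n N)) : Prop where
  ne_nil : f ≠ []
  vertex_mem : ∀ q ∈ f, q.vertex ∈ Set.range vx
  meets : ∀ q ∈ f, Meets w q.vertex q.inS ∧ Meets w q.vertex q.outS
  not_bad : ∀ q ∈ f, ¬ IsBad w k q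
  chain : f.IsChain fun q r => r.inS = q.outS ∧ OrientedEdge w k q.outS q.vertex r.vertex
  nodup : (f.map Passage.vertex).Nodup
  entry : ∀ q ∈ f.head?, ∀ x, q.vertex = vx x → IsEntry w vx k q.inS x
  exit : ∀ q ∈ f.getLast?, ∀ x, q.vertex = vx x → IsExit w vx k q.outS x

section Fragment

variable {n N : ℕ} {w w' : Word n N} {vx : Fin 3 → Fin N} {st : Fin 3 → Fin (n + 1)} {ty : Bool}
  {k : Fin n} {b : Fin 4}

/-- The passage with given indices of the crossing and of the strings. -/
def realize (vx : Fin 3 → Fin N) (st : Fin 3 → Fin (n + 1)) (q : TriPassage) : Passage n N :=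
  ⟨vx q.1, st q.2.1, st q.2.2⟩

namespace Triangle

/-- The upward strings form an initial segment and `st` is increasing, so the orientation of a
triangle is recorded by the number of its upward strings. -/
theorem exists_up (T : Triangle w vx st ty) (k : Fin n) :
    ∃ b : Fin 4, ∀ a, IsUp k (st a) ↔ TriUp b a := by
  have h01 : IsUp k (st 1) → IsUp k (st 0) := fun h => h.of_le (T.st_mono.monotone (by decide))
  have h12 : IsUp k (st 2) → IsUp k (st 1) := fun h => h.of_le (T.st_mono.monotone (by decide))
  by_cases h0 : IsUp k (st 0)
  · by_cases h1 : IsUp k (st 1)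
    · by_cases h2 : IsUp k (st 2)
      · exact ⟨3, fun a => by fin_cases a <;> simp [h0, h1, h2, TriUp]⟩
      · exact ⟨2, fun a => by fin_cases a <;> simp [h0, h1, h2, TriUp]⟩
    · exact ⟨1, fun a => by fin_cases a <;> simp [h0, h1, mt h12 h1, TriUp]⟩
  · exact ⟨0, fun a => by fin_cases a <;> simp [h0, mt h01 h0, mt h12 (mt h01 h0), TriUp]⟩

theorem meets_st_iff (T : Triangle w vx st ty) {x s : Fin 3} :
    Meets w (vx x) (st s) ↔ TriMeets ty x s := by
  rw [T.meets_iff, T.st_mono.injective.eq_iff, T.st_mono.injective.eq_iff]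
  rfl

/-- Only crossings of the triangle lie between two of them, so being consecutive on a string is
visible in the finite model. -/
theorem consecutiveOn_iff (T : Triangle w vx st ty) {x y s : Fin 3} :
    ConsecutiveOn w (st s) (vx x) (vx y) ↔ x < y ∧ TriMeets ty x s ∧ TriMeets ty y s ∧
      ∀ z, x < z → z < y → ¬ TriMeets ty z s := by
  unfold ConsecutiveOn
  rw [T.vx_lt, T.meets_st_iff, T.meets_st_iff]
  refine and_congr_right fun _ => and_congr_right fun _ => and_congr_right fun _ => ?_
  constructor
  · intro h z h1 h2
    rw [← T.meets_st_iff]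
    exact h _ (T.vx_lt.2 h1) (T.vx_lt.2 h2)
  · intro h v h1 h2
    obtain ⟨z, rfl⟩ : v ∈ Set.range vx := by
      rw [T.mem_range]
      exact ⟨(T.vx_le.2 (Fin.zero_le x)).trans h1.le, h2.le.trans (T.vx_le.2 (Fin.le_last y))⟩
    rw [T.meets_st_iff]
    exact h z (T.vx_lt.1 h1) (T.vx_lt.1 h2)

theorem orientedEdge_iff (T : Triangle w vx st ty) (hb : ∀ a, IsUp k (st a) ↔ TriUp b a)
    {x y s : Fin 3} : OrientedEdge w k (st s) (vx x) (vx y) ↔ TriEdge ty b s x y := by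
  unfold OrientedEdge TriEdge
  rw [T.consecutiveOn_iff, T.consecutiveOn_iff, hb]

theorem isBad_iff (T : Triangle w vx st ty) (hb : ∀ a, IsUp k (st a) ↔ TriUp b a)
    {q : TriPassage} : IsBad w k (realize vx st q) ↔ TriBad ty b q := by
  unfold IsBad TriBad realize
  simp only [T.upperLeft_eq, T.upperRight_eq, T.st_mono.injective.eq_iff, hb]

theorem isExit_iff (T : Triangle w vx st ty) (hb : ∀ a, IsUp k (st a) ↔ TriUp b a)
    {s x : Fin 3} : IsExit w vx k (st s) x ↔ TriExit ty b s x := by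
  unfold IsExit TriExit
  simp only [T.meets_st_iff, hb]

theorem isEntry_iff (T : Triangle w vx st ty) (hb : ∀ a, IsUp k (st a) ↔ TriUp b a)
    {s x : Fin 3} : IsEntry w vx k (st s) x ↔ TriEntry ty b s x := by
  unfold IsEntry TriEntry
  simp only [T.meets_st_iff, hb]

/-- The bridge to the finite model, used in both directions: a fragment of the old word becomes a
list that the enumeration covers, and the list found there becomes a fragment of the new word. -/
theorem isFragment_iff (T : Triangle w vx st ty) (hb : ∀ a, IsUp k (st a) ↔ TriUp b a)
    {l : List TriPassage} : IsFragment w vx k (l.map (realize vx st)) ↔ IsTriFragment ty b l := by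
  have hmap : (l.map (realize vx st)).map Passage.vertex = (l.map Prod.fst).map vx := by
    simp [realize, Function.comp_def]
  constructor
  · intro h
    refine ⟨by simpa using h.ne_nil, fun q hq => ?_, ?_, ?_, fun q hq => ?_, fun q hq => ?_⟩
    · have h1 := h.meets _ (List.mem_map_of_mem hq)
      have h2 := h.not_bad _ (List.mem_map_of_mem hq)
      rw [T.isBad_iff hb] at h2
      exact ⟨T.meets_st_iff.1 h1.1, T.meets_st_iff.1 h1.2, h2⟩
    · have h1 := h.chain
      rw [List.isChain_map] at h1
      refine h1.imp fun q r h2 => ?_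
      rw [← T.orientedEdge_iff hb]
      exact ⟨T.st_mono.injective h2.1, h2.2⟩
    · have h1 := h.nodup
      rw [hmap] at h1
      exact h1.of_map
    · rw [← T.isEntry_iff hb]
      exact h.entry (realize vx st q) (by rw [List.head?_map]; exact Option.mem_map_of_mem _ hq) _ rfl
    · rw [← T.isExit_iff hb]
      exact h.exit (realize vx st q) (by rw [List.getLast?_map]; exact Option.mem_map_of_mem _ hq) _ rfl
  · rintro ⟨h1, h2, h3, h4, h5, h6⟩
    refine ⟨by simpa using h1, ?_, ?_, ?_, ?_, ?_, ?_, ?_⟩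
    · simp only [List.mem_map]
      rintro _ ⟨q, _, rfl⟩
      exact ⟨_, rfl⟩
    · simp only [List.mem_map]
      rintro _ ⟨q, hq, rfl⟩
      exact ⟨T.meets_st_iff.2 (h2 q hq).1, T.meets_st_iff.2 (h2 q hq).2.1⟩
    · simp only [List.mem_map]
      rintro _ ⟨q, hq, rfl⟩
      rw [T.isBad_iff hb]
      exact (h2 q hq).2.2
    · rw [List.isChain_map]
      refine h3.imp fun q r h7 => ?_
      rw [← T.orientedEdge_iff hb] at h7
      exact ⟨congrArg st h7.1, h7.2⟩
    · rw [hmap]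
      exact h4.map T.vx_injective
    · rw [List.head?_map]
      intro q hq x hx
      obtain ⟨r, hr, rfl⟩ := Option.mem_map.1 hq
      obtain rfl := T.vx_injective hx
      exact (T.isEntry_iff hb).2 (h5 r hr)
    · rw [List.getLast?_map]
      intro q hq x hx
      obtain ⟨r, hr, rfl⟩ := Option.mem_map.1 hq
      obtain rfl := T.vx_injective hx
      exact (T.isExit_iff hb).2 (h6 r hr)

theorem switchSign_realize (T : Triangle w vx st ty) (q : TriPassage) :
    switchSign (realize vx st q) = triSign q := by
  simp [switchSign, realize, triSign, T.st_mono.lt_iff_lt]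

theorem stringCoeff_realize (T : Triangle w vx st ty) (l : List TriPassage) (x : Fin 3) :
    stringCoeff (l.map (realize vx st)) (vx x) = triCoeff l x := by
  unfold stringCoeff triCoeff
  rw [List.map_map]
  congr 1
  refine List.map_congr_left fun q _ => ?_
  simp only [Function.comp_apply, T.switchSign_realize]
  simp [realize, T.vx_injective.eq_iff]

end Triangle

/-- No crossing is repeated, so there are at most three passages and fuel 3 suffices. -/
theorem IsTriFragment.mem_triPathsFrom {l : List TriPassage} (h : IsTriFragment ty b l) :
    ∃ s, l ∈ triPathsFrom ty b s := by
  obtain ⟨h1, h2, h3, h4, h5, h6⟩ := h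
  have hlen : l.length ≤ 3 := by
    have := h4.length_le_card
    simpa using this
  match l, h1 with
  | (x, s, t) :: l, _ =>
    refine ⟨s, List.mem_flatMap.2 ⟨x, ?_, triPaths_complete ty b l 3 s x t hlen h2 h3 h6⟩⟩
    rw [List.mem_filter]
    have h7 := (h2 (x, s, t) (by simp)).1
    have h8 := h5 (x, s, t) (by simp)
    exact ⟨List.mem_finRange x, by simpa using ⟨h7, h8⟩⟩

/-- The vector of the coefficients of a path at the crossings `vx`. -/
def localVector (vx : Fin 3 → Fin N) (f : List (Passage n N)) : ℤ × ℤ × ℤ :=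
  (-stringCoeff f (vx 0), -stringCoeff f (vx 1), -stringCoeff f (vx 2))

/-- The fragments before and after a 3-move correspond to each other as monomials do under the
rational map. -/
theorem fragment_exchange (T : TriangleMove w w' vx st ty) {f : List (Passage n N)}
    (hf : IsFragment w vx k f) :
    moveTable (localVector vx f).1 (localVector vx f).2.1 (localVector vx f).2.2 ≠ [] ∧
    ∀ t ∈ moveTable (localVector vx f).1 (localVector vx f).2.1 (localVector vx f).2.2,
      ∃ f', IsFragment w' vx k f' ∧ f'.head?.map Passage.inS = f.head?.map Passage.inS ∧
        f'.getLast?.map Passage.outS = f.getLast?.map Passage.outS ∧ localVector vx f' = t := by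
  obtain ⟨l, rfl⟩ : f ∈ Set.range (List.map (realize vx st)) := by
    rw [Set.range_list_map]
    intro q hq
    obtain ⟨x, hx⟩ := hf.vertex_mem q hq
    have h1 := hf.meets q hq
    rw [← hx] at h1
    obtain ⟨s, hs⟩ := T.source.mem_range_of_meets h1.1
    obtain ⟨t, ht⟩ := T.source.mem_range_of_meets h1.2
    refine ⟨(x, s, t), ?_⟩
    simp only [realize, hx, hs, ht]
  obtain ⟨b, hb⟩ := T.source.exists_up k
  obtain ⟨s, hs⟩ := ((T.source.isFragment_iff hb).1 hf).mem_triPathsFrom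
  have hvec : localVector vx (l.map (realize vx st)) = triVector l := by
    simp only [localVector, T.source.stringCoeff_realize, triVector]
  rw [hvec]
  obtain ⟨h1, h2⟩ := triPathsFrom_exchange ty b s l hs
  refine ⟨h1, fun t ht => ?_⟩
  obtain ⟨l', -, h4, h5, h6⟩ := h2 t ht
  -- The same `b` serves for the new word, because the three strings and their orientations are
  -- unchanged.
  refine ⟨l'.map (realize vx st), (T.target.isFragment_iff hb).2 h4, ?_, ?_, ?_⟩
  · have := congrArg (Option.map st) h5.1
    simpa [List.head?_map, Function.comp_def, realize] using this
  · have := congrArg (Option.map st) h5.2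
    simpa [List.getLast?_map, Function.comp_def, realize] using this
  · rw [← h6]
    simp only [localVector, T.target.stringCoeff_realize, triVector]

end Fragment

/-! ### Rigorous paths before and after a 3-move -/

section Surgery

variable {n N : ℕ} {w w' : Word n N} {vx : Fin 3 → Fin N} {st : Fin 3 → Fin (n + 1)} {ty : Bool}
  {k : Fin n}

/-- The relation between consecutive passages of a path. -/
def Follows (w : Word n N) (k : Fin n) (q r : Passage n N) : Prop :=
  r.inS = q.outS ∧ OrientedEdge w k q.outS q.vertex r.vertex

theorem split_first {α : Type*} (P : α → Prop) (l : List α) :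
    (∀ q ∈ l, ¬ P q) ∨ ∃ l₁ a l₂, l = l₁ ++ a :: l₂ ∧ (∀ q ∈ l₁, ¬ P q) ∧ P a := by
  induction l with
  | nil => exact Or.inl (by simp)
  | cons c l ih =>
    by_cases hc : P c
    · exact Or.inr ⟨[], c, l, rfl, by simp, hc⟩
    · rcases ih with h | ⟨l₁, a, l₂, rfl, h2, h3⟩
      · left
        intro q hq
        rcases List.mem_cons.1 hq with rfl | hq
        · exact hc
        · exact h q hq
      · refine Or.inr ⟨c :: l₁, a, l₂, rfl, ?_, h3⟩
        intro q hq
        rcases List.mem_cons.1 hq with rfl | hq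
        · exact hc
        · exact h2 q hq

theorem transGen_of_chain {l₁ l₂ l₃ : List (Passage n N)} {q r : Passage n N}
    (h : (l₁ ++ q :: (l₂ ++ r :: l₃)).IsChain (Follows w k)) :
    Relation.TransGen (Step w k Set.univ) q r := by
  have h1 : (q :: (l₂ ++ r :: l₃)).IsChain (Follows w k) := (List.isChain_append.1 h).2.1
  clear h
  induction l₂ generalizing q with
  | nil =>
    rw [List.nil_append, List.isChain_cons_cons] at h1
    exact .single ⟨trivial, h1.1⟩
  | cons c l₂ ih =>
    rw [List.cons_append, List.isChain_cons_cons] at h1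
    exact .head ⟨trivial, h1.1⟩ (ih h1.2)

namespace Triangle

/-- The triangle is an interval of crossings, so any other crossing is above all of it or below all
of it. -/
theorem lt_of_notMem (T : Triangle w vx st ty) {v : Fin N} (hv : v ∉ Set.range vx) {x : Fin 3}
    (h : v < vx x) (y : Fin 3) : v < vx y := by
  by_contra! hle
  exact hv (T.mem_range.2 ⟨(T.vx_le.2 (Fin.zero_le y)).trans hle,
    h.le.trans (T.vx_le.2 (Fin.le_last x))⟩)

theorem gt_of_notMem (T : Triangle w vx st ty) {v : Fin N} (hv : v ∉ Set.range vx) {x : Fin 3}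
    (h : vx x < v) (y : Fin 3) : vx y < v := by
  by_contra! hle
  exact hv (T.mem_range.2 ⟨(T.vx_le.2 (Fin.zero_le x)).trans h.le,
    hle.trans (T.vx_le.2 (Fin.le_last y))⟩)

/-- The vertex `v` lies beyond the whole triangle, so a crossing of the triangle still ahead on `s`
would interrupt the edge. -/
theorem isExit_of_edge (T : Triangle w vx st ty) {s : Fin (n + 1)} {x : Fin 3} {v : Fin N}
    (hv : v ∉ Set.range vx) (h : OrientedEdge w k s (vx x) v) : IsExit w vx k s x := by
  intro y hy
  rcases h with ⟨hup, h⟩ | ⟨hup, h⟩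
  · rw [if_pos hup]
    by_contra! hlt
    exact h.2.2.2 (vx y) (T.lt_of_notMem hv h.1 y) (T.vx_lt.2 hlt) hy
  · rw [if_neg hup]
    by_contra! hlt
    exact h.2.2.2 (vx y) (T.vx_lt.2 hlt) (T.gt_of_notMem hv h.1 y) hy

theorem isEntry_of_edge (T : Triangle w vx st ty) {s : Fin (n + 1)} {x : Fin 3} {v : Fin N}
    (hv : v ∉ Set.range vx) (h : OrientedEdge w k s v (vx x)) : IsEntry w vx k s x := by
  intro y hy
  rcases h with ⟨hup, h⟩ | ⟨hup, h⟩
  · rw [if_pos hup]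
    by_contra! hlt
    exact h.2.2.2 (vx y) (T.vx_lt.2 hlt) (T.gt_of_notMem hv h.1 y) hy
  · rw [if_neg hup]
    by_contra! hlt
    exact h.2.2.2 (vx y) (T.lt_of_notMem hv h.1 y) (T.vx_lt.2 hlt) hy

/-- For a path whose first passage is already in the triangle there is no incoming edge; that it
starts at the lowest crossing of an upward string replaces it. `isExit_of_isLowestOn` does the same
at the other end. -/
theorem isEntry_of_isLowestOn (T : Triangle w vx st ty) {s : Fin (n + 1)} {x : Fin 3}
    (hup : IsUp k s) (h : IsLowestOn w s (vx x)) : IsEntry w vx k s x := by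
  intro y hy
  rw [if_pos hup]
  by_contra! hlt
  exact h.2 _ (T.vx_lt.2 hlt) hy

theorem isExit_of_isLowestOn (T : Triangle w vx st ty) {s : Fin (n + 1)} {x : Fin 3}
    (hup : ¬ IsUp k s) (h : IsLowestOn w s (vx x)) : IsExit w vx k s x := by
  intro y hy
  rw [if_neg hup]
  by_contra! hlt
  exact h.2 _ (T.vx_lt.2 hlt) hy

/-- A rigorous path passes through the triangle in at most one fragment. -/
theorem decompose (hw : IsReducedLongest w) (T : Triangle w vx st ty) {p : List (Passage n N)}
    (hp : IsRigorousPath w k p) :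
    (∀ q ∈ p, q.vertex ∉ Set.range vx) ∨ ∃ p₁ f p₂, p = p₁ ++ f ++ p₂ ∧
      (∀ q ∈ p₁, q.vertex ∉ Set.range vx) ∧ (∀ q ∈ p₂, q.vertex ∉ Set.range vx) ∧
      IsFragment w vx k f := by
  rcases split_first (fun q : Passage n N => q.vertex ∈ Set.range vx) p with
    h | ⟨p₁, a, l, rfl, hp₁, ha⟩
  · exact Or.inl h
  have hchain : (p₁ ++ a :: l).IsChain (Follows w k) := hp.chain
  right
  -- Here `a :: g` is the first run of passages in the triangle. If a later passage `r` were in the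
  -- triangle again, the walk from the last passage `q` of this run to the first such `r` would
  -- contradict `no_return`.
  obtain ⟨g, p₂, rfl, hg, hp₂⟩ : ∃ g p₂, l = g ++ p₂ ∧
      (∀ q ∈ g, q.vertex ∈ Set.range vx) ∧ ∀ q ∈ p₂, q.vertex ∉ Set.range vx := by
    rcases split_first (fun q : Passage n N => q.vertex ∉ Set.range vx) l with
      h | ⟨g, c, l', rfl, hg, hc⟩
    · exact ⟨l, [], by simp, fun q hq => not_not.1 (h q hq), by simp⟩
    have hg' : ∀ q ∈ g, q.vertex ∈ Set.range vx := fun q hq => not_not.1 (hg q hq)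
    refine ⟨g, c :: l', rfl, hg', ?_⟩
    rcases split_first (fun q : Passage n N => q.vertex ∈ Set.range vx) l' with
      h | ⟨m, r, m', rfl, hm, hr⟩
    · intro q hq
      rcases List.mem_cons.1 hq with rfl | hq
      · exact hc
      · exact h q hq
    exfalso
    obtain ⟨g', q, hgq⟩ : ∃ g' q, a :: g = g' ++ [q] := by
      rcases List.eq_nil_or_concat (a :: g) with h | ⟨g', q, h⟩
      · exact absurd h (by simp)
      · exact ⟨g', q, by simpa using h⟩
    obtain ⟨m₀, d, hmd⟩ : ∃ m₀ d, c :: m = m₀ ++ [d] := by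
      rcases List.eq_nil_or_concat (c :: m) with h | ⟨m₀, d, h⟩
      · exact absurd h (by simp)
      · exact ⟨m₀, d, by simpa using h⟩
    have hq : q.vertex ∈ Set.range vx := by
      have : q ∈ a :: g := by rw [hgq]; simp
      rcases List.mem_cons.1 this with rfl | h
      · exact ha
      · exact hg' q h
    have hd : d.vertex ∉ Set.range vx := by
      have : d ∈ c :: m := by rw [hmd]; simp
      rcases List.mem_cons.1 this with rfl | h
      · exact hc
      · exact hm d h
    have e1 : p₁ ++ a :: (g ++ c :: (m ++ r :: m')) = (p₁ ++ g') ++ q :: (c :: m ++ r :: m') := by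
      have : a :: (g ++ c :: (m ++ r :: m')) = (a :: g) ++ c :: (m ++ r :: m') := rfl
      rw [this, hgq]
      simp
    have e2 : p₁ ++ a :: (g ++ c :: (m ++ r :: m')) =
        (p₁ ++ g' ++ q :: m₀) ++ d :: r :: m' := by
      rw [e1, hmd]
      simp
    have c1 := hchain
    rw [e1] at c1
    have c2 := hchain
    rw [e2] at c2
    have f1 : Follows w k q c := by
      have := (List.isChain_append.1 c1).2.1
      rw [List.cons_append, List.isChain_cons_cons] at this
      exact this.1
    have f2 : Follows w k d r := by
      have := (List.isChain_append.1 c2).2.1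
      rw [List.isChain_cons_cons] at this
      exact this.1
    obtain ⟨x, hx⟩ := hq
    obtain ⟨y, hy⟩ := hr
    refine T.no_return hw (k := k) hx.symm hy.symm f1.2.meets_left ?_ ?_ ?_ (transGen_of_chain c1)
    · rw [f2.1]
      exact f2.2.meets_right
    · exact T.isExit_of_edge hc (hx ▸ f1.2)
    · rw [f2.1]
      exact T.isEntry_of_edge hd (hy ▸ f2.2)
  have e : p₁ ++ a :: (g ++ p₂) = p₁ ++ (a :: g) ++ p₂ := by simp
  rw [e] at hp hchain
  have hsub : (a :: g) <:+: p₁ ++ (a :: g) ++ p₂ := ⟨p₁, p₂, rfl⟩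
  have hmem : ∀ q ∈ a :: g, q ∈ p₁ ++ (a :: g) ++ p₂ := fun q hq => hsub.subset hq
  refine ⟨p₁, a :: g, p₂, e, hp₁, hp₂, ?_⟩
  constructor
  · simp
  · intro q hq
    rcases List.mem_cons.1 hq with rfl | hq
    · exact ha
    · exact hg q hq
  · exact fun q hq => hp.meets q (hmem q hq)
  · exact fun q hq => hp.not_bad q (hmem q hq)
  · exact hp.chain.infix hsub
  · exact hp.nodup.sublist (hsub.sublist.map _)
  · intro q hq x hx
    obtain rfl : a = q := by simpa using hq
    rcases List.eq_nil_or_concat p₁ with rfl | ⟨l₀, d, rfl⟩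
    · obtain ⟨q', h1, h2, h3⟩ := hp.start
      obtain rfl : a = q' := by simpa using h1
      rw [h2]
      exact T.isEntry_of_isLowestOn (isUp_castSucc k) (hx ▸ h3)
    · have h1 : (l₀ ++ d :: a :: (g ++ p₂)).IsChain (Follows w k) := by
        simpa using hchain
      have h2 := (List.isChain_append.1 h1).2.1
      rw [List.isChain_cons_cons] at h2
      rw [h2.1.1]
      exact T.isEntry_of_edge (hp₁ d (by simp)) (hx ▸ h2.1.2)
  · intro q hq x hx
    obtain ⟨g', hgq⟩ : ∃ g', a :: g = g' ++ [q] := by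
      rcases List.eq_nil_or_concat (a :: g) with h | ⟨g', q', h⟩
      · exact absurd h (by simp)
      · rw [h] at hq
        obtain rfl : q' = q := by simpa using hq
        exact ⟨g', by simpa using h⟩
    rw [hgq] at hp hchain
    cases p₂ with
    | nil =>
      obtain ⟨q', h1, h2, h3⟩ := hp.finish
      obtain rfl : q = q' := by simpa using h1
      rw [h2]
      exact T.isExit_of_isLowestOn (not_isUp_succ k) (hx ▸ h3)
    | cons d l₀ =>
      have h1 : (p₁ ++ g' ++ q :: d :: l₀).IsChain (Follows w k) := by
        simpa using hchain
      have h2 := (List.isChain_append.1 h1).2.1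
      rw [List.isChain_cons_cons] at h2
      exact T.isExit_of_edge (hp₂ d (by simp)) (hx ▸ h2.1.2)

end Triangle

/-! ### Transport of edges and rigorous paths across the move. -/

namespace TriangleMove

theorem meets_iff (T : TriangleMove w w' vx st ty) {v : Fin N} (hv : v ∉ Set.range vx)
    (s : Fin (n + 1)) : Meets w' v s ↔ Meets w v s := by
  unfold Meets
  rw [T.upperLeft_eq v hv, T.upperRight_eq v hv]

theorem exists_meets (T : TriangleMove w w' vx st ty) {x : Fin 3} {s : Fin (n + 1)}
    (h : Meets w' (vx x) s) : ∃ y, Meets w (vx y) s := by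
  obtain ⟨a, rfl⟩ := T.target.mem_range_of_meets h
  exact T.source.exists_meets_one a

/-- A string that meets the triangle after the move also meets it before. If one crossing of the
triangle is strictly between `v` and `u`, all three are, so the old edge would be interrupted as
well. -/
theorem consecutiveOn (T : TriangleMove w w' vx st ty) {v u : Fin N} {s : Fin (n + 1)}
    (hv : v ∉ Set.range vx) (hu : u ∉ Set.range vx) (h : ConsecutiveOn w s v u) :
    ConsecutiveOn w' s v u := by
  obtain ⟨h1, h2, h3, h4⟩ := h
  refine ⟨h1, (T.meets_iff hv s).2 h2, (T.meets_iff hu s).2 h3, fun z hz1 hz2 hz => ?_⟩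
  by_cases hz' : z ∈ Set.range vx
  · obtain ⟨x, rfl⟩ := hz'
    obtain ⟨y, hy⟩ := T.exists_meets hz
    exact h4 _ (T.source.lt_of_notMem hv hz1 y) (T.source.gt_of_notMem hu hz2 y) hy
  · exact h4 z hz1 hz2 ((T.meets_iff hz' s).1 hz)

theorem orientedEdge (T : TriangleMove w w' vx st ty) {v u : Fin N} {s : Fin (n + 1)}
    (hv : v ∉ Set.range vx) (hu : u ∉ Set.range vx) (h : OrientedEdge w k s v u) :
    OrientedEdge w' k s v u := by
  rcases h with ⟨hup, h⟩ | ⟨hup, h⟩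
  · exact Or.inl ⟨hup, T.consecutiveOn hu hv h⟩
  · exact Or.inr ⟨hup, T.consecutiveOn hv hu h⟩

/-- The move may change which crossing of the triangle a string meets first, but not the part of the
string outside; `hentry` says that `vx y` is the first one for `w'`. -/
theorem orientedEdge_entry (T : TriangleMove w w' vx st ty) {v : Fin N} {s : Fin (n + 1)}
    {x y : Fin 3} (hv : v ∉ Set.range vx) (h : OrientedEdge w k s v (vx x))
    (hy : Meets w' (vx y) s) (hentry : IsEntry w' vx k s y) :
    OrientedEdge w' k s v (vx y) := by
  rcases h with ⟨hup, h1, h2, h3, h4⟩ | ⟨hup, h1, h2, h3, h4⟩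
  · refine Or.inl ⟨hup, T.source.gt_of_notMem hv h1 y, hy, (T.meets_iff hv s).2 h3, ?_⟩
    intro z hz1 hz2 hz
    by_cases hz' : z ∈ Set.range vx
    · obtain ⟨a, rfl⟩ := hz'
      have := hentry a hz
      rw [if_pos hup] at this
      exact absurd (T.source.vx_lt.1 hz1) this.not_gt
    · exact h4 z (T.source.gt_of_notMem hz' hz1 x) hz2 ((T.meets_iff hz' s).1 hz)
  · refine Or.inr ⟨hup, T.source.lt_of_notMem hv h1 y, (T.meets_iff hv s).2 h2, hy, ?_⟩
    intro z hz1 hz2 hz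
    by_cases hz' : z ∈ Set.range vx
    · obtain ⟨a, rfl⟩ := hz'
      have := hentry a hz
      rw [if_neg hup] at this
      exact absurd (T.source.vx_lt.1 hz2) this.not_gt
    · exact h4 z hz1 (T.source.lt_of_notMem hz' hz2 x) ((T.meets_iff hz' s).1 hz)

theorem orientedEdge_exit (T : TriangleMove w w' vx st ty) {v : Fin N} {s : Fin (n + 1)}
    {x y : Fin 3} (hv : v ∉ Set.range vx) (h : OrientedEdge w k s (vx x) v)
    (hy : Meets w' (vx y) s) (hexit : IsExit w' vx k s y) :
    OrientedEdge w' k s (vx y) v := by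
  rcases h with ⟨hup, h1, h2, h3, h4⟩ | ⟨hup, h1, h2, h3, h4⟩
  · refine Or.inl ⟨hup, T.source.lt_of_notMem hv h1 y, (T.meets_iff hv s).2 h2, hy, ?_⟩
    intro z hz1 hz2 hz
    by_cases hz' : z ∈ Set.range vx
    · obtain ⟨a, rfl⟩ := hz'
      have := hexit a hz
      rw [if_pos hup] at this
      exact absurd (T.source.vx_lt.1 hz2) this.not_gt
    · exact h4 z hz1 (T.source.lt_of_notMem hz' hz2 x) ((T.meets_iff hz' s).1 hz)
  · refine Or.inr ⟨hup, T.source.gt_of_notMem hv h1 y, hy, (T.meets_iff hv s).2 h3, ?_⟩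
    intro z hz1 hz2 hz
    by_cases hz' : z ∈ Set.range vx
    · obtain ⟨a, rfl⟩ := hz'
      have := hexit a hz
      rw [if_neg hup] at this
      exact absurd (T.source.vx_lt.1 hz1) this.not_gt
    · exact h4 z (T.source.gt_of_notMem hz' hz1 x) hz2 ((T.meets_iff hz' s).1 hz)

theorem isLowestOn (T : TriangleMove w w' vx st ty) {v : Fin N} {s : Fin (n + 1)}
    (hv : v ∉ Set.range vx) (h : IsLowestOn w s v) : IsLowestOn w' s v := by
  refine ⟨(T.meets_iff hv s).2 h.1, fun z hz hm => ?_⟩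
  by_cases hz' : z ∈ Set.range vx
  · obtain ⟨x, rfl⟩ := hz'
    obtain ⟨y, hy⟩ := T.exists_meets hm
    exact h.2 _ (T.source.lt_of_notMem hv hz y) hy
  · exact h.2 z hz ((T.meets_iff hz' s).1 hm)

theorem isLowestOn_local (T : TriangleMove w w' vx st ty) {s : Fin (n + 1)} {x y : Fin 3}
    (h : IsLowestOn w s (vx x)) (hm : Meets w' (vx y) s)
    (hy : ∀ z, Meets w' (vx z) s → z ≤ y) : IsLowestOn w' s (vx y) := by
  refine ⟨hm, fun z hz hm => ?_⟩
  by_cases hz' : z ∈ Set.range vx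
  · obtain ⟨a, rfl⟩ := hz'
    exact absurd (T.source.vx_lt.1 hz) (hy a hm).not_gt
  · exact h.2 z (T.source.gt_of_notMem hz' hz x) ((T.meets_iff hz' s).1 hm)

theorem isBad_iff (T : TriangleMove w w' vx st ty) {q : Passage n N}
    (hq : q.vertex ∉ Set.range vx) : IsBad w' k q ↔ IsBad w k q := by
  unfold IsBad
  rw [T.upperLeft_eq _ hq, T.upperRight_eq _ hq]

theorem chain_outside (T : TriangleMove w w' vx st ty) {l : List (Passage n N)}
    (hl : ∀ q ∈ l, q.vertex ∉ Set.range vx) (h : l.IsChain (Follows w k)) :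
    l.IsChain (Follows w' k) :=
  h.imp_of_mem_imp fun _ _ hq hr h => ⟨h.1, T.orientedEdge (hl _ hq) (hl _ hr) h.2⟩

/-- A rigorous path which avoids the triangle stays rigorous. -/
theorem isRigorousPath_outside (T : TriangleMove w w' vx st ty) {p : List (Passage n N)}
    (hp : IsRigorousPath w k p) (hout : ∀ q ∈ p, q.vertex ∉ Set.range vx) :
    IsRigorousPath w' k p := by
  constructor
  · intro q hq
    rw [T.meets_iff (hout q hq), T.meets_iff (hout q hq)]
    exact hp.meets q hq
  · obtain ⟨q, h1, h2, h3⟩ := hp.start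
    exact ⟨q, h1, h2, T.isLowestOn (hout q (List.mem_of_mem_head? h1)) h3⟩
  · obtain ⟨q, h1, h2, h3⟩ := hp.finish
    exact ⟨q, h1, h2, T.isLowestOn (hout q (List.mem_of_mem_getLast? h1)) h3⟩
  · exact T.chain_outside hout hp.chain
  · exact hp.nodup
  · intro q hq
    rw [T.isBad_iff (hout q hq)]
    exact hp.not_bad q hq

/-- In a rigorous path, a fragment can be replaced by a fragment of the new word which has the
same ends. -/
theorem isRigorousPath_replace (T : TriangleMove w w' vx st ty) {p₁ f f' p₂ : List (Passage n N)}
    (hp : IsRigorousPath w k (p₁ ++ f ++ p₂)) (hp₁ : ∀ q ∈ p₁, q.vertex ∉ Set.range vx)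
    (hp₂ : ∀ q ∈ p₂, q.vertex ∉ Set.range vx) (hf : IsFragment w vx k f)
    (hf' : IsFragment w' vx k f') (hhead : f'.head?.map Passage.inS = f.head?.map Passage.inS)
    (hlast : f'.getLast?.map Passage.outS = f.getLast?.map Passage.outS) :
    IsRigorousPath w' k (p₁ ++ f' ++ p₂) := by
  obtain ⟨a, ha⟩ : ∃ a, f.head? = some a := ⟨_, List.head?_eq_some_head hf.ne_nil⟩
  obtain ⟨a', ha'⟩ : ∃ a, f'.head? = some a := ⟨_, List.head?_eq_some_head hf'.ne_nil⟩
  obtain ⟨z, hz⟩ : ∃ a, f.getLast? = some a := ⟨_, List.getLast?_eq_some_getLast hf.ne_nil⟩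
  obtain ⟨z', hz'⟩ : ∃ a, f'.getLast? = some a := ⟨_, List.getLast?_eq_some_getLast hf'.ne_nil⟩
  have hin : a'.inS = a.inS := by simpa [ha, ha'] using hhead
  have hout : z'.outS = z.outS := by simpa [hz, hz'] using hlast
  obtain ⟨xa, hxa⟩ := hf.vertex_mem a (List.mem_of_mem_head? ha)
  obtain ⟨xa', hxa'⟩ := hf'.vertex_mem a' (List.mem_of_mem_head? ha')
  obtain ⟨xz, hxz⟩ := hf.vertex_mem z (List.mem_of_mem_getLast? hz)
  obtain ⟨xz', hxz'⟩ := hf'.vertex_mem z' (List.mem_of_mem_getLast? hz')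
  have ma' := (hf'.meets a' (List.mem_of_mem_head? ha')).1
  have mz' := (hf'.meets z' (List.mem_of_mem_getLast? hz')).2
  have ea' := hf'.entry a' ha' xa' hxa'.symm
  have ez' := hf'.exit z' hz' xz' hxz'.symm
  have hchain : (p₁ ++ f ++ p₂).IsChain (Follows w k) := hp.chain
  obtain ⟨hc1, hc2, hc3⟩ := List.isChain_append.1 hchain
  obtain ⟨hc4, hc5, hc6⟩ := List.isChain_append.1 hc1
  constructor
  · intro q hq
    rw [List.mem_append, List.mem_append] at hq
    rcases hq with (hq | hq) | hq
    · rw [T.meets_iff (hp₁ q hq), T.meets_iff (hp₁ q hq)]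
      exact hp.meets q (by simp [hq])
    · exact hf'.meets q hq
    · rw [T.meets_iff (hp₂ q hq), T.meets_iff (hp₂ q hq)]
      exact hp.meets q (by simp [hq])
  · obtain ⟨q, h1, h2, h3⟩ := hp.start
    cases p₁ with
    | nil =>
      obtain rfl : a = q := by simpa [ha] using h1
      refine ⟨a', by simp [ha'], hin.trans h2, ?_⟩
      rw [← hxa'] at ma' ⊢
      rw [hin, h2] at ma'
      rw [← hxa] at h3
      refine T.isLowestOn_local h3 ma' fun z hz => ?_
      rw [hin, h2] at ea'
      have := ea' z hz
      rwa [if_pos (isUp_castSucc k)] at this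
    | cons c l =>
      obtain rfl : c = q := by simpa using h1
      exact ⟨c, by simp, h2, T.isLowestOn (hp₁ c (by simp)) h3⟩
  · obtain ⟨q, h1, h2, h3⟩ := hp.finish
    rcases List.eq_nil_or_concat p₂ with rfl | ⟨l, c, rfl⟩
    · obtain rfl : z = q := by simpa [hz] using h1
      refine ⟨z', by simp [hz'], hout.trans h2, ?_⟩
      rw [← hxz'] at mz' ⊢
      rw [hout, h2] at mz'
      rw [← hxz] at h3
      refine T.isLowestOn_local h3 mz' fun y hy => ?_
      rw [hout, h2] at ez'
      have := ez' y hy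
      rwa [if_neg (not_isUp_succ k)] at this
    · obtain rfl : c = q := by simpa using h1
      exact ⟨c, by simp, h2, T.isLowestOn (hp₂ c (by simp)) h3⟩
  -- Inside the three pieces the edges are known. Only the two junctions remain, and there the
  -- fragments arrive and leave on the same strings.
  · refine List.isChain_append.2 ⟨List.isChain_append.2 ⟨T.chain_outside hp₁ hc4, hf'.chain, ?_⟩,
      T.chain_outside hp₂ hc2, ?_⟩
    · intro q hq r hr
      obtain rfl : a' = r := by simpa [ha'] using hr
      have h1 := hc6 q hq a ha
      refine ⟨hin.trans h1.1, ?_⟩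
      rw [← hxa'] at ma' ⊢
      rw [← h1.1, ← hin]
      refine T.orientedEdge_entry (x := xa) (hp₁ q (List.mem_of_mem_getLast? hq)) ?_ ma' ea'
      rw [hin, h1.1, hxa]
      exact h1.2
    · intro q hq r hr
      obtain rfl : z' = q := by simpa [hz'] using hq
      have h1 := hc3 z (by simp [hz]) r hr
      refine ⟨h1.1.trans hout.symm, ?_⟩
      rw [← hxz'] at mz' ⊢
      refine T.orientedEdge_exit (x := xz) (hp₂ r (List.mem_of_mem_head? hr)) ?_ mz' ez'
      rw [hout, hxz]
      exact h1.2
  · have h1 := hp.nodup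
    simp only [List.map_append] at h1 ⊢
    have hd₁ : List.Disjoint (p₁.map Passage.vertex) (f'.map Passage.vertex) := by
      intro v hv hv'
      obtain ⟨q, hq, rfl⟩ := List.mem_map.1 hv
      obtain ⟨r, hr, hqr⟩ := List.mem_map.1 hv'
      exact hp₁ q hq (hqr ▸ hf'.vertex_mem r hr)
    have hd₂ : List.Disjoint (f'.map Passage.vertex) (p₂.map Passage.vertex) := by
      intro v hv' hv
      obtain ⟨q, hq, rfl⟩ := List.mem_map.1 hv
      obtain ⟨r, hr, hqr⟩ := List.mem_map.1 hv'
      exact hp₂ q hq (hqr ▸ hf'.vertex_mem r hr)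
    have hd₃ : List.Disjoint (p₁.map Passage.vertex) (p₂.map Passage.vertex) := by
      have := List.disjoint_of_nodup_append h1
      intro v hv hv'
      exact this (List.mem_append_left _ hv) hv'
    refine ((List.Nodup.append ?_ hf'.nodup hd₁)).append ?_ ?_
    · exact h1.of_append_left.of_append_left
    · exact h1.of_append_right
    · rw [List.disjoint_append_left]
      exact ⟨hd₃, hd₂⟩
  · intro q hq
    rw [List.mem_append, List.mem_append] at hq
    rcases hq with (hq | hq) | hq
    · rw [T.isBad_iff (hp₁ q hq)]
      exact hp.not_bad q (by simp [hq])
    · exact hf'.not_bad q hq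
    · rw [T.isBad_iff (hp₂ q hq)]
      exact hp.not_bad q (by simp [hq])

end TriangleMove

theorem stringCoeff_append (p p' : List (Passage n N)) (v : Fin N) :
    stringCoeff (p ++ p') v = stringCoeff p v + stringCoeff p' v := by
  simp [stringCoeff]

theorem stringCoeff_eq_zero {p : List (Passage n N)} {v : Fin N} (h : ∀ q ∈ p, q.vertex ≠ v) :
    stringCoeff p v = 0 := by
  unfold stringCoeff
  apply List.sum_eq_zero
  intro c hc
  obtain ⟨q, hq, rfl⟩ := List.mem_map.1 hc
  rw [if_neg (h q hq)]

/-- The vector with the entries `t` at the crossings `vx`, which agrees with `M` elsewhere. -/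
def replaceAt (vx : Fin 3 → Fin N) (M : Fin N → ℤ) (t : ℤ × ℤ × ℤ) : Fin N → ℤ := fun v =>
  if v = vx 0 then t.1 else if v = vx 1 then t.2.1 else if v = vx 2 then t.2.2 else M v

/-- The string inequalities before and after a 3-move correspond to each other as monomials do
under the rational map. -/
theorem stringVectors_exchange (hw : IsReducedLongest w) (T : TriangleMove w w' vx st ty)
    {M : Fin N → ℤ} (hM : M ∈ stringVectors w) :
    moveTable (M (vx 0)) (M (vx 1)) (M (vx 2)) ≠ [] ∧
      ∀ t ∈ moveTable (M (vx 0)) (M (vx 1)) (M (vx 2)), replaceAt vx M t ∈ stringVectors w' := by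
  obtain ⟨k, p, hp, rfl⟩ := hM
  have h01 : vx 0 ≠ vx 1 := fun h => absurd (T.source.vx_injective h) (by decide)
  have h02 : vx 0 ≠ vx 2 := fun h => absurd (T.source.vx_injective h) (by decide)
  have h12 : vx 1 ≠ vx 2 := fun h => absurd (T.source.vx_injective h) (by decide)
  rcases T.source.decompose hw hp with hout | ⟨p₁, f, p₂, rfl, hp₁, hp₂, hf⟩
  -- A path that avoids the triangle has local exponents (0, 0, 0), which the table fixes.
  · have h0 : ∀ x, stringCoeff p (vx x) = 0 := fun x =>
      stringCoeff_eq_zero fun q hq h => hout q hq ⟨x, h.symm⟩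
    simp only [h0, neg_zero]
    refine ⟨by decide, fun t ht => ?_⟩
    obtain rfl : t = (0, 0, 0) := by simpa [moveTable] using ht
    refine ⟨k, p, T.isRigorousPath_outside hp hout, ?_⟩
    funext v
    unfold replaceAt
    split_ifs with h1 h2 h3
    · rw [h1, h0]; rfl
    · rw [h2, h0]; rfl
    · rw [h3, h0]; rfl
    · rfl
  · have e1 : ∀ g : List (Passage n N), ∀ x,
        stringCoeff (p₁ ++ g ++ p₂) (vx x) = stringCoeff g (vx x) := by
      intro g x
      rw [stringCoeff_append, stringCoeff_append,
        stringCoeff_eq_zero (p := p₁) fun q hq h => hp₁ q hq ⟨x, h.symm⟩,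
        stringCoeff_eq_zero (p := p₂) fun q hq h => hp₂ q hq ⟨x, h.symm⟩]
      simp
    obtain ⟨h1, h2⟩ := fragment_exchange T hf
    simp only [e1]
    refine ⟨h1, fun t ht => ?_⟩
    obtain ⟨f', hf', hhead, hlast, rfl⟩ := h2 t ht
    refine ⟨k, p₁ ++ f' ++ p₂, T.isRigorousPath_replace hp hp₁ hp₂ hf hf' hhead hlast, ?_⟩
    funext v
    unfold replaceAt
    split_ifs with h3 h4 h5
    · rw [h3, e1]; rfl
    · rw [h4, e1]; rfl
    · rw [h5, e1]; rfl
    · have hv : v ∉ Set.range vx := by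
        rintro ⟨x, rfl⟩
        match x with
        | 0 => exact h3 rfl
        | 1 => exact h4 rfl
        | 2 => exact h5 rfl
      simp only [stringCoeff_append]
      rw [stringCoeff_eq_zero (p := f) fun q hq h => hv (by
          rw [← h]
          exact hf.vertex_mem q hq),
        stringCoeff_eq_zero (p := f') fun q hq h => hv (by
          rw [← h]
          exact hf'.vertex_mem q hq)]

end Surgery

/-! ### Walks around a box -/

section Box

variable {n N : ℕ} {w : Word n N} {k : Fin n}

/-- If the largest upward string whose side changes has its side decreased, then there is no such
string, and the walk uses downward strings only. -/
theorem down_of_sides (hw : IsReducedLongest w) {q r : Passage n N}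
    (h : Relation.TransGen (Step w k Set.univ) q r)
    (hu : ∀ u, IsUp k u → (outSide w k u q = inSide w k u r ∧ outSide w k u q ≠ 1) ∨
      ∃ u', u ≤ u' ∧ IsUp k u' ∧ inSide w k u' r < outSide w k u' q) :
    Relation.TransGen (Step w k {s | ¬ IsUp k s}) q r := by
  classical
  by_cases hex : ∃ u, IsUp k u ∧ inSide w k u r < outSide w k u q
  · exfalso
    -- Consider the largest upward string whose side decreases. By its choice the first alternative
    -- of `hu` holds for all larger upward strings, so they are avoided; then its side is monotone,
    -- a contradiction.
    let F := Finset.univ.filter fun u => IsUp k u ∧ inSide w k u r < outSide w k u q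
    have hF : F.Nonempty := by
      obtain ⟨u, hu⟩ := hex
      exact ⟨u, by simpa [F] using hu⟩
    obtain ⟨h1, h2⟩ := (Finset.mem_filter.1 (F.max'_mem hF)).2
    have h3 := avoids_up hw (u₀ := (F.max' hF : ℕ) + 1) h fun u hup hlt => by
      rcases hu u hup with h4 | ⟨u', h4, h5, h6⟩
      · exact h4
      · have h7 := F.le_max' u' (by simp [F, h5, h6])
        have h8 := Fin.le_def.1 (h4.trans h7)
        omega
    have h4 := (side_monotone hw (u := F.max' hF) ?_ h3).1
    · omega
    · intro s hs hne
      constructor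
      · intro h5
        exact lt_of_le_of_ne (Nat.lt_succ_iff.1 (hs h5)) hne
      · intro h5
        exact h1.of_le h5.le
  · push Not at hex
    have h1 := avoids_up hw (u₀ := 0) h fun u hup _ => by
      rcases hu u hup with h4 | ⟨u', _, h5, h6⟩
      · exact h4
      · exact absurd h6 (hex u' h5).not_gt
    exact Step.transGen_mono (S := {s | IsUp k s → (s : ℕ) < 0})
      (fun a c hac => hac.mono fun h hup => Nat.not_lt_zero _ (h hup)) h1

/-- The analogue of `down_of_sides` for the downward strings. -/
theorem up_of_sides (hw : IsReducedLongest w) {q r : Passage n N}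
    (h : Relation.TransGen (Step w k Set.univ) q r)
    (hu : ∀ u, ¬ IsUp k u → (outSide w k u q = inSide w k u r ∧ outSide w k u q ≠ 1) ∨
      ∃ u', u' ≤ u ∧ ¬ IsUp k u' ∧ inSide w k u' r < outSide w k u' q) :
    Relation.TransGen (Step w k {s | IsUp k s}) q r := by
  classical
  by_cases hex : ∃ u, ¬ IsUp k u ∧ inSide w k u r < outSide w k u q
  · exfalso
    -- For downward strings the smallest one is taken, since `avoids_down` removes them in
    -- increasing order.
    let F := Finset.univ.filter fun u => ¬ IsUp k u ∧ inSide w k u r < outSide w k u q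
    have hF : F.Nonempty := by
      obtain ⟨u, hu⟩ := hex
      exact ⟨u, by simpa [F] using hu⟩
    obtain ⟨h1, h2⟩ := (Finset.mem_filter.1 (F.min'_mem hF)).2
    have h3 := avoids_down hw (u₀ := (F.min' hF : ℕ)) h fun u hup hlt => by
      rcases hu u hup with h4 | ⟨u', h4, h5, h6⟩
      · exact h4
      · have h7 := F.min'_le u' (by simp [F, h5, h6])
        have h8 := Fin.le_def.1 (h7.trans h4)
        omega
    have h4 := (side_monotone hw (u := F.min' hF) ?_ h3).1
    · omega
    · intro s hs hne
      constructor
      · intro h5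
        exact h5.lt h1
      · intro h5
        by_contra h6
        exact absurd (Fin.lt_def.1 h5) (hs h6).not_gt
  · push Not at hex
    have h1 := avoids_down hw (u₀ := n + 1) h fun u hup _ => by
      rcases hu u hup with h4 | ⟨u', _, h5, h6⟩
      · exact h4
      · exact absurd h6 (hex u' h5).not_gt
    refine Step.transGen_mono (S := {s | ¬ IsUp k s → n + 1 ≤ (s : ℕ)})
      (fun a c hac => hac.mono fun h => ?_) h1
    by_contra hup
    have h3 : n + 1 ≤ (a.outS : ℕ) := h hup
    omega

/-! ### A box as a barrier for strings and walks. -/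

variable {top bot : Fin N}

/-- Between the two crossings of a box, a string does not cross the column of the box. -/
theorem IsBox.pos_le_iff (hbox : IsBox w top bot) (u : Fin (n + 1)) {m : ℕ}
    (h1 : (top : ℕ) + 1 ≤ m) (h2 : m ≤ bot) :
    pos w m u ≤ w top ↔ pos w (top + 1) u ≤ w top := by
  induction m, h1 using Nat.le_induction with
  | base => rfl
  | succ m hm ih =>
    rw [← ih (by omega)]
    let v : Fin N := ⟨m, by omega⟩
    -- A string can pass between the positions up to `w top` and those beyond it only at a crossing
    -- of that column.
    have hv : w v ≠ w top := hbox.2.2 v (Fin.lt_def.2 hm) (Fin.lt_def.2 h2)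
    have hv' : (w v : ℕ) ≠ w top := fun h => hv (Fin.ext h)
    by_cases hmeet : Meets w v u
    · rcases hmeet.pos_cases with ⟨-, h3, h4⟩ | ⟨-, h3, h4⟩
      · have h3' : pos w m u = w v := h3
        have h4' : pos w (m + 1) u = w v + 1 := h4
        omega
      · have h3' : pos w m u = w v + 1 := h3
        have h4' : pos w (m + 1) u = w v := h4
        omega
    · have h3 : pos w (m + 1) u = pos w m u := pos_succ_of_not_meets w v hmeet
      rw [h3]

/-- A crossing on the boundary of a box: its top, its bottom, or a crossing of a neighbouring
column between these. -/
def OnBox (w : Word n N) (top bot v : Fin N) : Prop :=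
  v = top ∨ v = bot ∨ (top < v ∧ v < bot ∧ ((w v : ℕ) = w top + 1 ∨ (w v : ℕ) + 1 = w top))

/-- All crossings on the boundary of a box are on the same side of a string. -/
theorem IsBox.side_eq (hbox : IsBox w top bot) {v : Fin N} (hv : OnBox w top bot v)
    {s u : Fin (n + 1)} (hs : Meets w v s) (hu : ¬ Meets w v u) {m : ℕ}
    (hm : m = v ∨ m = v + 1) :
    side w u s m = if pos w (top + 1) u ≤ w top then 0 else 2 := by
  have hne : s ≠ u := by rintro rfl; exact hu hs
  have h1 := pos_ne_of_not_meets w v hu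
  have h2 := pos_succ_of_not_meets w v hu
  have h4 : (pos w v u ≤ w top ∧ v ≠ top) ∨ v = top ∨ (¬ pos w v u ≤ w top ∧ v ≠ top) := by tauto
  -- The column of `v` is that of the box or next to it. As `u` misses `v`, it lies on the same side
  -- of both strings at `v` as it does of the column of the box.
  have key : (pos w m s < pos w m u) ↔ ¬ pos w (top + 1) u ≤ w top := by
    rcases hv with rfl | rfl | ⟨h5, h6, h7⟩
    · rcases hs.pos_cases with h8 | h8 <;> rcases hm with rfl | rfl <;> omega
    · have h5 := hbox.pos_le_iff u (m := v) (Fin.lt_def.1 hbox.1) le_rfl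
      have h6 := hbox.2.1
      rw [h6] at h5 ⊢
      rcases hs.pos_cases with h8 | h8 <;> rcases hm with rfl | rfl <;> omega
    · have h9 := hbox.pos_le_iff u (m := v) (Fin.lt_def.1 h5) (Fin.lt_def.1 h6).le
      rcases hs.pos_cases with h8 | h8 <;> rcases hm with rfl | rfl <;> omega
  unfold side
  rw [if_neg hne]
  by_cases h : pos w (top + 1) u ≤ w top
  · rw [if_pos h, if_neg fun h' => key.1 h' h]
  · rw [if_neg h, if_pos (key.2 h)]

theorem IsBox.inSide_eq (hbox : IsBox w top bot) {q : Passage n N} (hv : OnBox w top bot q.vertex)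
    (hq : Meets w q.vertex q.inS) {u : Fin (n + 1)} (hu : ¬ Meets w q.vertex u) :
    inSide w k u q = if pos w (top + 1) u ≤ w top then 0 else 2 :=
  hbox.side_eq hv hq hu (Triangle.inLevel_cases q)

theorem IsBox.outSide_eq (hbox : IsBox w top bot) {q : Passage n N}
    (hv : OnBox w top bot q.vertex) (hq : Meets w q.vertex q.outS) {u : Fin (n + 1)}
    (hu : ¬ Meets w q.vertex u) :
    outSide w k u q = if pos w (top + 1) u ≤ w top then 0 else 2 :=
  hbox.side_eq hv hq hu (Triangle.outLevel_cases q)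

theorem transGen_meets_left {S : Set (Fin (n + 1))} {q r : Passage n N}
    (h : Relation.TransGen (Step w k S) q r) : Meets w q.vertex q.outS := by
  cases h using Relation.TransGen.head_induction_on with
  | single h => exact h.2.2.meets_left
  | head h _ _ => exact h.2.2.meets_left

theorem transGen_meets_right {S : Set (Fin (n + 1))} {q r : Passage n N}
    (h : Relation.TransGen (Step w k S) q r) : Meets w r.vertex r.inS := by
  cases h with
  | single h => rw [h.2.1]; exact h.2.2.meets_right
  | tail _ h => rw [h.2.1]; exact h.2.2.meets_right

/-- In the range of a box, a string does not change the side of the box at a crossing. -/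
theorem IsBox.switch_le (hbox : IsBox w top bot) {v : Fin N} (h1 : top < v) (h2 : v < bot)
    {s t : Fin (n + 1)} (hs : Meets w v s) (ht : Meets w v t) {a b : ℕ} (ha : a = v ∨ a = v + 1)
    (hb : b = v ∨ b = v + 1) (h : pos w a s ≤ w top) : pos w b t ≤ w top := by
  have hv : (w v : ℕ) ≠ w top := fun h => hbox.2.2 v h1 h2 (Fin.ext h)
  rcases hs.pos_cases with h3 | h3 <;> rcases ht.pos_cases with h4 | h4 <;>
    rcases ha with rfl | rfl <;> rcases hb with rfl | rfl <;> omega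

/-- A downward walk in the range of a box stays on the left of the box. -/
theorem IsBox.down_stays_left (hbox : IsBox w top bot) {q r : Passage n N}
    (h : Relation.TransGen (Step w k {s | ¬ IsUp k s}) q r) (h1 : top ≤ q.vertex)
    (h2 : r.vertex ≤ bot) (h3 : pos w (q.vertex + 1) q.outS ≤ w top) :
    pos w r.vertex r.inS ≤ w top := by
  have edge : ∀ a b : Passage n N, Step w k {s | ¬ IsUp k s} a b → top ≤ a.vertex →
      b.vertex ≤ bot → pos w (a.vertex + 1) a.outS ≤ w top → pos w b.vertex b.inS ≤ w top := by
    intro a b hab ha hb hpos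
    have hlt : a.vertex < b.vertex := vertex_lt_of_down (.single hab)
    rw [hab.2.1]
    rw [Fin.le_def] at ha hb
    rw [Fin.lt_def] at hlt
    rw [hbox.pos_le_iff _ (by omega) (by omega)] at hpos ⊢
    exact hpos
  induction h with
  | single h => exact edge _ _ h h1 h2 h3
  | @tail r r' h h' ih =>
    have hlt : r.vertex < r'.vertex := vertex_lt_of_down (.single h')
    have hlt' : q.vertex < r.vertex := vertex_lt_of_down h
    have h4 := ih (hlt.le.trans h2)
    refine edge _ _ h' (h1.trans hlt'.le) h2 ?_
    exact hbox.switch_le (h1.trans_lt hlt') (hlt.trans_le h2) (transGen_meets_right h)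
      h'.2.2.meets_left (Or.inl rfl) (Or.inr rfl) h4

/-- An upward walk in the range of a box stays on the left of the box. -/
theorem IsBox.up_stays_left (hbox : IsBox w top bot) {q r : Passage n N}
    (h : Relation.TransGen (Step w k {s | IsUp k s}) q r) (h1 : q.vertex ≤ bot)
    (h2 : top ≤ r.vertex) (h3 : pos w q.vertex q.outS ≤ w top) :
    pos w (r.vertex + 1) r.inS ≤ w top := by
  have edge : ∀ a b : Passage n N, Step w k {s | IsUp k s} a b → a.vertex ≤ bot →
      top ≤ b.vertex → pos w a.vertex a.outS ≤ w top → pos w (b.vertex + 1) b.inS ≤ w top := by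
    intro a b hab ha hb hpos
    have hlt : b.vertex < a.vertex := vertex_lt_of_up (.single hab)
    rw [hab.2.1]
    rw [Fin.le_def] at ha hb
    rw [Fin.lt_def] at hlt
    rw [hbox.pos_le_iff _ (by omega) (by omega)] at hpos ⊢
    exact hpos
  induction h with
  | single h => exact edge _ _ h h1 h2 h3
  | @tail r r' h h' ih =>
    have hlt : r'.vertex < r.vertex := vertex_lt_of_up (.single h')
    have hlt' : r.vertex < q.vertex := vertex_lt_of_up h
    have h4 := ih (h2.trans hlt.le)
    refine edge _ _ h' (hlt'.le.trans h1) h2 ?_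
    exact hbox.switch_le (h2.trans_lt hlt) (hlt'.trans_le h1) (transGen_meets_right h)
      h'.2.2.meets_left (Or.inr rfl) (Or.inl rfl) h4

/-- A path which switches to the larger string at the top of a box does not pass through a
crossing of two downward strings on the right of the box. -/
theorem IsBox.not_top_right_down (hw : IsReducedLongest w) (hbox : IsBox w top bot)
    {q r : Passage n N} (hq : q.vertex = top) (hin : q.inS = upperLeft w top)
    (hout : q.outS = upperRight w top) (h1 : top < r.vertex) (h2 : r.vertex < bot)
    (hcol : (w r.vertex : ℕ) = w top + 1) (hdown : ∀ s, Meets w r.vertex s → ¬ IsUp k s)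
    (h : Relation.TransGen (Step w k Set.univ) q r ∨
      Relation.TransGen (Step w k Set.univ) r q) : False := by
  obtain ⟨v, s, t⟩ := q
  simp only at hq hin hout
  subst hq hin hout
  have hlt := upperLeft_lt_upperRight hw v
  have hr : OnBox w v bot r.vertex := Or.inr (Or.inr ⟨h1, h2, Or.inl hcol⟩)
  have hq : OnBox w v bot v := Or.inl rfl
  have hL : pos w (v + 1) (upperRight w v) ≤ w v := (pos_succ_upperRight w v).le
  have hR : ¬ pos w (v + 1) (upperLeft w v) ≤ w v := by rw [pos_succ_upperLeft]; omega
  rcases h with h | h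
  · have hrm := transGen_meets_right h
    -- No upward string meets `r`, and one that misses the top has both ends on one side. If the
    -- right string at the top goes up, its side falls from 1 to 0, which is the second alternative;
    -- if only the left one goes up, both ends are on the left of it. So the walk goes down, and it
    -- stays on the left of the box where it started, while `r` is on the right.
    have hd := down_of_sides hw h (fun u hu => by
      have hur : ¬ Meets w r.vertex u := fun hm => hdown u hm hu
      have e1 := hbox.inSide_eq (k := k) hr hrm hur
      by_cases hum : Meets w v u
      · by_cases hc : IsUp k (upperRight w v)
        · refine Or.inr ⟨upperRight w v, ?_, hc, ?_⟩
          · rcases hum with rfl | rfl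
            · exact hlt.le
            · exact le_rfl
          · rw [hbox.inSide_eq hr hrm fun hm => hdown _ hm hc, if_pos hL]
            simp [outSide, side]
        · left
          rcases hum with rfl | rfl
          · rw [e1, if_neg hR]
            have : pos w (v + 1) (upperRight w v) < pos w (v + 1) (upperLeft w v) := by omega
            simp [outSide, side, outLevel, hc, this, hlt.ne']
          · exact absurd hu hc
      · left
        rw [e1, hbox.outSide_eq hq (Or.inr rfl) hum]
        split_ifs <;> simp)
    have := hbox.down_stays_left hd le_rfl h2.le hL
    rcases hrm.pos_cases with h3 | h3 <;> omega
  · have hrm := transGen_meets_left h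
    have hd := down_of_sides hw h (fun u hu => by
      have hur : ¬ Meets w r.vertex u := fun hm => hdown u hm hu
      have e1 := hbox.outSide_eq (k := k) hr hrm hur
      by_cases hum : Meets w v u
      · rcases hum with rfl | rfl
        · refine Or.inr ⟨_, le_rfl, hu, ?_⟩
          rw [e1, if_neg hR]
          simp [inSide, side]
        · left
          have hc : IsUp k (upperLeft w v) := hu.of_le hlt.le
          rw [e1, if_pos hL]
          have : ¬ pos w (v + 1) (upperLeft w v) < pos w (v + 1) (upperRight w v) := by omega
          simp [inSide, side, inLevel, hc, this, hlt.ne]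
      · left
        rw [e1, hbox.inSide_eq hq (Or.inl rfl) hum]
        split_ifs <;> simp)
    -- The walk would descend from `r` to the top of the box, which is above `r`.
    exact absurd (vertex_lt_of_down hd) h1.not_gt

/-- A path which switches to the larger string at the top of a box does not pass through a
crossing of two upward strings on the left of the box. -/
theorem IsBox.not_top_left_up (hw : IsReducedLongest w) (hbox : IsBox w top bot)
    {q r : Passage n N} (hq : q.vertex = top) (hin : q.inS = upperLeft w top)
    (hout : q.outS = upperRight w top) (h1 : top < r.vertex) (h2 : r.vertex < bot)
    (hcol : (w r.vertex : ℕ) + 1 = w top) (hup : ∀ s, Meets w r.vertex s → IsUp k s)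
    (h : Relation.TransGen (Step w k Set.univ) q r ∨
      Relation.TransGen (Step w k Set.univ) r q) : False := by
  obtain ⟨v, s, t⟩ := q
  simp only at hq hin hout
  subst hq hin hout
  have hlt := upperLeft_lt_upperRight hw v
  have hr : OnBox w v bot r.vertex := Or.inr (Or.inr ⟨h1, h2, Or.inr hcol⟩)
  have hq : OnBox w v bot v := Or.inl rfl
  have hL : pos w (v + 1) (upperRight w v) ≤ w v := (pos_succ_upperRight w v).le
  have hR : ¬ pos w (v + 1) (upperLeft w v) ≤ w v := by rw [pos_succ_upperLeft]; omega
  have hdn : ∀ {s t : Fin (n + 1)}, ¬ IsUp k s → s ≤ t → ¬ IsUp k t :=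
    fun hs hst ht => hs (ht.of_le hst)
  rcases h with h | h
  · have hrm := transGen_meets_right h
    have hd := up_of_sides hw h (fun u hu => by
      have hur : ¬ Meets w r.vertex u := fun hm => hu (hup u hm)
      have e1 := hbox.inSide_eq (k := k) hr hrm hur
      by_cases hum : Meets w v u
      · rcases hum with rfl | rfl
        · left
          have hc : ¬ IsUp k (upperRight w v) := hdn hu hlt.le
          rw [e1, if_neg hR]
          have : pos w (v + 1) (upperRight w v) < pos w (v + 1) (upperLeft w v) := by omega
          simp [outSide, side, outLevel, hc, this, hlt.ne']
        · refine Or.inr ⟨_, le_rfl, hu, ?_⟩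
          rw [e1, if_pos hL]
          simp [outSide, side]
      · left
        rw [e1, hbox.outSide_eq hq (Or.inr rfl) hum]
        split_ifs <;> simp)
    exact absurd (vertex_lt_of_up hd) h1.not_gt
  · have hrm := transGen_meets_left h
    have hd := up_of_sides hw h (fun u hu => by
      have hur : ¬ Meets w r.vertex u := fun hm => hu (hup u hm)
      have e1 := hbox.outSide_eq (k := k) hr hrm hur
      by_cases hum : Meets w v u
      · by_cases hc : IsUp k (upperLeft w v)
        · left
          rcases hum with rfl | rfl
          · exact absurd hc hu
          · rw [e1, if_pos hL]
            have : ¬ pos w (v + 1) (upperLeft w v) < pos w (v + 1) (upperRight w v) := by omega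
            simp [inSide, side, inLevel, hc, this, hlt.ne]
        · refine Or.inr ⟨upperLeft w v, ?_, hc, ?_⟩
          · rcases hum with rfl | rfl
            · exact le_rfl
            · exact hlt.le
          · rw [hbox.outSide_eq hr hrm fun hm => hc (hup _ hm), if_neg hR]
            simp [inSide, side]
      · left
        rw [e1, hbox.inSide_eq hq (Or.inl rfl) hum]
        split_ifs <;> simp)
    -- The upward walk starts on the left of the box and stays there, but it should reach the top on
    -- the string that bounds the box from the right.
    have h3 : pos w r.vertex r.outS ≤ w v := by
      rcases hrm.pos_cases with h3 | h3 <;> omega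
    exact hR (hbox.up_stays_left hd h2.le le_rfl h3)

/-- A path which switches to the smaller string at the bottom of a box does not pass through a
crossing of two upward strings on the right of the box. -/
theorem IsBox.not_bot_right_up (hw : IsReducedLongest w) (hbox : IsBox w top bot)
    {q r : Passage n N} (hq : q.vertex = bot) (hin : q.inS = upperRight w bot)
    (hout : q.outS = upperLeft w bot) (h1 : top < r.vertex) (h2 : r.vertex < bot)
    (hcol : (w r.vertex : ℕ) = w top + 1) (hup : ∀ s, Meets w r.vertex s → IsUp k s)
    (h : Relation.TransGen (Step w k Set.univ) q r ∨
      Relation.TransGen (Step w k Set.univ) r q) : False := by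
  obtain ⟨v, s, t⟩ := q
  simp only at hq hin hout
  subst hq hin hout
  have hlt := upperLeft_lt_upperRight hw v
  have hr : OnBox w top v r.vertex := Or.inr (Or.inr ⟨h1, h2, Or.inl hcol⟩)
  have hq : OnBox w top v v := Or.inr (Or.inl rfl)
  have hlv : pos w v (upperLeft w v) ≤ w top := by rw [pos_upperLeft, hbox.2.1]
  have hrv : ¬ pos w v (upperRight w v) ≤ w top := by rw [pos_upperRight, hbox.2.1]; omega
  have hL := hlv
  have hR := hrv
  rw [hbox.pos_le_iff _ (Fin.lt_def.1 hbox.1) le_rfl] at hL hR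
  have hdn : ∀ {s t : Fin (n + 1)}, ¬ IsUp k s → s ≤ t → ¬ IsUp k t :=
    fun hs hst ht => hs (ht.of_le hst)
  rcases h with h | h
  · have hrm := transGen_meets_right h
    have hd := up_of_sides hw h (fun u hu => by
      have hur : ¬ Meets w r.vertex u := fun hm => hu (hup u hm)
      have e1 := hbox.inSide_eq (k := k) hr hrm hur
      by_cases hum : Meets w v u
      · by_cases hc : IsUp k (upperLeft w v)
        · left
          rcases hum with rfl | rfl
          · exact absurd hc hu
          · rw [e1, if_neg hR]
            have : pos w v (upperLeft w v) < pos w v (upperRight w v) := by omega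
            simp [outSide, side, outLevel, hc, this, hlt.ne]
        · refine Or.inr ⟨upperLeft w v, ?_, hc, ?_⟩
          · rcases hum with rfl | rfl
            · exact le_rfl
            · exact hlt.le
          · rw [hbox.inSide_eq hr hrm fun hm => hc (hup _ hm), if_pos hL]
            simp [outSide, side]
      · left
        rw [e1, hbox.outSide_eq hq (Or.inl rfl) hum]
        split_ifs <;> simp)
    -- The upward walk leaves the bottom along the left side of the box, so it cannot reach `r` on
    -- the right.
    have := hbox.up_stays_left hd le_rfl h1.le hlv
    rcases hrm.pos_cases with h3 | h3 <;> omega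
  · have hrm := transGen_meets_left h
    have hd := up_of_sides hw h (fun u hu => by
      have hur : ¬ Meets w r.vertex u := fun hm => hu (hup u hm)
      have e1 := hbox.outSide_eq (k := k) hr hrm hur
      by_cases hum : Meets w v u
      · rcases hum with rfl | rfl
        · left
          have hc : ¬ IsUp k (upperRight w v) := hdn hu hlt.le
          rw [e1, if_pos hL]
          have : ¬ pos w v (upperRight w v) < pos w v (upperLeft w v) := by omega
          simp [inSide, side, inLevel, hc, this, hlt.ne']
        · refine Or.inr ⟨_, le_rfl, hu, ?_⟩
          rw [e1, if_neg hR]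
          simp [inSide, side]
      · left
        rw [e1, hbox.inSide_eq hq (Or.inr rfl) hum]
        split_ifs <;> simp)
    exact absurd (vertex_lt_of_up hd) h2.not_gt

/-- A path which switches to the smaller string at the bottom of a box does not pass through a
crossing of two downward strings on the left of the box. -/
theorem IsBox.not_bot_left_down (hw : IsReducedLongest w) (hbox : IsBox w top bot)
    {q r : Passage n N} (hq : q.vertex = bot) (hin : q.inS = upperRight w bot)
    (hout : q.outS = upperLeft w bot) (h1 : top < r.vertex) (h2 : r.vertex < bot)
    (hcol : (w r.vertex : ℕ) + 1 = w top) (hdown : ∀ s, Meets w r.vertex s → ¬ IsUp k s)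
    (h : Relation.TransGen (Step w k Set.univ) q r ∨
      Relation.TransGen (Step w k Set.univ) r q) : False := by
  obtain ⟨v, s, t⟩ := q
  simp only at hq hin hout
  subst hq hin hout
  have hlt := upperLeft_lt_upperRight hw v
  have hr : OnBox w top v r.vertex := Or.inr (Or.inr ⟨h1, h2, Or.inr hcol⟩)
  have hq : OnBox w top v v := Or.inr (Or.inl rfl)
  have hlv : pos w v (upperLeft w v) ≤ w top := by rw [pos_upperLeft, hbox.2.1]
  have hrv : ¬ pos w v (upperRight w v) ≤ w top := by rw [pos_upperRight, hbox.2.1]; omega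
  have hL := hlv
  have hR := hrv
  rw [hbox.pos_le_iff _ (Fin.lt_def.1 hbox.1) le_rfl] at hL hR
  rcases h with h | h
  · have hrm := transGen_meets_right h
    have hd := down_of_sides hw h (fun u hu => by
      have hur : ¬ Meets w r.vertex u := fun hm => hdown u hm hu
      have e1 := hbox.inSide_eq (k := k) hr hrm hur
      by_cases hum : Meets w v u
      · rcases hum with rfl | rfl
        · refine Or.inr ⟨_, le_rfl, hu, ?_⟩
          rw [e1, if_pos hL]
          simp [outSide, side]
        · left
          have hc : IsUp k (upperLeft w v) := hu.of_le hlt.le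
          rw [e1, if_neg hR]
          have : pos w v (upperLeft w v) < pos w v (upperRight w v) := by omega
          simp [outSide, side, outLevel, hc, this, hlt.ne]
      · left
        rw [e1, hbox.outSide_eq hq (Or.inl rfl) hum]
        split_ifs <;> simp)
    exact absurd (vertex_lt_of_down hd) h2.not_gt
  · have hrm := transGen_meets_left h
    have hd := down_of_sides hw h (fun u hu => by
      have hur : ¬ Meets w r.vertex u := fun hm => hdown u hm hu
      have e1 := hbox.outSide_eq (k := k) hr hrm hur
      by_cases hum : Meets w v u
      · by_cases hc : IsUp k (upperRight w v)
        · refine Or.inr ⟨upperRight w v, ?_, hc, ?_⟩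
          · rcases hum with rfl | rfl
            · exact hlt.le
            · exact le_rfl
          · rw [hbox.outSide_eq hr hrm fun hm => hdown _ hm hc, if_neg hR]
            simp [inSide, side]
        · left
          rcases hum with rfl | rfl
          · rw [e1, if_pos hL]
            have : ¬ pos w v (upperRight w v) < pos w v (upperLeft w v) := by omega
            simp [inSide, side, inLevel, hc, this, hlt.ne']
          · exact absurd hu hc
      · left
        rw [e1, hbox.inSide_eq hq (Or.inr rfl) hum]
        split_ifs <;> simp)
    -- The downward walk starts on the left of the box, but it should reach the bottom on the string
    -- that bounds the box from the right.
    have h3 : pos w (r.vertex + 1) r.outS ≤ w top := by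
      rcases hrm.pos_cases with h3 | h3 <;> omega
    exact hrv (hbox.down_stays_left hd h1.le le_rfl h3)

end Box

/-! ### Passages and coefficients -/

section Passages

variable {n N : ℕ} {w : Word n N} {k : Fin n} {p : List (Passage n N)}

theorem stringCoeff_eq_switchSign (hp : (p.map Passage.vertex).Nodup) {q : Passage n N}
    (hq : q ∈ p) : stringCoeff p q.vertex = switchSign q := by
  obtain ⟨l₁, l₂, rfl⟩ := List.append_of_mem hq
  rw [List.map_append, List.map_cons, List.nodup_append, List.nodup_cons] at hp
  obtain ⟨-, ⟨h2, -⟩, h3⟩ := hp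
  have e1 : stringCoeff l₁ q.vertex = 0 := stringCoeff_eq_zero fun r hr h =>
    h3 _ (List.mem_map_of_mem hr) _ List.mem_cons_self h
  have e2 : stringCoeff l₂ q.vertex = 0 := stringCoeff_eq_zero fun r hr h =>
    h2 (h ▸ List.mem_map_of_mem hr)
  rw [← List.singleton_append, stringCoeff_append, stringCoeff_append, e1, e2]
  simp [stringCoeff]

theorem exists_passage (hp : (p.map Passage.vertex).Nodup) {v : Fin N} (h : stringCoeff p v ≠ 0) :
    ∃ q ∈ p, q.vertex = v ∧ switchSign q = stringCoeff p v := by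
  have : ∃ q ∈ p, q.vertex = v := by
    by_contra! hno
    exact h (stringCoeff_eq_zero hno)
  obtain ⟨q, hq, rfl⟩ := this
  exact ⟨q, hq, rfl, (stringCoeff_eq_switchSign hp hq).symm⟩

theorem inS_outS_of_switchSign_eq_one (hw : IsReducedLongest w) {q : Passage n N}
    (h1 : Meets w q.vertex q.inS) (h2 : Meets w q.vertex q.outS) (h : switchSign q = 1) :
    q.inS = upperLeft w q.vertex ∧ q.outS = upperRight w q.vertex := by
  have hlt := upperLeft_lt_upperRight hw q.vertex
  unfold switchSign at h
  rcases h1 with h1 | h1 <;> rcases h2 with h2 | h2 <;>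
    simp_all [hlt.not_gt]

theorem inS_outS_of_switchSign_eq_neg_one (hw : IsReducedLongest w) {q : Passage n N}
    (h1 : Meets w q.vertex q.inS) (h2 : Meets w q.vertex q.outS) (h : switchSign q = -1) :
    q.inS = upperRight w q.vertex ∧ q.outS = upperLeft w q.vertex := by
  have hlt := upperLeft_lt_upperRight hw q.vertex
  unfold switchSign at h
  rcases h1 with h1 | h1 <;> rcases h2 with h2 | h2 <;>
    simp_all [hlt.not_gt]

theorem transGen_or_transGen (hp : p.IsChain (Follows w k)) {q r : Passage n N} (hq : q ∈ p)
    (hr : r ∈ p) (hne : q ≠ r) :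
    Relation.TransGen (Step w k Set.univ) q r ∨ Relation.TransGen (Step w k Set.univ) r q := by
  obtain ⟨l₁, l₂, rfl⟩ := List.append_of_mem hq
  rcases List.mem_append.1 hr with h | h
  · obtain ⟨l₃, l₄, rfl⟩ := List.append_of_mem h
    rw [List.append_assoc, List.cons_append] at hp
    exact Or.inr (transGen_of_chain hp)
  · rcases List.mem_cons.1 h with rfl | h
    · exact absurd rfl hne
    · obtain ⟨l₃, l₄, rfl⟩ := List.append_of_mem h
      exact Or.inl (transGen_of_chain hp)

/-! ### Weights -/

/-- The pairing of an exponent vector with the differences of a function of the strings at the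
crossings. -/
def weight (w : Word n N) (φ : Fin (n + 1) → ℤ) (M : Fin N → ℤ) : ℤ :=
  ∑ v, M v * (φ (upperRight w v) - φ (upperLeft w v))

theorem weight_add (φ : Fin (n + 1) → ℤ) (M M' : Fin N → ℤ) :
    weight w φ (M + M') = weight w φ M + weight w φ M' := by
  simp [weight, add_mul, Finset.sum_add_distrib]

theorem sum_switch (φ : Fin (n + 1) → ℤ) (hp : p.IsChain (Follows w k)) (hne : p ≠ []) :
    (p.map fun q => φ q.outS - φ q.inS).sum =
      φ (p.getLast hne).outS - φ (p.head hne).inS := by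
  induction p with
  | nil => exact absurd rfl hne
  | cons a l ih =>
    cases l with
    | nil => simp
    | cons b l =>
      rw [List.isChain_cons_cons] at hp
      rw [List.map_cons, List.sum_cons, ih hp.2 (by simp)]
      have := hp.1.1
      simp only [List.head_cons, this, List.getLast_cons_cons]
      ring

theorem switch_mul (hw : IsReducedLongest w) (φ : Fin (n + 1) → ℤ) {q : Passage n N}
    (h : Meets w q.vertex q.inS ∧ Meets w q.vertex q.outS) :
    switchSign q * (φ (upperRight w q.vertex) - φ (upperLeft w q.vertex)) =
      φ q.outS - φ q.inS := by
  have hlt := upperLeft_lt_upperRight hw q.vertex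
  obtain ⟨h1, h2⟩ := h
  unfold switchSign
  rcases h1 with h1 | h1 <;> rcases h2 with h2 | h2 <;> simp [h1, h2, hlt, hlt.not_gt]

/-- By `switch_mul` each passage contributes the change of `φ` from the string of arrival to that of
departure, and these changes telescope along the path. The weight therefore depends on the end
strings only, with the sign of the form `≤ 0`. -/
theorem weight_stringCoeff (hw : IsReducedLongest w) (φ : Fin (n + 1) → ℤ)
    (hp : IsRigorousPath w k p) : weight w φ (fun v => -stringCoeff p v) =
      φ k.castSucc - φ k.succ := by
  have hne : p ≠ [] := by
    rintro rfl
    obtain ⟨q, hq, -⟩ := hp.start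
    simp at hq
  have h1 : ∀ l : List (Passage n N), (∀ q ∈ l, Meets w q.vertex q.inS ∧ Meets w q.vertex q.outS) →
      weight w φ (fun v => -stringCoeff l v) = -(l.map fun q => φ q.outS - φ q.inS).sum := by
    intro l hl
    induction l with
    | nil => simp [weight, stringCoeff]
    | cons a l ih =>
      have e : (fun v => -stringCoeff (a :: l) v) =
          (fun v => -(if a.vertex = v then switchSign a else 0)) + fun v => -stringCoeff l v := by
        funext v
        simp [stringCoeff]
        ring
      rw [e, weight_add, ih fun q hq => hl q (List.mem_cons_of_mem _ hq), List.map_cons,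
        List.sum_cons, ← switch_mul hw φ (hl a List.mem_cons_self)]
      simp [weight]
      ring
  rw [h1 p hp.meets, sum_switch φ hp.chain hne]
  obtain ⟨q, hq, h2, -⟩ := hp.start
  obtain ⟨r, hr, h3, -⟩ := hp.finish
  rw [List.head?_eq_some_head hne, Option.mem_some_iff] at hq
  rw [List.getLast?_eq_some_getLast hne, Option.mem_some_iff] at hr
  rw [hq, hr, h2, h3]
  ring

theorem arrangement_succ_castSucc (v : Fin N) (c : Fin n) :
    arrangement w (v + 1) c.castSucc = if w v = c then upperRight w v else
      if (w v : ℕ) + 1 = c then upperLeft w v else arrangement w v c.castSucc := by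
  rw [← pos_inj w (v + 1), pos_arrangement]
  split_ifs with h1 h2
  · rw [pos_succ_upperRight, h1]; rfl
  · rw [pos_succ_upperLeft, h2]; rfl
  · rw [pos_succ_of_not_meets, pos_arrangement]
    rw [meets_iff_pos, pos_arrangement]
    rw [Fin.ext_iff] at h1
    simp
    omega

theorem arrangement_succ_succ (v : Fin N) (c : Fin n) :
    arrangement w (v + 1) c.succ = if w v = c then upperLeft w v else
      if (c : ℕ) + 1 = w v then upperRight w v else arrangement w v c.succ := by
  rw [← pos_inj w (v + 1), pos_arrangement]
  split_ifs with h1 h2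
  · rw [pos_succ_upperLeft, h1]; simp
  · rw [pos_succ_upperRight, ← h2]; simp
  · rw [pos_succ_of_not_meets, pos_arrangement]
    rw [meets_iff_pos, pos_arrangement]
    rw [Fin.ext_iff] at h1
    simp
    omega

/-- A crossing outside column `c` replaces at most one of the strings in positions `c` and `c + 1`,
and does so only in a neighbouring column. This is where the coefficients of the λ-inequalities come
from. -/
theorem weight_step (φ : Fin (n + 1) → ℤ) {c : Fin n} (v : Fin N) (hv : w v ≠ c) :
    (φ (arrangement w (v + 1) c.castSucc) - φ (arrangement w (v + 1) c.succ)) -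
      (φ (arrangement w v c.castSucc) - φ (arrangement w v c.succ)) =
    (if (w v : ℕ) + 1 = c ∨ (c : ℕ) + 1 = w v then -1 else 0) *
      (φ (upperRight w v) - φ (upperLeft w v)) := by
  rw [arrangement_succ_castSucc, arrangement_succ_succ, if_neg hv, if_neg hv]
  by_cases h1 : (w v : ℕ) + 1 = c
  · have e : arrangement w v c.castSucc = upperRight w v := by
      unfold upperRight
      congr 1
      exact Fin.ext (by simp [h1])
    rw [if_pos h1, if_neg (by omega), if_pos (Or.inl h1), e]
    ring
  · by_cases h2 : (c : ℕ) + 1 = w v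
    · have e : arrangement w v c.succ = upperLeft w v := by
        unfold upperLeft
        congr 1
        exact Fin.ext (by simp [h2])
      rw [if_neg h1, if_pos h2, if_pos (Or.inr h2), e]
      ring
    · rw [if_neg h1, if_neg h2, if_neg (by omega)]
      ring

/-- The difference of the `λ`-vectors of the two crossings of a box. -/
theorem IsBox.lambda_sub {top bot : Fin N} (hbox : IsBox w top bot) (v : Fin N) :
    lambdaVector w top v - lambdaVector w bot v = if v = top ∨ v = bot then 1 else
      if top < v ∧ v < bot then
        (if (w v : ℕ) + 1 = w top ∨ (w top : ℕ) + 1 = w v then -1 else 0) else 0 := by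
  obtain ⟨h1, h2, h3⟩ := hbox
  unfold lambdaVector
  rcases lt_trichotomy v top with h | rfl | h
  · have := h.trans h1
    simp [h.ne, this.ne, h.not_gt, this.not_gt]
  · simp [h1.ne, h1.not_gt]
  · rcases lt_trichotomy v bot with h' | rfl | h'
    · have h4 := h3 v h h'
      simp [h.ne', h'.ne, h, h', h'.not_gt, h4]
    · simp [h1.ne', h1, h2]
    · simp [h.ne', h'.ne', h, h', h'.not_gt, h2]

/-- The λ-vectors differ by 1 at the top and bottom and by -1 at the neighbouring crossings between
them (`lambda_sub`). The weight of this difference telescopes: the partial sum down to a level is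
the difference of `φ` across column `w top` at that level, and the bottom crossing cancels it. -/
theorem IsBox.weight_lambda {top bot : Fin N} (hbox : IsBox w top bot) (φ : Fin (n + 1) → ℤ) :
    weight w φ (lambdaVector w top) = weight w φ (lambdaVector w bot) := by
  rw [← sub_eq_zero]
  unfold weight
  rw [← Finset.sum_sub_distrib]
  simp only [← sub_mul, hbox.lambda_sub]
  set c := w top with hc
  have key : ∀ m : ℕ, (top : ℕ) + 1 ≤ m → m ≤ bot →
      ∑ v : Fin N, (if v = top then 1 else if top < v ∧ (v : ℕ) < m then
        (if (w v : ℕ) + 1 = c ∨ (c : ℕ) + 1 = w v then -1 else 0) else 0) *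
          (φ (upperRight w v) - φ (upperLeft w v)) =
      φ (arrangement w m c.castSucc) - φ (arrangement w m c.succ) := by
    intro m hm
    induction m, hm using Nat.le_induction with
    | base =>
      intro _
      rw [Finset.sum_eq_single top]
      · rw [arrangement_succ_castSucc, arrangement_succ_succ]
        simp [hc]
      · intro v _ hv
        rw [if_neg hv, if_neg (by rw [Fin.lt_def]; omega), zero_mul]
      · simp
    | succ m hm ih =>
      intro hb
      let x : Fin N := ⟨m, by omega⟩
      have hx : w x ≠ c := hbox.2.2 x (Fin.lt_def.2 hm) (Fin.lt_def.2 hb)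
      have h1 := weight_step φ x hx
      have h2 := ih (by omega)
      have h3 : ∀ v : Fin N, (if v = top then (1 : ℤ) else if top < v ∧ (v : ℕ) < m + 1 then
        (if (w v : ℕ) + 1 = c ∨ (c : ℕ) + 1 = w v then -1 else 0) else 0) =
        (if v = top then 1 else if top < v ∧ (v : ℕ) < m then
        (if (w v : ℕ) + 1 = c ∨ (c : ℕ) + 1 = w v then -1 else 0) else 0) +
        if v = x then
          (if (w x : ℕ) + 1 = c ∨ (c : ℕ) + 1 = w x then -1 else 0) else 0 := by
        intro v
        have hx' : (x : ℕ) = m := rfl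
        by_cases hv : v = x
        · subst hv
          have h4 : x ≠ top := fun h => by rw [← h] at hm; omega
          have h5 : top < x := Fin.lt_def.2 hm
          simp [h4, h5, hx']
        · have : (v : ℕ) ≠ m := fun h => hv (Fin.ext h)
          have h6 : (v : ℕ) < m + 1 ↔ (v : ℕ) < m := by omega
          simp [hv, h6]
      simp only [h3, add_mul, Finset.sum_add_distrib, h2]
      rw [← eq_sub_iff_add_eq']
      rw [Finset.sum_eq_single x (by intro v _ hv; simp [hv]) (by simp), if_pos rfl]
      exact h1.symm
  have h1 := key bot (Fin.lt_def.1 hbox.1) le_rfl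
  have h2 : ∀ v : Fin N, (if v = top ∨ v = bot then (1 : ℤ) else if top < v ∧ v < bot then
        (if (w v : ℕ) + 1 = c ∨ (c : ℕ) + 1 = w v then -1 else 0) else 0) =
        (if v = top then 1 else if top < v ∧ (v : ℕ) < bot then
        (if (w v : ℕ) + 1 = c ∨ (c : ℕ) + 1 = w v then -1 else 0) else 0) +
        if v = bot then 1 else 0 := by
    intro v
    by_cases hv : v = bot
    · subst hv
      simp [hbox.1.ne']
    · simp only [hv, or_false, Fin.val_fin_lt, if_false, add_zero]
  simp only [h2, add_mul, Finset.sum_add_distrib, h1]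
  rw [Finset.sum_eq_single bot (by intro v _ hv; simp [hv]) (by simp), if_pos rfl]
  unfold upperLeft upperRight
  rw [hc, hbox.2.1]
  ring

/-- The relation equates the weights of the two string vectors. With `φ s = s ^ 2` these are -(2k +
1) and -(2k' + 1); the simpler `φ s = s` would always give -1 and not detect `k`. -/
theorem bend_eq_of_box (hw : IsReducedLongest w) {top bot : Fin N} (hbox : IsBox w top bot)
    {k' : Fin n} {p' : List (Passage n N)} (hp : IsRigorousPath w k p)
    (hp' : IsRigorousPath w k' p')
    (h : (fun v => -stringCoeff p v) + lambdaVector w top =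
      (fun v => -stringCoeff p' v) + lambdaVector w bot) : k = k' := by
  have h1 := congrArg (weight w fun s => (s : ℤ) ^ 2) h
  rw [weight_add, weight_add, hbox.weight_lambda, weight_stringCoeff hw _ hp,
    weight_stringCoeff hw _ hp'] at h1
  simp only [Fin.val_castSucc, Fin.val_succ, Nat.cast_add, Nat.cast_one] at h1
  apply Fin.ext
  have : (2 : ℤ) * k = 2 * k' := by linarith
  omega

/-! ### Triangles beside a box. -/

namespace Triangle

variable {vx : Fin 3 → Fin N} {st : Fin 3 → Fin (n + 1)} {ty : Bool}

theorem column_eq (T : Triangle w vx st ty) :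
    (ty = true ∧ (w (vx 1) : ℕ) = w (vx 0) + 1 ∨ ty = false ∧ (w (vx 1) : ℕ) + 1 = w (vx 0)) ∧
      w (vx 2) = w (vx 0) := by
  have h01 : ((vx 1 : Fin N) : ℕ) = vx 0 + 1 := T.vx_eq 1
  have h12 : ((vx 2 : Fin N) : ℕ) = vx 1 + 1 := by rw [h01]; exact T.vx_eq 2
  have l0 := T.upperLeft_eq 0
  have l1 := T.upperLeft_eq 1
  have l2 := T.upperLeft_eq 2
  have r0 := T.upperRight_eq 0
  have r1 := T.upperRight_eq 1
  have r2 := T.upperRight_eq 2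
  have a1 := pos_upperLeft w (vx 1)
  have a2 := pos_upperLeft w (vx 2)
  have b1 := pos_upperRight w (vx 1)
  have b2 := pos_upperRight w (vx 2)
  have c0 := pos_succ_upperLeft w (vx 0)
  have c1 := pos_succ_upperLeft w (vx 1)
  have d0 := pos_succ_upperRight w (vx 0)
  have d1 := pos_succ_upperRight w (vx 1)
  rw [← h01] at c0 d0
  rw [← h12] at c1 d1
  rw [Fin.ext_iff]
  cases ty <;> simp only [triLeft, triRight] at * <;> simp_all

/-- If a triangle lies inside a box and touches it from one side, then string inequalities related
by the box equation do not end with the two crossings of the triangle next to the box. -/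
theorem not_box_pair (hw : IsReducedLongest w) (T : Triangle w vx st ty) {top bot : Fin N}
    (hbox : IsBox w top bot) (htop : top < vx 0) (hbot : vx 2 < bot)
    (hadj : (w (vx 0) : ℕ) = w top + 1 ∨ (w (vx 0) : ℕ) + 1 = w top) (hne : w (vx 1) ≠ w top)
    {P Q : Fin N → ℤ} (hP : P ∈ stringVectors w) (hQ : Q ∈ stringVectors w)
    (hPQ : P + lambdaVector w top = Q + lambdaVector w bot) (hPt : P top = -1) (hQb : Q bot = 1)
    (hP2 : P (vx 2) ≠ 0) (hQ0 : Q (vx 0) ≠ 0) : False := by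
  obtain ⟨k, p, hp, rfl⟩ := hP
  obtain ⟨k', q, hq, rfl⟩ := hQ
  -- Both paths now refer to the same orientation, so one case distinction on `st 1` serves for `P`
  -- and `Q`.
  obtain rfl := bend_eq_of_box hw hbox hp hq hPQ
  simp only [neg_inj, ne_eq, neg_eq_zero] at hPt hQb hP2 hQ0
  obtain ⟨x, hx, hxv, hxs⟩ := exists_passage hp.nodup (v := top) (by omega)
  obtain ⟨y, hy, hyv, -⟩ := exists_passage hp.nodup hP2
  obtain ⟨z, hz, hzv, hzs⟩ := exists_passage hq.nodup (v := bot) (by omega)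
  obtain ⟨t, ht, htv, -⟩ := exists_passage hq.nodup hQ0
  have e1 := inS_outS_of_switchSign_eq_one hw (hp.meets x hx).1 (hp.meets x hx).2 (by omega)
  have e2 := inS_outS_of_switchSign_eq_neg_one hw (hq.meets z hz).1 (hq.meets z hz).2 (by omega)
  rw [hxv] at e1
  rw [hzv] at e2
  have h02 : vx 0 < vx 2 := T.vx_lt.2 (by decide)
  have g1 := transGen_or_transGen hp.chain hx hy fun h => by
    rw [h, hyv] at hxv
    exact (htop.trans h02).ne hxv.symm
  have g2 := transGen_or_transGen hq.chain hz ht fun h => by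
    rw [h, htv] at hzv
    exact (h02.trans hbot).ne hzv
  have hy1 : top < y.vertex := by rw [hyv]; exact htop.trans h02
  have hy2 : y.vertex < bot := by rw [hyv]; exact hbot
  have ht1 : top < t.vertex := by rw [htv]; exact htop
  have ht2 : t.vertex < bot := by rw [htv]; exact h02.trans hbot
  obtain ⟨hc, hc2⟩ := T.column_eq
  have l0 := T.upperLeft_eq 0
  have l2 := T.upperLeft_eq 2
  have r0 := T.upperRight_eq 0
  have r2 := T.upperRight_eq 2
  have s01 : st 0 ≤ st 1 := T.st_mono.monotone (by decide)
  have s12 : st 1 ≤ st 2 := T.st_mono.monotone (by decide)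
  rw [Ne, Fin.ext_iff] at hne
  -- The middle string passes through both `vx 0` and `vx 2`, crossing a smaller string at one of
  -- them and a larger one at the other. If it goes up, its crossing with the smaller string has two
  -- upward strings; if it goes down, its crossing with the larger one has two downward strings. In
  -- each case that crossing is forbidden for the path that passes through it.
  rcases hc with ⟨rfl, hc⟩ | ⟨rfl, hc⟩ <;> simp [triLeft, triRight] at l0 l2 r0 r2
  · have had : (w (vx 0) : ℕ) = w top + 1 := by omega
    by_cases hup : IsUp k (st 1)
    · refine hbox.not_bot_right_up hw hzv e2.1 e2.2 ht1 ht2 (by rw [htv, had]) (k := k) ?_ g2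
      rw [htv]
      rintro s (h | h)
      · rw [h, l0]; exact hup.of_le s01
      · rw [h, r0]; exact hup
    · refine hbox.not_top_right_down hw hxv e1.1 e1.2 hy1 hy2 (by rw [hyv, hc2, had]) (k := k) ?_ g1
      rw [hyv]
      rintro s (h | h) hs
      · rw [h, l2] at hs; exact hup hs
      · rw [h, r2] at hs; exact hup (hs.of_le s12)
  · have had : (w (vx 0) : ℕ) + 1 = w top := by omega
    by_cases hup : IsUp k (st 1)
    · refine hbox.not_top_left_up hw hxv e1.1 e1.2 hy1 hy2 (by rw [hyv, hc2, had]) (k := k) ?_ g1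
      rw [hyv]
      rintro s (h | h)
      · rw [h, l2]; exact hup.of_le s01
      · rw [h, r2]; exact hup
    · refine hbox.not_bot_left_down hw hzv e2.1 e2.2 ht1 ht2 (by rw [htv, had]) (k := k) ?_ g2
      rw [htv]
      rintro s (h | h) hs
      · rw [h, l0] at hs; exact hup hs
      · rw [h, r0] at hs; exact hup (hs.of_le s12)

/-- The exponents of a defining inequality are not proportional to those of `t_i t_k / t_j`. -/
theorem stringVector_ne_proportional (hw : IsReducedLongest w) (T : Triangle w vx st ty)
    {M : Fin N → ℤ} (hM : M ∈ stringVectors w) (hout : ∀ v ∉ Set.range vx, M v = 0)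
    (h1 : M (vx 1) = -M (vx 0)) (h2 : M (vx 2) = M (vx 0)) : False := by
  obtain ⟨k, p, hp, rfl⟩ := hM
  -- For `φ s = s` a string inequality has weight -1, but exponents proportional to (1, -1, 1) on
  -- the triangle have weight 0.
  have h := weight_stringCoeff hw (fun s => (s : ℤ)) hp
  unfold weight at h
  rw [← Finset.sum_subset (Finset.subset_univ (Finset.univ.image vx)),
    Finset.sum_image T.vx_injective.injOn, Fin.sum_univ_three, h1, h2] at h
  · simp only [T.upperLeft_eq, T.upperRight_eq] at h
    cases ty <;> simp [triLeft, triRight] at h <;> ring_nf at h <;> omega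
  · intro v _ hv
    rw [hout v (by simpa using hv), zero_mul]

end Triangle

end Passages

/-! ### Monomials under the rational map -/

section Pullback

variable {N : ℕ} {C : ℂˣ} {i j k : Fin N}

/-- The monomial `T^M` as a unit of the localized ring. -/
def monLoc (C : ℂˣ) (i j k : Fin N) (M : Fin N → ℤ) : (LocalizedLaurent C i j k)ˣ :=
  ∏ v, coordLoc C i j k v ^ M v

theorem monLoc_add (M M' : Fin N → ℤ) :
    monLoc C i j k (M + M') = monLoc C i j k M * monLoc C i j k M' := by
  simp [monLoc, zpow_add, Finset.prod_mul_distrib]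

theorem monomial_eq_prod (M : Fin N → ℤ) : monomial M = ((∏ v, coord v ^ M v : (Laurent N)ˣ) : Laurent N) := by
  let φ : Multiplicative (Fin N → ℤ) →* (Laurent N)ˣ :=
    MonoidHom.toHomUnits (AddMonoidAlgebra.of ℂ (Fin N → ℤ))
  have h : ∀ v, φ (Multiplicative.ofAdd (Pi.single v 1)) = coord v := fun v => Units.ext rfl
  have h2 : M = ∑ v, M v • Pi.single v (1 : ℤ) := by
    funext u
    simp [Finset.sum_apply, Pi.single_apply]
  have h3 : φ (Multiplicative.ofAdd M) = ∏ v, coord v ^ M v := by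
    conv_lhs => rw [h2, ofAdd_sum, map_prod]
    refine Finset.prod_congr rfl fun v _ => ?_
    rw [ofAdd_zsmul, map_zpow, h]
  rw [← h3]
  rfl

theorem algebraMap_monomial (M : Fin N → ℤ) :
    algebraMap (Laurent N) (LocalizedLaurent C i j k) (monomial M) = monLoc C i j k M := by
  rw [monomial_eq_prod]
  change ((Units.map (algebraMap (Laurent N) (LocalizedLaurent C i j k)).toMonoidHom
    (∏ v, coord v ^ M v) : (LocalizedLaurent C i j k)ˣ) : LocalizedLaurent C i j k) = _
  rw [map_prod]
  simp only [map_zpow]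
  rfl

theorem algebraMap_const_smul (c : ℂ) (x : Laurent N) :
    algebraMap (Laurent N) (LocalizedLaurent C i j k) (c • x) =
      c • algebraMap (Laurent N) (LocalizedLaurent C i j k) x :=
  map_smul (IsScalarTower.toAlgHom ℂ (Laurent N) (LocalizedLaurent C i j k)) c x

theorem coe_denomLoc : (denomLoc C i j k : LocalizedLaurent C i j k) =
    monLoc C i j k (Pi.single i 1 + Pi.single k 1) +
      (C : ℂ) • (monLoc C i j k (Pi.single j 1) : LocalizedLaurent C i j k) := by
  rw [← algebraMap_monomial, ← algebraMap_monomial]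
  change algebraMap (Laurent N) _ (coord i * coord k + (C : ℂ) • (coord j : Laurent N)) = _
  rw [map_add, algebraMap_const_smul]
  congr 2
  simp [coord, monomial, AddMonoidAlgebra.single_mul_single]

theorem prod_three {G : Type*} [CommGroup G] (hij : i ≠ j) (hik : i ≠ k) (hjk : j ≠ k)
    (f : Fin N → G) : ∏ v, f v = f i * f j * f k * ∏ v ∈ Finset.univ \ {i, j, k}, f v := by
  rw [← Finset.prod_sdiff (Finset.subset_univ {i, j, k}), mul_comm, Finset.prod_insert (by simp [*]),
    Finset.prod_insert (by simp [*]), Finset.prod_singleton, mul_assoc (f i) (f j)]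

theorem replaceAt_left (M : Fin N → ℤ) (t : ℤ × ℤ × ℤ) : replaceAt ![i, j, k] M t i = t.1 := by
  simp [replaceAt]

theorem replaceAt_middle (hij : i ≠ j) (M : Fin N → ℤ) (t : ℤ × ℤ × ℤ) :
    replaceAt ![i, j, k] M t j = t.2.1 := by
  simp [replaceAt, hij.symm]

theorem replaceAt_right (hik : i ≠ k) (hjk : j ≠ k) (M : Fin N → ℤ) (t : ℤ × ℤ × ℤ) :
    replaceAt ![i, j, k] M t k = t.2.2 := by
  simp [replaceAt, hik.symm, hjk.symm]

theorem replaceAt_of_ne {v : Fin N} (hi : v ≠ i) (hj : v ≠ j) (hk : v ≠ k) (M : Fin N → ℤ)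
    (t : ℤ × ℤ × ℤ) : replaceAt ![i, j, k] M t v = M v := by
  simp [replaceAt, hi, hj, hk]

theorem eq_replaceAt {M M' : Fin N → ℤ} {t : ℤ × ℤ × ℤ} (hi : M i = t.1) (hj : M j = t.2.1)
    (hk : M k = t.2.2) (h : ∀ v, v ≠ i → v ≠ j → v ≠ k → M v = M' v) :
    M = replaceAt ![i, j, k] M' t := by
  funext v
  by_cases h1 : v = i
  · subst h1; rw [replaceAt_left, hi]
  by_cases h2 : v = j
  · subst h2; rw [replaceAt_middle (Ne.symm h1), hj]
  by_cases h3 : v = k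
  · subst h3; rw [replaceAt_right (Ne.symm h1) (Ne.symm h2), hk]
  rw [replaceAt_of_ne h1 h2 h3, h v h1 h2 h3]

theorem hPullback_monomial_eq_prod (M : Fin N → ℤ) : hPullback C i j k (monomial M) =
    ((∏ v, hComponent C i j k v ^ M v : (LocalizedLaurent C i j k)ˣ) :
      LocalizedLaurent C i j k) := by
  unfold hPullback monomial
  rw [AddMonoidAlgebra.lift_single, one_smul]
  rfl

/-- The exponent `M i - M k` of the denominator governs what follows: the values 0, 1 and -1 lead to
`hPullback_swap`, `hPullback_split` and `hPullback_merge`. -/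
theorem prod_hComponent (hij : i ≠ j) (hik : i ≠ k) (hjk : j ≠ k) (M : Fin N → ℤ) :
    ∏ v, hComponent C i j k v ^ M v = constLoc C i j k ^ (M k - M j) *
      denomLoc C i j k ^ (M i - M k) *
        monLoc C i j k (replaceAt ![i, j, k] M (M j + M k - M i, M k, M j)) := by
  unfold monLoc
  rw [prod_three hij hik hjk, prod_three hij hik hjk (fun v => _ ^ replaceAt _ _ _ v),
    replaceAt_left, replaceAt_middle hij, replaceAt_right hik hjk, ← mul_assoc]
  congr 1
  · simp only [hComponent, if_true, if_neg hij.symm, if_neg hik.symm, if_neg hjk.symm]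
    -- In additive notation the identity between monomials in units is a linear identity between
    -- exponents.
    apply Additive.ofMul.injective
    simp only [ofMul_mul, ofMul_zpow, ofMul_div]
    module
  · refine Finset.prod_congr rfl fun v hv => ?_
    simp only [Finset.mem_sdiff, Finset.mem_insert, Finset.mem_singleton, not_or] at hv
    obtain ⟨-, h1, h2, h3⟩ := hv
    rw [replaceAt_of_ne h1 h2 h3, hComponent, if_neg h1, if_neg h2, if_neg h3]

theorem constLoc_zpow_mul (e : ℤ) (x : LocalizedLaurent C i j k) :
    ((constLoc C i j k ^ e : (LocalizedLaurent C i j k)ˣ) : LocalizedLaurent C i j k) * x =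
      ((C ^ e : ℂˣ) : ℂ) • x := by
  rw [Algebra.smul_def, constLoc, ← map_zpow]
  rfl

/-- A monomial with equal exponents at `i` and `k` is pulled back to a monomial. -/
theorem hPullback_swap (hij : i ≠ j) (hik : i ≠ k) (hjk : j ≠ k) {M : Fin N → ℤ}
    (h : M i = M k) : hPullback C i j k (monomial M) =
      ((C ^ (M k - M j) : ℂˣ) : ℂ) •
        algebraMap (Laurent N) (LocalizedLaurent C i j k)
          (monomial (replaceAt ![i, j, k] M (M j, M k, M j))) := by
  rw [hPullback_monomial_eq_prod, prod_hComponent hij hik hjk, h, sub_self, zpow_zero, mul_one,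
    Units.val_mul, constLoc_zpow_mul, algebraMap_monomial, add_sub_cancel_right]

/-- A monomial whose exponent at `i` exceeds that at `k` by one is pulled back to a binomial. -/
theorem hPullback_split (hij : i ≠ j) (hik : i ≠ k) (hjk : j ≠ k) {M : Fin N → ℤ}
    (h : M i = M k + 1) : hPullback C i j k (monomial M) =
      ((C ^ (M k - M j) : ℂˣ) : ℂ) •
        algebraMap (Laurent N) (LocalizedLaurent C i j k)
          (monomial (replaceAt ![i, j, k] M (M j, M k, M j + 1))) +
      ((C ^ (M k - M j + 1) : ℂˣ) : ℂ) •
        algebraMap (Laurent N) (LocalizedLaurent C i j k)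
          (monomial (replaceAt ![i, j, k] M (M j - 1, M k + 1, M j))) := by
  have e1 : replaceAt ![i, j, k] M (M j, M k, M j + 1) = (Pi.single i 1 + Pi.single k 1) +
      replaceAt ![i, j, k] M (M j + M k - M i, M k, M j) := by
    symm
    apply eq_replaceAt
    · simp [replaceAt_left, hik, h]; ring
    · simp [replaceAt_middle hij, hij.symm, hjk]
    · simp [replaceAt_right hik hjk, hik.symm, add_comm]
    · intro v h1 h2 h3
      simp [replaceAt_of_ne h1 h2 h3, h1, h3]
  have e2 : replaceAt ![i, j, k] M (M j - 1, M k + 1, M j) = Pi.single j 1 +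
      replaceAt ![i, j, k] M (M j + M k - M i, M k, M j) := by
    symm
    apply eq_replaceAt
    · simp [replaceAt_left, hij, h]; ring
    · simp [replaceAt_middle hij, add_comm]
    · simp [replaceAt_right hik hjk, hjk.symm]
    · intro v h1 h2 h3
      simp [replaceAt_of_ne h1 h2 h3, h2]
  rw [hPullback_monomial_eq_prod, prod_hComponent hij hik hjk, algebraMap_monomial,
    algebraMap_monomial, e1, e2, monLoc_add _ (replaceAt _ _ _), monLoc_add _ (replaceAt _ _ _), h,
    add_sub_cancel_left, zpow_one, mul_assoc, Units.val_mul, constLoc_zpow_mul, Units.val_mul,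
    coe_denomLoc, add_mul, smul_add, smul_mul_assoc, smul_smul, zpow_add_one, Units.val_mul,
    Units.val_mul, Units.val_mul]

/-- Two monomials whose combination is pulled back to a monomial. -/
theorem hPullback_merge (hij : i ≠ j) (hik : i ≠ k) (hjk : j ≠ k) {M : Fin N → ℤ}
    (h : M i = M k + 1) :
    hPullback C i j k (monomial (replaceAt ![i, j, k] M (M j, M k, M j + 1))) +
      (C : ℂ) • hPullback C i j k (monomial (replaceAt ![i, j, k] M (M j - 1, M k + 1, M j))) =
      ((C ^ (M j - M k) : ℂˣ) : ℂ) •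
        algebraMap (Laurent N) (LocalizedLaurent C i j k) (monomial M) := by
  have e1 : replaceAt ![i, j, k] (replaceAt ![i, j, k] M (M j, M k, M j + 1))
      (M k + (M j + 1) - M j, M j + 1, M k) = Pi.single j 1 + M := by
    symm
    apply eq_replaceAt
    · simp [hij, h]; ring
    · simp [add_comm]
    · simp [hjk.symm]
    · intro v h1 h2 h3
      simp [replaceAt_of_ne h1 h2 h3, h2]
  have e2 : replaceAt ![i, j, k] (replaceAt ![i, j, k] M (M j - 1, M k + 1, M j))
      (M k + 1 + M j - (M j - 1), M j, M k + 1) = (Pi.single i 1 + Pi.single k 1) + M := by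
    symm
    apply eq_replaceAt
    · simp [hik, h]; ring
    · simp [hij.symm, hjk]
    · simp [hik.symm, add_comm]
    · intro v h1 h2 h3
      simp [replaceAt_of_ne h1 h2 h3, h1, h3]
  rw [hPullback_monomial_eq_prod, hPullback_monomial_eq_prod, prod_hComponent hij hik hjk,
    prod_hComponent hij hik hjk, algebraMap_monomial]
  simp only [replaceAt_left, replaceAt_middle hij, replaceAt_right hik hjk]
  rw [e1, e2, monLoc_add _ M, monLoc_add _ M, sub_add_cancel_left, sub_sub_cancel_left]
  have e3 : M j + 1 - M k = (M j - M k) + 1 := by ring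
  have e4 : M j - (M k + 1) + 1 = M j - M k := by ring
  have e5 : ((C : ℂ) • ((constLoc C i j k ^ (M j - (M k + 1)) * denomLoc C i j k ^ (-1 : ℤ) *
      (monLoc C i j k (Pi.single i 1 + Pi.single k 1) * monLoc C i j k M) :
        (LocalizedLaurent C i j k)ˣ) : LocalizedLaurent C i j k)) =
      ((C ^ (M j - M k) : ℂˣ) : ℂ) • ((denomLoc C i j k ^ (-1 : ℤ) *
        (monLoc C i j k (Pi.single i 1 + Pi.single k 1) * monLoc C i j k M) :
        (LocalizedLaurent C i j k)ˣ) : LocalizedLaurent C i j k) := by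
    rw [mul_assoc, Units.val_mul, constLoc_zpow_mul, smul_smul, ← e4, zpow_add_one, mul_comm (C : ℂ),
      Units.val_mul, Units.val_mul, Units.val_mul]
  rw [e5, e3, mul_assoc, Units.val_mul, constLoc_zpow_mul, zpow_add_one, Units.val_mul, mul_smul,
    ← smul_add]
  congr 1
  -- Both terms carry a factor 1/D, and their numerators `C t_j` and `t_i t_k` add up to D.
  have e6 := congrArg (fun x => x * ((denomLoc C i j k ^ (-1 : ℤ) * monLoc C i j k M :
    (LocalizedLaurent C i j k)ˣ) : LocalizedLaurent C i j k)) (coe_denomLoc (C := C) (i := i)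
      (j := j) (k := k))
  simp only [← Units.val_mul, add_mul, smul_mul_assoc] at e6
  rw [zpow_neg_one, mul_inv_cancel_left] at e6
  rw [e6, zpow_neg_one, add_comm, mul_left_comm, mul_left_comm _ (monLoc _ _ _ _ _)]

end Pullback

/-! ### The transformed coefficients -/

section Coefficients

variable {n N : ℕ} {w w' : Word n N} {i j k : Fin N}

theorem moveTable_mem_cases {x y z : ℤ} (h : moveTable x y z ≠ []) :
    (x, y, z) ∈ [((0 : ℤ), (0 : ℤ), (0 : ℤ)), (0, 1, 0), (0, -1, 0), (1, 0, 1), (-1, 0, -1),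
      (1, -1, 1), (-1, 1, -1), (1, 0, 0), (0, 0, -1), (-1, 0, 0), (0, -1, 1), (-1, 1, 0),
      (0, 0, 1)] := by
  by_contra hno
  simp only [List.mem_cons, List.not_mem_nil, or_false, not_or] at hno
  apply h
  unfold moveTable
  simp [hno]

theorem moveTable_swap {x y z : ℤ} (h : moveTable x y z ≠ []) (hxz : x = z) :
    (y, z, y) ∈ moveTable x y z := by
  have := moveTable_mem_cases h
  simp only [List.mem_cons, Prod.mk.injEq, List.not_mem_nil, or_false] at this
  rcases this with ⟨rfl, rfl, rfl⟩ | ⟨rfl, rfl, rfl⟩ | ⟨rfl, rfl, rfl⟩ | ⟨rfl, rfl, rfl⟩ |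
    ⟨rfl, rfl, rfl⟩ | ⟨rfl, rfl, rfl⟩ | ⟨rfl, rfl, rfl⟩ | ⟨rfl, rfl, rfl⟩ | ⟨rfl, rfl, rfl⟩ |
    ⟨rfl, rfl, rfl⟩ | ⟨rfl, rfl, rfl⟩ | ⟨rfl, rfl, rfl⟩ | ⟨rfl, rfl, rfl⟩ <;> revert hxz <;> decide

theorem moveTable_split {x y z : ℤ} (h : moveTable x y z ≠ []) (hxz : x = z + 1) :
    y = 0 ∧ moveTable x y z = [(0, z, 1), (-1, z + 1, 0)] := by
  have := moveTable_mem_cases h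
  simp only [List.mem_cons, Prod.mk.injEq, List.not_mem_nil, or_false] at this
  rcases this with ⟨rfl, rfl, rfl⟩ | ⟨rfl, rfl, rfl⟩ | ⟨rfl, rfl, rfl⟩ | ⟨rfl, rfl, rfl⟩ |
    ⟨rfl, rfl, rfl⟩ | ⟨rfl, rfl, rfl⟩ | ⟨rfl, rfl, rfl⟩ | ⟨rfl, rfl, rfl⟩ | ⟨rfl, rfl, rfl⟩ |
    ⟨rfl, rfl, rfl⟩ | ⟨rfl, rfl, rfl⟩ | ⟨rfl, rfl, rfl⟩ | ⟨rfl, rfl, rfl⟩ <;> revert hxz <;> decide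

theorem moveTable_right {y : ℤ} (h : moveTable 0 y 1 ≠ []) :
    moveTable 0 y 1 = [(y + 1, 0, y)] := by
  have := moveTable_mem_cases h
  simp at this
  rcases this with rfl | rfl <;> decide

theorem moveTable_left {y : ℤ} (h : moveTable (-1) y 0 ≠ []) :
    moveTable (-1) y 0 = [(y, 0, y - 1)] := by
  have := moveTable_mem_cases h
  simp at this
  rcases this with rfl | rfl <;> decide

/-- The difference of the outer exponents is 0, 1 or -1. The last value occurs in two shapes, which
are the two partners in a merging. -/
theorem moveTable_types {x y z : ℤ} (h : moveTable x y z ≠ []) :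
    x = z ∨ x = z + 1 ∨ (x = 0 ∧ z = 1) ∨ (x = -1 ∧ z = 0) := by
  have := moveTable_mem_cases h
  simp only [List.mem_cons, Prod.mk.injEq, List.not_mem_nil, or_false] at this
  omega

namespace IsThreeMove

theorem ne_left_middle (h : IsThreeMove w w' i j k) : i ≠ j := by
  intro h'; have := h.hij; rw [h'] at this; omega

theorem ne_left_right (h : IsThreeMove w w' i j k) : i ≠ k := by
  intro h'; have := h.hij; have := h.hjk; rw [Fin.ext_iff] at h'; omega

theorem ne_middle_right (h : IsThreeMove w w' i j k) : j ≠ k := by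
  intro h'; have := h.hjk; rw [h'] at this; omega

theorem exchange (h : IsThreeMove w w' i j k) (hw : IsReducedLongest w) {M : Fin N → ℤ}
    (hM : M ∈ stringVectors w) : moveTable (M i) (M j) (M k) ≠ [] ∧
      ∀ t ∈ moveTable (M i) (M j) (M k), replaceAt ![i, j, k] M t ∈ stringVectors w' := by
  obtain ⟨st, ty, T⟩ := h.exists_triangleMove hw
  exact stringVectors_exchange hw T hM

theorem replaceAt_replaceAt (h : IsThreeMove w w' i j k) (M : Fin N → ℤ) (t u : ℤ × ℤ × ℤ) :
    replaceAt ![i, j, k] (replaceAt ![i, j, k] M t) u = replaceAt ![i, j, k] M u := by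
  apply (eq_replaceAt _ _ _ _)
  · simp [replaceAt_left]
  · simp [replaceAt_middle h.ne_left_middle]
  · simp [replaceAt_right h.ne_left_right h.ne_middle_right]
  · intro v h1 h2 h3
    simp [replaceAt_of_ne h1 h2 h3]

theorem replaceAt_eq_self {M : Fin N → ℤ} {t : ℤ × ℤ × ℤ} (hi : M i = t.1)
    (hj : M j = t.2.1) (hk : M k = t.2.2) : replaceAt ![i, j, k] M t = M :=
  (eq_replaceAt hi hj hk fun _ _ _ _ => rfl).symm

/-! The `λ`-vectors before and after the move. -/

theorem columns_ne (h : IsThreeMove w w' i j k) : w i ≠ w j := by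
  intro h'
  have := h.adjacent
  rw [h'] at this
  omega

theorem lt_left (h : IsThreeMove w w' i j k) : i < j ∧ j < k ∧ i < k := by
  have := h.hij
  have := h.hjk
  refine ⟨?_, ?_, ?_⟩ <;> rw [Fin.lt_def] <;> omega

theorem lambda_left (h : IsThreeMove w w' i j k) :
    lambdaVector w i i = 1 ∧ lambdaVector w i j = -1 ∧ lambdaVector w i k = 2 := by
  obtain ⟨h1, h2, h3⟩ := h.lt_left
  have h4 := h.columns_ne
  have h5 := h.adjacent
  have h6 := h.hki
  refine ⟨by simp [lambdaVector], ?_, by simp [lambdaVector, h3, h3.ne', h6]⟩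
  simp only [lambdaVector, if_neg h1.ne', if_pos h1, if_neg h4.symm]
  rw [if_pos (by tauto)]

theorem lambda_middle (h : IsThreeMove w w' i j k) :
    lambdaVector w j i = 0 ∧ lambdaVector w j j = 1 ∧ lambdaVector w j k = -1 := by
  obtain ⟨h1, h2, h3⟩ := h.lt_left
  have h4 := h.columns_ne
  have h5 := h.adjacent
  have h6 := h.hki
  refine ⟨by simp [lambdaVector, h1.ne, h1.not_gt], by simp [lambdaVector], ?_⟩
  simp only [lambdaVector, if_neg h2.ne', if_pos h2, h6, if_neg h4]
  rw [if_pos (by tauto)]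

theorem lambda_right (h : IsThreeMove w w' i j k) :
    lambdaVector w k i = 0 ∧ lambdaVector w k j = 0 ∧ lambdaVector w k k = 1 := by
  obtain ⟨h1, h2, h3⟩ := h.lt_left
  simp [lambdaVector, h3.ne, h3.not_gt, h2.ne, h2.not_gt]

theorem lt_iff (h : IsThreeMove w w' i j k) {v : Fin N} (hi : v ≠ i) (hj : v ≠ j) (hk : v ≠ k) :
    (v < j ↔ v < i) ∧ (v < k ↔ v < i) ∧ (i < v ↔ k < v) ∧ (j < v ↔ k < v) := by
  have := h.hij
  have := h.hjk
  rw [Ne, Fin.ext_iff] at hi hj hk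
  simp only [Fin.lt_def]
  omega

/-- A crossing `m` outside the triangle is above all of it or below all of it, so its λ-coefficient
at each of the three depends only on the column there. The move changes the columns from (c, e, c)
to (e, c, e). -/
theorem lambda_of_ne (h : IsThreeMove w w' i j k) {m : Fin N} (hi : m ≠ i) (hj : m ≠ j)
    (hk : m ≠ k) : lambdaVector w m i = lambdaVector w m k ∧
      lambdaVector w' m = replaceAt ![i, j, k] (lambdaVector w m)
        (lambdaVector w m j, lambdaVector w m k, lambdaVector w m j) := by
  obtain ⟨h1, h2, -, -⟩ := h.lt_iff hi hj hk
  constructor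
  · simp only [lambdaVector, hi.symm, hk.symm, h2, h.hki]
  · apply eq_replaceAt
    · simp only [lambdaVector, hi.symm, hj.symm, h1, h.hi', h.hq' m hi hj hk]
    · simp only [lambdaVector, hj.symm, hk.symm, h1, h2, h.hj', h.hki, h.hq' m hi hj hk]
    · simp only [lambdaVector, hj.symm, hk.symm, h1, h2, h.hk', h.hq' m hi hj hk]
    · intro v h3 h4 h5
      simp only [lambdaVector, h.hq' m hi hj hk, h.hq' v h3 h4 h5]

/-- After the move `j` is in the former column of `i` and `k`, and outside the triangle it does not
matter at which of the three crossings the λ-inequality starts. -/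
theorem lambda_middle' (h : IsThreeMove w w' i j k) {v : Fin N} (hi : v ≠ i) (hj : v ≠ j)
    (hk : v ≠ k) : lambdaVector w' j v = lambdaVector w i v ∧
      lambdaVector w' j v = lambdaVector w k v := by
  obtain ⟨-, -, h1, h2⟩ := h.lt_iff hi hj hk
  simp only [lambdaVector, hi, hj, hk, h1, h2, h.hki, h.hj', h.hq' v hi hj hk]
  trivial

end IsThreeMove

open Classical in
/-- The coefficient of a string inequality, as a function of its exponent vector. -/
def stringCoef (a : Inequality w → ℂˣ) (M : Fin N → ℤ) : ℂˣ :=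
  if h : M ∈ stringVectors w then a (Sum.inr ⟨M, h⟩) else 1

theorem stringCoef_coe (a : Inequality w → ℂˣ) (M : stringVectors w) :
    stringCoef a M.1 = a (Sum.inr M) := by
  simp [stringCoef]

/-- The coefficients of the hypersurface after the 3-move. -/
def movedCoef (w' : Word n N) (i j k : Fin N) (a : Inequality w → ℂˣ) : Inequality w' → ℂˣ :=
  Sum.elim
    -- The exponents of λ_j at i, j, k are (0, 1, -1), so splitting yields λ'_i with C^(-2) and λ'_k
    -- with C^(-1). Merging λ_i and λ_k into λ'_j, again with exponents (0, 1, -1), yields C^2.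
    (fun v => if v = i then a (Sum.inl j) * ratioC a i k ^ (-2 : ℤ)
      else if v = j then a (Sum.inl i) * ratioC a i k ^ (2 : ℤ)
      else if v = k then a (Sum.inl j) * ratioC a i k ^ (-1 : ℤ)
      else a (Sum.inl v) * ratioC a i k ^ (lambdaVector w v k - lambdaVector w v j))
    fun M =>
      -- For a 3-move from a reduced word the table is nonempty here, so the default is not used.
      -- When there are two entries, either gives the same coefficient by `stringCoef_moved`.
      let t := (moveTable (M.1 i) (M.1 j) (M.1 k)).headD (0, 0, 0)
      stringCoef a (replaceAt ![i, j, k] M.1 t) * ratioC a i k ^ (t.1 - M.1 k)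

namespace IsThreeMove

theorem isBox (h : IsThreeMove w w' i j k) : IsBox w i k := by
  refine ⟨h.lt_left.2.2, h.hki.symm, fun x h1 h2 => ?_⟩
  have : x = j := by
    apply Fin.ext
    have := h.hij
    have := h.hjk
    rw [Fin.lt_def] at h1 h2
    omega
  rw [this]
  exact h.columns_ne.symm

/-- The box equation of the box formed by the move. -/
theorem stringCoef_pair (h : IsThreeMove w w' i j k) {a : Inequality w → ℂˣ}
    (ha : a ∈ parameterSpace w) {M : Fin N → ℤ} {y : ℤ}
    (h1 : replaceAt ![i, j, k] M (-1, y + 1, 0) ∈ stringVectors w)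
    (h2 : replaceAt ![i, j, k] M (0, y, 1) ∈ stringVectors w) :
    stringCoef a (replaceAt ![i, j, k] M (-1, y + 1, 0)) =
      ratioC a i k * stringCoef a (replaceAt ![i, j, k] M (0, y, 1)) := by
  obtain ⟨e1, e2, e3⟩ := h.lambda_left
  obtain ⟨f1, f2, f3⟩ := h.lambda_right
  have hij := h.ne_left_middle
  have hik := h.ne_left_right
  have hjk := h.ne_middle_right
  -- Local exponents: (-1, y + 1, 0) + (1, -1, 2) = (0, y, 1) + (0, 0, 1), with -1 at the top `i`
  -- and 1 at the bottom `k`, as the box equation requires.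
  have key := ha i k ⟨_, h1⟩ ⟨_, h2⟩ h.isBox ?_ (by simp [replaceAt_left])
    (by simp [replaceAt_right hik hjk])
  · have e : ∀ {M'} (h : M' ∈ stringVectors w), stringCoef a M' = a (Sum.inr ⟨M', h⟩) :=
      fun h => stringCoef_coe a ⟨_, h⟩
    rw [← e, ← e] at key
    rw [ratioC, div_mul_eq_mul_div, eq_div_iff_mul_eq', key, mul_comm]
  · funext v
    simp only [Pi.add_apply]
    by_cases hi : v = i
    · subst hi; simp [replaceAt_left, e1, f1]
    by_cases hj : v = j
    · subst hj; simp [replaceAt_middle hij, e2, f2]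
    by_cases hk : v = k
    · subst hk; simp [replaceAt_right hik hjk, e3, f3]
    rw [replaceAt_of_ne hi hj hk, replaceAt_of_ne hi hj hk, ← (h.lambda_middle' hi hj hk).1,
      (h.lambda_middle' hi hj hk).2]

/-- When the table has two entries, the corresponding old inequalities are partners in the box
bounded by `i` and `k`, and `stringCoef_pair` compensates for the different powers of C. Otherwise
there is nothing to choose. -/
theorem stringCoef_moved (h : IsThreeMove w w' i j k) (hw : IsReducedLongest w)
    {a : Inequality w → ℂˣ} (ha : a ∈ parameterSpace w) {M : Fin N → ℤ}
    (hM : M ∈ stringVectors w') {t : ℤ × ℤ × ℤ} (ht : t ∈ moveTable (M i) (M j) (M k)) :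
    stringCoef (movedCoef w' i j k a) M =
      stringCoef a (replaceAt ![i, j, k] M t) * ratioC a i k ^ (t.1 - M k) := by
  obtain ⟨hne, hall⟩ := h.symm.exchange (h.isReducedLongest hw) hM
  have e : stringCoef (movedCoef w' i j k a) M =
      stringCoef a (replaceAt ![i, j, k] M ((moveTable (M i) (M j) (M k)).headD (0, 0, 0))) *
        ratioC a i k ^ (((moveTable (M i) (M j) (M k)).headD (0, 0, 0)).1 - M k) := by
    rw [stringCoef, dif_pos hM]
    rfl
  rw [e]
  have hlen : ∀ u, moveTable (M i) (M j) (M k) = [u] →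
      stringCoef a (replaceAt ![i, j, k] M ((moveTable (M i) (M j) (M k)).headD (0, 0, 0))) *
        ratioC a i k ^ (((moveTable (M i) (M j) (M k)).headD (0, 0, 0)).1 - M k) =
      stringCoef a (replaceAt ![i, j, k] M t) * ratioC a i k ^ (t.1 - M k) := by
    intro u hu
    rw [hu, List.mem_singleton] at ht
    rw [hu, ht]
    rfl
  rcases moveTable_types hne with h1 | h1 | ⟨h1, h2⟩ | ⟨h1, h2⟩
  · have := moveTable_mem_cases hne
    simp only [List.mem_cons, Prod.mk.injEq, List.not_mem_nil, or_false] at this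
    have h3 : ∃ u, moveTable (M i) (M j) (M k) = [u] := by
      rcases this with ⟨h4, h5, h6⟩ | ⟨h4, h5, h6⟩ | ⟨h4, h5, h6⟩ | ⟨h4, h5, h6⟩ |
        ⟨h4, h5, h6⟩ | ⟨h4, h5, h6⟩ | ⟨h4, h5, h6⟩ | h7 | h7 | h7 | h7 | h7 | h7
      all_goals first
        | (rw [h4, h5, h6]; exact ⟨_, rfl⟩)
        | (exfalso; omega)
    obtain ⟨u, hu⟩ := h3
    exact hlen u hu
  · obtain ⟨h2, h3⟩ := moveTable_split hne h1
    rw [h3] at ht hall ⊢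
    simp only [List.mem_cons, List.not_mem_nil, or_false] at ht
    rcases ht with rfl | rfl
    · rfl
    · rw [h.stringCoef_pair ha (hall _ (by simp)) (hall _ (by simp)), List.headD_cons,
        mul_comm (ratioC a i k), mul_assoc, ← zpow_one_add]
      congr 2
      ring
  · rw [h1, h2] at hne
    exact hlen _ (by rw [h1, h2]; exact moveTable_right hne)
  · rw [h1, h2] at hne
    exact hlen _ (by rw [h1, h2]; exact moveTable_left hne)

end IsThreeMove

end Coefficients

/-! ### The pullback of the defining equation -/

section PullbackEquation

variable {n N : ℕ} {w w' : Word n N} {i j k : Fin N}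

/-- The Laurent polynomial without its constant term, by types of inequalities. -/
theorem laurentPoly_eq (w : Word n N) (a : Inequality w → ℂˣ) :
    laurentPoly w a = 1 - ((∑ v, (a (Sum.inl v) : ℂ) • monomial (lambdaVector w v)) +
      ∑ M ∈ (stringVectors w).toFinset, (stringCoef a M : ℂ) • monomial M) := by
  rw [laurentPoly, Fintype.sum_sum_type, ← Finset.sum_set_coe]
  simp only [stringCoef_coe, vectorOf, Sum.elim_inl, Sum.elim_inr]

namespace IsThreeMove

theorem sum_three {R : Type*} [AddCommGroup R] (h : IsThreeMove w w' i j k) {f g : Fin N → R}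
    (h1 : ∀ v, v ≠ i → v ≠ j → v ≠ k → f v = g v) (h2 : f i + f j + f k = g i + g j + g k) :
    ∑ v, f v = ∑ v, g v := by
  have hij := h.ne_left_middle
  have hik := h.ne_left_right
  have hjk := h.ne_middle_right
  have e : ∀ f : Fin N → R, ∑ v, f v = f i + f j + f k + ∑ v ∈ Finset.univ \ {i, j, k}, f v := by
    intro f
    rw [← Finset.sum_sdiff (Finset.subset_univ {i, j, k}), add_comm,
      Finset.sum_insert (by simp [*]), Finset.sum_insert (by simp [*]), Finset.sum_singleton,
      add_assoc (f i) (f j)]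
  rw [e f, e g, h2]
  congr 1
  refine Finset.sum_congr rfl fun v hv => ?_
  simp only [Finset.mem_sdiff, Finset.mem_insert, Finset.mem_singleton, not_or] at hv
  exact h1 v hv.2.1 hv.2.2.1 hv.2.2.2

theorem lambda_eq_replaceAt (h : IsThreeMove w w' i j k) :
    lambdaVector w i = replaceAt ![i, j, k] (lambdaVector w' j) (1, -1, 2) ∧
      lambdaVector w k = replaceAt ![i, j, k] (lambdaVector w' j) (0, 0, 1) := by
  obtain ⟨e1, e2, e3⟩ := h.lambda_left
  obtain ⟨f1, f2, f3⟩ := h.lambda_right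
  exact ⟨eq_replaceAt e1 e2 e3 fun v hi hj hk => ((h.lambda_middle' hi hj hk).1).symm,
    eq_replaceAt f1 f2 f3 fun v hi hj hk => ((h.lambda_middle' hi hj hk).2).symm⟩

/-- Outside the triangle λ_m has equal exponents at `i` and `k` and goes to λ'_m. Of the other
three, λ_j splits into λ'_i and λ'_k, and λ_i and λ_k merge into λ'_j because a_{λ_k} = C a_{λ_i}:
this dictates the choice of C. -/
theorem hPullback_lambda (h : IsThreeMove w w' i j k) (a : Inequality w → ℂˣ) :
    ∑ v, (a (Sum.inl v) : ℂ) • hPullback (ratioC a i k) i j k (monomial (lambdaVector w v)) =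
      ∑ v, (movedCoef w' i j k a (Sum.inl v) : ℂ) • algebraMap (Laurent N)
        (LocalizedLaurent (ratioC a i k) i j k) (monomial (lambdaVector w' v)) := by
  have hij := h.ne_left_middle
  have hik := h.ne_left_right
  have hjk := h.ne_middle_right
  refine h.sum_three (fun v hi hj hk => ?_) ?_
  · obtain ⟨h1, h2⟩ := h.lambda_of_ne hi hj hk
    rw [hPullback_swap hij hik hjk h1, ← h2, smul_smul, ← Units.val_mul]
    simp [movedCoef, hi, hj, hk]
  · obtain ⟨e1, e2, e3⟩ := h.lambda_middle
    obtain ⟨f1, f2, f3⟩ := h.symm.lambda_middle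
    have h1 := hPullback_split (C := ratioC a i k) hij hik hjk (M := lambdaVector w j)
      (by rw [e1, e3]; norm_num)
    have h2 := hPullback_merge (C := ratioC a i k) hij hik hjk (M := lambdaVector w' j)
      (by rw [f1, f3]; norm_num)
    obtain ⟨g1, g2⟩ := h.lambda_eq_replaceAt
    obtain ⟨g3, g4⟩ := h.symm.lambda_eq_replaceAt
    have hk : a (Sum.inl k) = a (Sum.inl i) * ratioC a i k := by simp [ratioC]
    rw [e2, e3] at h1
    rw [f2, f3] at h2
    norm_num at h1 h2
    rw [← g3, ← g4] at h1
    rw [← g1, ← g2] at h2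
    have h3 : movedCoef w' i j k a (Sum.inl i) = a (Sum.inl j) * ratioC a i k ^ (-2 : ℤ) := by
      simp [movedCoef]
    have h4 : movedCoef w' i j k a (Sum.inl j) = a (Sum.inl i) * ratioC a i k ^ (2 : ℤ) := by
      simp [movedCoef, hij.symm]
    have h5 : movedCoef w' i j k a (Sum.inl k) = a (Sum.inl j) * ratioC a i k ^ (-1 : ℤ) := by
      simp [movedCoef, hik.symm, hjk.symm]
    rw [h3, h4, h5, hk, h1]
    simp only [Units.val_mul, mul_smul, smul_add]
    rw [add_right_comm, ← smul_add, h2]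
    simp
    abel

/-! ### Matching of the string vectors before and after the move. -/

theorem swap_mem (h : IsThreeMove w w' i j k) (hw : IsReducedLongest w) :
    ∀ M ∈ (stringVectors w).toFinset.filter fun M => M i = M k,
      replaceAt ![i, j, k] M (M j, M k, M j) ∈
        (stringVectors w').toFinset.filter fun M => M i = M k := by
  intro M hM
  rw [Finset.mem_filter, Set.mem_toFinset] at hM ⊢
  obtain ⟨h1, h2⟩ := h.exchange hw hM.1
  refine ⟨h2 _ (moveTable_swap h1 hM.2), ?_⟩
  rw [replaceAt_left, replaceAt_right h.ne_left_right h.ne_middle_right]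

theorem split_right_mem (h : IsThreeMove w w' i j k) (hw : IsReducedLongest w) :
    ∀ M ∈ (stringVectors w).toFinset.filter fun M => M i = M k + 1,
      replaceAt ![i, j, k] M (0, M k, 1) ∈
        (stringVectors w').toFinset.filter fun M => M i = 0 ∧ M k = 1 := by
  intro M hM
  rw [Finset.mem_filter, Set.mem_toFinset] at hM ⊢
  obtain ⟨h1, h2⟩ := h.exchange hw hM.1
  rw [(moveTable_split h1 hM.2).2] at h2
  refine ⟨h2 _ (by simp), ?_⟩
  rw [replaceAt_left, replaceAt_right h.ne_left_right h.ne_middle_right]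
  simp

theorem split_left_mem (h : IsThreeMove w w' i j k) (hw : IsReducedLongest w) :
    ∀ M ∈ (stringVectors w).toFinset.filter fun M => M i = M k + 1,
      replaceAt ![i, j, k] M (-1, M k + 1, 0) ∈
        (stringVectors w').toFinset.filter fun M => M i = -1 ∧ M k = 0 := by
  intro M hM
  rw [Finset.mem_filter, Set.mem_toFinset] at hM ⊢
  obtain ⟨h1, h2⟩ := h.exchange hw hM.1
  rw [(moveTable_split h1 hM.2).2] at h2
  refine ⟨h2 _ (by simp), ?_⟩
  rw [replaceAt_left, replaceAt_right h.ne_left_right h.ne_middle_right]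
  simp

theorem merge_right_mem (h : IsThreeMove w w' i j k) (hw : IsReducedLongest w) :
    ∀ M ∈ (stringVectors w).toFinset.filter fun M => M i = 0 ∧ M k = 1,
      replaceAt ![i, j, k] M (M j + 1, 0, M j) ∈
        (stringVectors w').toFinset.filter fun M => M i = M k + 1 := by
  intro M hM
  rw [Finset.mem_filter, Set.mem_toFinset] at hM ⊢
  obtain ⟨h1, h2⟩ := h.exchange hw hM.1
  rw [hM.2.1, hM.2.2] at h1 h2
  rw [moveTable_right h1] at h2
  refine ⟨h2 _ (by simp), ?_⟩
  rw [replaceAt_left, replaceAt_right h.ne_left_right h.ne_middle_right]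

theorem merge_left_mem (h : IsThreeMove w w' i j k) (hw : IsReducedLongest w) :
    ∀ M ∈ (stringVectors w).toFinset.filter fun M => M i = -1 ∧ M k = 0,
      replaceAt ![i, j, k] M (M j, 0, M j - 1) ∈
        (stringVectors w').toFinset.filter fun M => M i = M k + 1 := by
  intro M hM
  rw [Finset.mem_filter, Set.mem_toFinset] at hM ⊢
  obtain ⟨h1, h2⟩ := h.exchange hw hM.1
  rw [hM.2.1, hM.2.2] at h1 h2
  rw [moveTable_left h1] at h2
  refine ⟨h2 _ (by simp), ?_⟩
  rw [replaceAt_left, replaceAt_right h.ne_left_right h.ne_middle_right]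
  simp

/-- A vector of splitting type has exponent 0 at `j` by `moveTable_split`, so it can be recovered
from either of the two vectors into which it splits. -/
theorem replaceAt_split_right (h : IsThreeMove w w' i j k) (hw : IsReducedLongest w)
    {M : Fin N → ℤ} (hM : M ∈ (stringVectors w).toFinset.filter fun M => M i = M k + 1) :
    replaceAt ![i, j, k] (replaceAt ![i, j, k] M (0, M k, 1))
      (replaceAt ![i, j, k] M (0, M k, 1) j + 1, 0, replaceAt ![i, j, k] M (0, M k, 1) j) = M := by
  rw [Finset.mem_filter, Set.mem_toFinset] at hM
  have h1 := moveTable_split (h.exchange hw hM.1).1 hM.2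
  rw [h.replaceAt_replaceAt, replaceAt_middle h.ne_left_middle]
  exact replaceAt_eq_self hM.2 h1.1 rfl

theorem replaceAt_split_left (h : IsThreeMove w w' i j k) (hw : IsReducedLongest w)
    {M : Fin N → ℤ} (hM : M ∈ (stringVectors w).toFinset.filter fun M => M i = M k + 1) :
    replaceAt ![i, j, k] (replaceAt ![i, j, k] M (-1, M k + 1, 0))
      (replaceAt ![i, j, k] M (-1, M k + 1, 0) j, 0,
        replaceAt ![i, j, k] M (-1, M k + 1, 0) j - 1) = M := by
  rw [Finset.mem_filter, Set.mem_toFinset] at hM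
  have h1 := moveTable_split (h.exchange hw hM.1).1 hM.2
  rw [h.replaceAt_replaceAt, replaceAt_middle h.ne_left_middle]
  exact replaceAt_eq_self hM.2 h1.1 (by simp)

theorem replaceAt_merge_right (h : IsThreeMove w w' i j k) {S : Finset (Fin N → ℤ)}
    {M : Fin N → ℤ} (hM : M ∈ S.filter fun M => M i = 0 ∧ M k = 1) :
    replaceAt ![i, j, k] (replaceAt ![i, j, k] M (M j + 1, 0, M j))
      (0, replaceAt ![i, j, k] M (M j + 1, 0, M j) k, 1) = M := by
  rw [Finset.mem_filter] at hM
  rw [h.replaceAt_replaceAt, replaceAt_right h.ne_left_right h.ne_middle_right]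
  exact replaceAt_eq_self hM.2.1 rfl hM.2.2

theorem replaceAt_merge_left (h : IsThreeMove w w' i j k) {S : Finset (Fin N → ℤ)}
    {M : Fin N → ℤ} (hM : M ∈ S.filter fun M => M i = -1 ∧ M k = 0) :
    replaceAt ![i, j, k] (replaceAt ![i, j, k] M (M j, 0, M j - 1))
      (-1, replaceAt ![i, j, k] M (M j, 0, M j - 1) k + 1, 0) = M := by
  rw [Finset.mem_filter] at hM
  rw [h.replaceAt_replaceAt, replaceAt_right h.ne_left_right h.ne_middle_right]
  exact replaceAt_eq_self hM.2.1 (by simp) hM.2.2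

/-- The string vectors are sorted by `M i - M k`. Difference 0 corresponds to difference 0 (`e0`),
the splitting vectors before the move to the pairs of partners after it (`e1`), and the pairs of
partners before to the splitting vectors after (`e2`). The inverse matchings come from the reversed
move. -/
theorem hPullback_string (h : IsThreeMove w w' i j k) (hw : IsReducedLongest w)
    {a : Inequality w → ℂˣ} (ha : a ∈ parameterSpace w) :
    ∑ M ∈ (stringVectors w).toFinset, (stringCoef a M : ℂ) •
        hPullback (ratioC a i k) i j k (monomial M) =
      ∑ M ∈ (stringVectors w').toFinset, (stringCoef (movedCoef w' i j k a) M : ℂ) •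
        algebraMap (Laurent N) (LocalizedLaurent (ratioC a i k) i j k) (monomial M) := by
  have hw' := h.isReducedLongest hw
  have hij := h.ne_left_middle
  have hik := h.ne_left_right
  have hjk := h.ne_middle_right
  have split : ∀ (S : Finset (Fin N → ℤ)) (F : (Fin N → ℤ) → LocalizedLaurent (ratioC a i k) i j k),
      (∀ M ∈ S, moveTable (M i) (M j) (M k) ≠ []) →
      ∑ M ∈ S, F M = (∑ M ∈ S with M i = M k, F M) + (∑ M ∈ S with M i = M k + 1, F M) +
        ((∑ M ∈ S with M i = 0 ∧ M k = 1, F M) + ∑ M ∈ S with M i = -1 ∧ M k = 0, F M) := by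
    intro S F hS
    simp only [Finset.sum_filter, ← Finset.sum_add_distrib]
    refine Finset.sum_congr rfl fun M hM => ?_
    rcases moveTable_types (hS M hM) with h1 | h1 | ⟨h1, h2⟩ | ⟨h1, h2⟩
    · rw [if_pos h1, if_neg (by omega), if_neg (by omega), if_neg (by omega)]
      simp
    · rw [if_neg (by omega), if_pos h1, if_neg (by omega), if_neg (by omega)]
      simp
    · simp [h1, h2]
    · simp [h1, h2]
  have hS : ∀ M ∈ (stringVectors w).toFinset, moveTable (M i) (M j) (M k) ≠ [] := fun M hM =>
    (h.exchange hw (Set.mem_toFinset.1 hM)).1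
  have hS' : ∀ M ∈ (stringVectors w').toFinset, moveTable (M i) (M j) (M k) ≠ [] := fun M hM =>
    (h.symm.exchange hw' (Set.mem_toFinset.1 hM)).1
  rw [split _ _ hS, split _ _ hS']
  have e0 : (∑ M ∈ (stringVectors w).toFinset with M i = M k, (stringCoef a M : ℂ) •
        hPullback (ratioC a i k) i j k (monomial M)) =
      ∑ M ∈ (stringVectors w').toFinset with M i = M k, (stringCoef (movedCoef w' i j k a) M : ℂ) •
        algebraMap (Laurent N) (LocalizedLaurent (ratioC a i k) i j k) (monomial M) := by
    refine Finset.sum_nbij' (fun M => replaceAt ![i, j, k] M (M j, M k, M j))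
      (fun M => replaceAt ![i, j, k] M (M j, M k, M j)) (h.swap_mem hw) (h.symm.swap_mem hw')
      (fun M hM => ?_) (fun M hM => ?_) (fun M hM => ?_)
    · have h1 := (Finset.mem_filter.1 hM).2
      rw [h.replaceAt_replaceAt]
      apply replaceAt_eq_self <;> simp [replaceAt_middle hij, replaceAt_right hik hjk, h1]
    · have h1 := (Finset.mem_filter.1 hM).2
      rw [h.replaceAt_replaceAt]
      apply replaceAt_eq_self <;> simp [replaceAt_middle hij, replaceAt_right hik hjk, h1]
    · obtain ⟨h1, h2⟩ := Finset.mem_filter.1 hM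
      have h3 := Set.mem_toFinset.1 (Finset.mem_filter.1 (h.swap_mem hw M hM)).1
      have h4 := (h.symm.exchange hw' h3).1
      simp only [replaceAt_left, replaceAt_middle hij, replaceAt_right hik hjk] at h4
      rw [h.stringCoef_moved hw ha h3 (t := (M k, M j, M k))
        (by
          simp only [replaceAt_left, replaceAt_middle hij, replaceAt_right hik hjk]
          exact moveTable_swap h4 rfl),
        h.replaceAt_replaceAt, replaceAt_eq_self h2 rfl rfl, hPullback_swap hij hik hjk h2,
        smul_smul, Units.val_mul, replaceAt_right hik hjk]
  have e1 : (∑ M ∈ (stringVectors w).toFinset with M i = M k + 1, (stringCoef a M : ℂ) •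
        hPullback (ratioC a i k) i j k (monomial M)) =
      (∑ M ∈ (stringVectors w').toFinset with M i = 0 ∧ M k = 1, (stringCoef (movedCoef w' i j k a) M : ℂ) •
        algebraMap (Laurent N) (LocalizedLaurent (ratioC a i k) i j k) (monomial M)) +
      ∑ M ∈ (stringVectors w').toFinset with M i = -1 ∧ M k = 0, (stringCoef (movedCoef w' i j k a) M : ℂ) •
        algebraMap (Laurent N) (LocalizedLaurent (ratioC a i k) i j k) (monomial M) := by
    have e : ∀ M ∈ (stringVectors w).toFinset.filter fun M => M i = M k + 1,
        (stringCoef a M : ℂ) • hPullback (ratioC a i k) i j k (monomial M) =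
        (stringCoef (movedCoef w' i j k a) (replaceAt ![i, j, k] M (0, M k, 1)) : ℂ) •
          algebraMap (Laurent N) (LocalizedLaurent (ratioC a i k) i j k)
            (monomial (replaceAt ![i, j, k] M (0, M k, 1))) +
        (stringCoef (movedCoef w' i j k a) (replaceAt ![i, j, k] M (-1, M k + 1, 0)) : ℂ) •
          algebraMap (Laurent N) (LocalizedLaurent (ratioC a i k) i j k)
            (monomial (replaceAt ![i, j, k] M (-1, M k + 1, 0))) := by
      intro M hM
      obtain ⟨h1, h2⟩ := Finset.mem_filter.1 hM
      obtain ⟨h3, h4⟩ := moveTable_split (hS M h1) h2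
      have h5 := Set.mem_toFinset.1 (Finset.mem_filter.1 (h.split_right_mem hw M hM)).1
      have h6 := Set.mem_toFinset.1 (Finset.mem_filter.1 (h.split_left_mem hw M hM)).1
      have h7 := (h.symm.exchange hw' h5).1
      have h8 := (h.symm.exchange hw' h6).1
      simp only [replaceAt_left, replaceAt_middle hij, replaceAt_right hik hjk] at h7 h8
      rw [h.stringCoef_moved hw ha h5 (t := (M k + 1, 0, M k))
        (by
          simp only [replaceAt_left, replaceAt_middle hij, replaceAt_right hik hjk]
          rw [moveTable_right h7]
          simp),
        h.stringCoef_moved hw ha h6 (t := (M k + 1, 0, M k))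
        (by
          simp only [replaceAt_left, replaceAt_middle hij, replaceAt_right hik hjk]
          rw [moveTable_left h8]
          simp),
        h.replaceAt_replaceAt, h.replaceAt_replaceAt, replaceAt_eq_self h2 h3 rfl,
        hPullback_split hij hik hjk h2, smul_add, smul_smul, smul_smul, Units.val_mul,
        Units.val_mul, replaceAt_right hik hjk, replaceAt_right hik hjk, h3]
      simp only [sub_zero, add_sub_cancel_right, zero_sub, zero_add]
    rw [Finset.sum_congr rfl e, Finset.sum_add_distrib]
    congr 1
    · refine Finset.sum_nbij' (fun M => replaceAt ![i, j, k] M (0, M k, 1))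
        (fun M => replaceAt ![i, j, k] M (M j + 1, 0, M j)) (h.split_right_mem hw)
        (h.symm.merge_right_mem hw') (fun M hM => ?_) (fun M hM => ?_) fun _ _ => rfl
      · exact h.replaceAt_split_right hw hM
      · exact h.replaceAt_merge_right hM
    · refine Finset.sum_nbij' (fun M => replaceAt ![i, j, k] M (-1, M k + 1, 0))
        (fun M => replaceAt ![i, j, k] M (M j, 0, M j - 1)) (h.split_left_mem hw)
        (h.symm.merge_left_mem hw') (fun M hM => ?_) (fun M hM => ?_) fun _ _ => rfl
      · exact h.replaceAt_split_left hw hM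
      · exact h.replaceAt_merge_left hM
  have e2 : (∑ M ∈ (stringVectors w).toFinset with M i = 0 ∧ M k = 1, (stringCoef a M : ℂ) •
        hPullback (ratioC a i k) i j k (monomial M)) +
      (∑ M ∈ (stringVectors w).toFinset with M i = -1 ∧ M k = 0, (stringCoef a M : ℂ) •
        hPullback (ratioC a i k) i j k (monomial M)) =
      ∑ M ∈ (stringVectors w').toFinset with M i = M k + 1, (stringCoef (movedCoef w' i j k a) M : ℂ) •
        algebraMap (Laurent N) (LocalizedLaurent (ratioC a i k) i j k) (monomial M) := by
    have e : ∀ M ∈ (stringVectors w').toFinset.filter fun M => M i = M k + 1,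
        (stringCoef (movedCoef w' i j k a) M : ℂ) •
          algebraMap (Laurent N) (LocalizedLaurent (ratioC a i k) i j k) (monomial M) =
        (stringCoef a (replaceAt ![i, j, k] M (0, M k, 1)) : ℂ) •
          hPullback (ratioC a i k) i j k (monomial (replaceAt ![i, j, k] M (0, M k, 1))) +
        (stringCoef a (replaceAt ![i, j, k] M (-1, M k + 1, 0)) : ℂ) •
          hPullback (ratioC a i k) i j k (monomial (replaceAt ![i, j, k] M (-1, M k + 1, 0))) := by
      intro M hM
      obtain ⟨h1, h2⟩ := Finset.mem_filter.1 hM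
      obtain ⟨h3, h4⟩ := moveTable_split (hS' M h1) h2
      have h5 := Set.mem_toFinset.1 (Finset.mem_filter.1 (h.symm.split_right_mem hw' M hM)).1
      have h6 := Set.mem_toFinset.1 (Finset.mem_filter.1 (h.symm.split_left_mem hw' M hM)).1
      have h7 := hPullback_merge (C := ratioC a i k) hij hik hjk h2
      rw [h3, zero_add, zero_sub, zero_sub] at h7
      -- The box equation of the old word gives the partners coefficients in the ratio C, as merging
      -- requires.
      rw [h.stringCoef_pair ha h6 h5, h.stringCoef_moved hw ha (Set.mem_toFinset.1 h1)
        (t := (0, M k, 1)) (by rw [h4]; simp), mul_comm (ratioC a i k), Units.val_mul,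
        Units.val_mul, mul_smul, mul_smul, ← smul_add, h7, zero_sub]
    rw [Finset.sum_congr rfl e, Finset.sum_add_distrib]
    congr 1
    · refine Finset.sum_nbij' (fun M => replaceAt ![i, j, k] M (M j + 1, 0, M j))
        (fun M => replaceAt ![i, j, k] M (0, M k, 1)) (h.merge_right_mem hw)
        (h.symm.split_right_mem hw') (fun M hM => ?_) (fun M hM => ?_) fun M hM => ?_
      · exact h.replaceAt_merge_right hM
      · exact h.symm.replaceAt_split_right hw' hM
      · rw [h.replaceAt_merge_right hM]
    · refine Finset.sum_nbij' (fun M => replaceAt ![i, j, k] M (M j, 0, M j - 1))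
        (fun M => replaceAt ![i, j, k] M (-1, M k + 1, 0)) (h.merge_left_mem hw)
        (h.symm.split_left_mem hw') (fun M hM => ?_) (fun M hM => ?_) fun M hM => ?_
      · exact h.replaceAt_merge_left hM
      · exact h.symm.replaceAt_split_left hw' hM
      · rw [h.replaceAt_merge_left hM]
  rw [e0, e1, e2, add_right_comm]

theorem hPullback_laurentPoly (h : IsThreeMove w w' i j k) (hw : IsReducedLongest w)
    {a : Inequality w → ℂˣ} (ha : a ∈ parameterSpace w) :
    hPullback (ratioC a i k) i j k (laurentPoly w a) =
      algebraMap (Laurent N) (LocalizedLaurent (ratioC a i k) i j k)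
        (laurentPoly w' (movedCoef w' i j k a)) := by
  rw [laurentPoly_eq, laurentPoly_eq]
  simp only [map_sub, map_one, map_add, map_sum, map_smul, algebraMap_const_smul]
  rw [h.hPullback_lambda a, h.hPullback_string hw ha]

end IsThreeMove

end PullbackEquation

/-! ### The box equations after the move -/

section BoxEquations

variable {n N : ℕ} {w w' : Word n N} {i j k : Fin N}

/-- The exponents which a string inequality may have at the three crossings of a 3-move. -/
def localTypes : List (ℤ × ℤ × ℤ) :=
  [(0, 0, 0), (0, 1, 0), (0, -1, 0), (1, 0, 1), (-1, 0, -1), (1, -1, 1), (-1, 1, -1), (1, 0, 0),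
    (0, 0, -1), (-1, 0, 0), (0, -1, 1), (-1, 1, 0), (0, 0, 1)]

/-- Exponents `p` and `q` differing by `d` are related by the move to exponents `x` and `y`
differing by `d'`; the powers of the constant differ by `e`. -/
abbrev Transfers (p q d d' : ℤ × ℤ × ℤ) (e : ℤ) (good : ℤ × ℤ × ℤ → ℤ × ℤ × ℤ → Prop) : Prop :=
  p + d = q → ∃ x ∈ moveTable p.1 p.2.1 p.2.2, ∃ y ∈ moveTable q.1 q.2.1 q.2.2,
    x + d' = y ∧ good x y ∧ x.1 - p.2.2 + e = y.1 - q.2.2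

-- For a box that has `i` and `k` on its boundary after the move and only `j` before. The extra
-- condition excludes the pair (0, 0, 1), (-1, 0, 0), for which the table gives no matching
-- relation; `not_box_pair` shows that it does not occur.
set_option maxRecDepth 100000 in
theorem transfers_around_left : ∀ p ∈ localTypes, ∀ q ∈ localTypes, (p.2.2 = 0 ∨ q.1 = 0) →
    Transfers p q (-1, 0, -1) (0, -1, 0) 1 fun _ _ => True := by decide

-- The opposite situation, with only `j` on the boundary after the move; here there is no exception.
set_option maxRecDepth 100000 in
theorem transfers_around_middle : ∀ p ∈ localTypes, ∀ q ∈ localTypes,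
    Transfers p q (0, -1, 0) (-1, 0, -1) (-1) fun _ _ => True := by decide

-- In this and the next three checks the box ends or begins at a crossing of the triangle. The last
-- condition keeps the exponent 1 or -1 that the old box equation requires at the corresponding
-- crossing.
set_option maxRecDepth 100000 in
theorem transfers_above_left : ∀ p ∈ localTypes, ∀ q ∈ localTypes, q.1 = 1 →
    Transfers p q (1, 0, 0) (-1, 1, 0) (-1) fun _ y => y.2.1 = 1 := by decide

set_option maxRecDepth 100000 in
theorem transfers_above_middle : ∀ p ∈ localTypes, ∀ q ∈ localTypes, q.2.1 = 1 →
    Transfers p q (-1, 1, 0) (1, 0, 0) 1 fun _ y => y.1 = 1 := by decide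

set_option maxRecDepth 100000 in
theorem transfers_below_middle : ∀ p ∈ localTypes, ∀ q ∈ localTypes, p.2.1 = -1 →
    Transfers p q (0, 1, -1) (0, 0, 1) 1 fun x _ => x.2.2 = -1 := by decide

set_option maxRecDepth 100000 in
theorem transfers_below_right : ∀ p ∈ localTypes, ∀ q ∈ localTypes, p.2.2 = -1 →
    Transfers p q (0, 0, 1) (0, 1, -1) (-1) fun x _ => x.2.1 = -1 := by decide

-- The difference after transfer is 0: the two inequalities of the new box come from a single old
-- one.
set_option maxRecDepth 100000 in
theorem transfers_inside : ∀ p ∈ localTypes, ∀ q ∈ localTypes, p.1 = -1 → q.2.2 = 1 →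
    Transfers p q (1, -1, 1) (0, 0, 0) (-1) fun _ _ => True := by decide

namespace IsThreeMove

/-- The power of the constant by which the coefficient of a `λ`-inequality changes. -/
theorem movedCoef_left (a : Inequality w → ℂˣ) :
    movedCoef w' i j k a (Sum.inl i) = a (Sum.inl j) * ratioC a i k ^ (-2 : ℤ) := by
  simp [movedCoef]

theorem movedCoef_middle (h : IsThreeMove w w' i j k) (a : Inequality w → ℂˣ) :
    movedCoef w' i j k a (Sum.inl j) = a (Sum.inl i) * ratioC a i k ^ (2 : ℤ) := by
  simp [movedCoef, h.ne_left_middle.symm]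

theorem movedCoef_right (h : IsThreeMove w w' i j k) (a : Inequality w → ℂˣ) :
    movedCoef w' i j k a (Sum.inl k) = a (Sum.inl j) * ratioC a i k ^ (-1 : ℤ) := by
  simp [movedCoef, h.ne_left_right.symm, h.ne_middle_right.symm]

theorem movedCoef_of_ne {v : Fin N} (hi : v ≠ i) (hj : v ≠ j) (hk : v ≠ k)
    (a : Inequality w → ℂˣ) : movedCoef w' i j k a (Sum.inl v) =
      a (Sum.inl v) * ratioC a i k ^ (lambdaVector w v k - lambdaVector w v j) := by
  simp [movedCoef, hi, hj, hk]

theorem localType_mem (h : IsThreeMove w w' i j k) (hw : IsReducedLongest w) {M : Fin N → ℤ}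
    (hM : M ∈ stringVectors w) : (M i, M j, M k) ∈ localTypes :=
  moveTable_mem_cases (h.exchange hw hM).1

theorem ext_off {M M' : Fin N → ℤ} (hi : M i = M' i)
    (hj : M j = M' j) (hk : M k = M' k) (hoff : ∀ v, v ≠ i → v ≠ j → v ≠ k → M v = M' v) :
    M = M' := by
  rw [eq_replaceAt (t := (M' i, M' j, M' k)) hi hj hk hoff]
  exact replaceAt_eq_self rfl rfl rfl

/-- A box equation before the move gives a box equation after the move. -/
theorem box_transfer (h : IsThreeMove w w' i j k) (hw : IsReducedLongest w)
    {a : Inequality w → ℂˣ} (ha : a ∈ parameterSpace w) {top bot top₀ bot₀ : Fin N}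
    (hbox : IsBox w top₀ bot₀) {u v : ℤ}
    (hu : movedCoef w' i j k a (Sum.inl top) = a (Sum.inl top₀) * ratioC a i k ^ u)
    (hv : movedCoef w' i j k a (Sum.inl bot) = a (Sum.inl bot₀) * ratioC a i k ^ v)
    {P Q : Fin N → ℤ} (hP : P ∈ stringVectors w') (hQ : Q ∈ stringVectors w')
    (hPQ : P + lambdaVector w' top = Q + lambdaVector w' bot)
    (hoff : ∀ v, v ≠ i → v ≠ j → v ≠ k → lambdaVector w' top v - lambdaVector w' bot v =
      lambdaVector w top₀ v - lambdaVector w bot₀ v)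
    {x y d : ℤ × ℤ × ℤ} (hx : x ∈ moveTable (P i) (P j) (P k))
    (hy : y ∈ moveTable (Q i) (Q j) (Q k)) (hxy : x + d = y)
    (hdi : lambdaVector w top₀ i - lambdaVector w bot₀ i = d.1)
    (hdj : lambdaVector w top₀ j - lambdaVector w bot₀ j = d.2.1)
    (hdk : lambdaVector w top₀ k - lambdaVector w bot₀ k = d.2.2)
    (htop : replaceAt ![i, j, k] P x top₀ = -1) (hbot : replaceAt ![i, j, k] Q y bot₀ = 1)
    (he : x.1 - P k + (u - v) = y.1 - Q k) :
    stringCoef (movedCoef w' i j k a) P * movedCoef w' i j k a (Sum.inl top) =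
      stringCoef (movedCoef w' i j k a) Q * movedCoef w' i j k a (Sum.inl bot) := by
  have hij := h.ne_left_middle
  have hik := h.ne_left_right
  have hjk := h.ne_middle_right
  have hw' := h.isReducedLongest hw
  have hP' := (h.symm.exchange hw' hP).2 x hx
  have hQ' := (h.symm.exchange hw' hQ).2 y hy
  have e : ∀ {M'} (h : M' ∈ stringVectors w), a (Sum.inr ⟨M', h⟩) = stringCoef a M' :=
    fun h => (stringCoef_coe a ⟨_, h⟩).symm
  subst hxy
  -- The moved vectors satisfy the relation of the old box: away from the triangle it is the given
  -- one by `hoff`, and at the three crossings it is `x + d = y`.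
  have key := ha top₀ bot₀ ⟨_, hP'⟩ ⟨_, hQ'⟩ hbox ?_ htop hbot
  · rw [e, e] at key
    rw [h.stringCoef_moved hw ha hP hx, h.stringCoef_moved hw ha hQ hy, hu, hv,
      mul_mul_mul_comm _ (_ ^ (x.1 - P k)), key, mul_mul_mul_comm _ (_ ^ ((x + d).1 - Q k)),
      ← zpow_add, ← zpow_add]
    congr 2
    linarith
  · refine ext_off (i := i) (j := j) (k := k) ?_ ?_ ?_ fun v h1 h2 h3 => ?_
    · simp only [Pi.add_apply, replaceAt_left, Prod.fst_add]
      linarith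
    · simp only [Pi.add_apply, replaceAt_middle hij, Prod.fst_add, Prod.snd_add]
      linarith
    · simp only [Pi.add_apply, replaceAt_right hik hjk, Prod.snd_add]
      linarith
    · have h4 := congrFun hPQ v
      have h5 := hoff v h1 h2 h3
      simp only [Pi.add_apply, replaceAt_of_ne h1 h2 h3] at h4 ⊢
      linarith

theorem lambda_above (h : IsThreeMove w w' i j k) {t : Fin N} (ht : t < i) {x : Fin N}
    (hx : x = i ∨ x = j ∨ x = k) : lambdaVector w t x = if w x = w t then 2 else
      if (w x : ℕ) + 1 = w t ∨ (w t : ℕ) + 1 = w x then -1 else 0 := by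
  obtain ⟨h1, h2, h3⟩ := h.lt_left
  have h4 : t < x := by
    rcases hx with rfl | rfl | rfl
    · exact ht
    · exact ht.trans h1
    · exact ht.trans h3
  simp only [lambdaVector, if_neg h4.ne', if_pos h4]

theorem lambda_below (h : IsThreeMove w w' i j k) {b : Fin N} (hb : k < b) {x : Fin N}
    (hx : x = i ∨ x = j ∨ x = k) : lambdaVector w b x = 0 := by
  obtain ⟨h1, h2, h3⟩ := h.lt_left
  have h4 : x < b := by
    rcases hx with rfl | rfl | rfl
    · exact h3.trans hb
    · exact h2.trans hb
    · exact hb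
  simp only [lambdaVector, if_neg h4.ne, if_neg h4.not_gt]

theorem ne_of_lt_left (h : IsThreeMove w w' i j k) {t : Fin N} (ht : t < i) :
    t ≠ i ∧ t ≠ j ∧ t ≠ k := by
  obtain ⟨h1, h2, h3⟩ := h.lt_left
  exact ⟨ht.ne, (ht.trans h1).ne, (ht.trans h3).ne⟩

theorem ne_of_right_lt (h : IsThreeMove w w' i j k) {b : Fin N} (hb : k < b) :
    b ≠ i ∧ b ≠ j ∧ b ≠ k := by
  obtain ⟨h1, h2, h3⟩ := h.lt_left
  exact ⟨(h3.trans hb).ne', (h2.trans hb).ne', hb.ne'⟩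

theorem movedCoef_below (h : IsThreeMove w w' i j k) (a : Inequality w → ℂˣ) {b : Fin N}
    (hb : k < b) : movedCoef w' i j k a (Sum.inl b) = a (Sum.inl b) * ratioC a i k ^ (0 : ℤ) := by
  obtain ⟨h1, h2, h3⟩ := h.ne_of_right_lt hb
  rw [movedCoef_of_ne h1 h2 h3, h.lambda_below hb (by simp), h.lambda_below hb (by simp), sub_zero]

theorem lambda_off (h : IsThreeMove w w' i j k) {m : Fin N} (hi : m ≠ i) (hj : m ≠ j) (hk : m ≠ k)
    {v : Fin N} (h1 : v ≠ i) (h2 : v ≠ j) (h3 : v ≠ k) :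
    lambdaVector w' m v = lambdaVector w m v := by
  rw [(h.lambda_of_ne hi hj hk).2, replaceAt_of_ne h1 h2 h3]

theorem lambda_add_eq {P Q : Fin N → ℤ} {top bot : Fin N} {d : ℤ × ℤ × ℤ}
    (hPQ : P + lambdaVector w' top = Q + lambdaVector w' bot)
    (hdi : lambdaVector w' top i - lambdaVector w' bot i = d.1)
    (hdj : lambdaVector w' top j - lambdaVector w' bot j = d.2.1)
    (hdk : lambdaVector w' top k - lambdaVector w' bot k = d.2.2) :
    (P i, P j, P k) + d = (Q i, Q j, Q k) := by
  have h1 := congrFun hPQ i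
  have h2 := congrFun hPQ j
  have h3 := congrFun hPQ k
  simp only [Pi.add_apply] at h1 h2 h3
  ext <;> simp <;> linarith

/-- The box equation of the box formed by the three crossings. -/
theorem box_inside (h : IsThreeMove w w' i j k) (hw : IsReducedLongest w)
    {a : Inequality w → ℂˣ} (ha : a ∈ parameterSpace w) {P Q : Fin N → ℤ}
    (hP : P ∈ stringVectors w') (hQ : Q ∈ stringVectors w')
    (hPQ : P + lambdaVector w' i = Q + lambdaVector w' k) (hPt : P i = -1) (hQb : Q k = 1) :
    stringCoef (movedCoef w' i j k a) P * movedCoef w' i j k a (Sum.inl i) =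
      stringCoef (movedCoef w' i j k a) Q * movedCoef w' i j k a (Sum.inl k) := by
  have hw' := h.isReducedLongest hw
  obtain ⟨e1, e2, e3⟩ := h.symm.lambda_left
  obtain ⟨f1, f2, f3⟩ := h.symm.lambda_right
  obtain ⟨x, hx, y, hy, hxy, -, he⟩ := transfers_inside _ (h.symm.localType_mem hw' hP) _
    (h.symm.localType_mem hw' hQ) hPt hQb (lambda_add_eq hPQ (by rw [e1, f1]; rfl)
      (by rw [e2, f2]; rfl) (by rw [e3, f3]; rfl))
  rw [h.stringCoef_moved hw ha hP hx, h.stringCoef_moved hw ha hQ hy, movedCoef_left,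
    h.movedCoef_right]
  -- Both `P` and `Q` come from the same old string vector, so only powers of C are left to compare.
  have hxy' : x = y := by rw [← hxy]; ext <;> simp
  have hrep : replaceAt ![i, j, k] P x = replaceAt ![i, j, k] Q y := by
    rw [hxy']
    apply eq_replaceAt
    · exact replaceAt_left _ _
    · exact replaceAt_middle h.ne_left_middle _ _
    · exact replaceAt_right h.ne_left_right h.ne_middle_right _ _
    · intro v h1 h2 h3
      have h4 := congrFun hPQ v
      have h5 := (h.symm.lambda_middle' h1 h2 h3)
      simp only [Pi.add_apply] at h4
      rw [replaceAt_of_ne h1 h2 h3]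
      linarith [h5.1, h5.2]
  rw [hrep, mul_mul_mul_comm _ (_ ^ (x.1 - P k)), mul_mul_mul_comm _ (_ ^ (y.1 - Q k)),
    ← zpow_add, ← zpow_add]
  congr 2
  simp only at he
  linarith

/-- The box equation of a box which is not bounded by crossings of the 3-move. -/
theorem box_outside (h : IsThreeMove w w' i j k) (hw : IsReducedLongest w)
    {a : Inequality w → ℂˣ} (ha : a ∈ parameterSpace w) {top bot : Fin N}
    (hbox : IsBox w' top bot) (ht : top ≠ i ∧ top ≠ j ∧ top ≠ k) (hb : bot ≠ i ∧ bot ≠ j ∧ bot ≠ k)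
    {P Q : Fin N → ℤ} (hP : P ∈ stringVectors w') (hQ : Q ∈ stringVectors w')
    (hPQ : P + lambdaVector w' top = Q + lambdaVector w' bot) (hPt : P top = -1)
    (hQb : Q bot = 1) :
    stringCoef (movedCoef w' i j k a) P * movedCoef w' i j k a (Sum.inl top) =
      stringCoef (movedCoef w' i j k a) Q * movedCoef w' i j k a (Sum.inl bot) := by
  have hw' := h.isReducedLongest hw
  have hij := h.ne_left_middle
  have hik := h.ne_left_right
  have hjk := h.ne_middle_right
  obtain ⟨ti, tj, tk⟩ := ht
  obtain ⟨bi, bj, bk⟩ := hb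
  have hcol := h.columns_ne
  have hwt := h.hq' top ti tj tk
  have hwb := h.hq' bot bi bj bk
  obtain ⟨b1, b2, b3⟩ := hbox
  have hbox₀ : IsBox w top bot := by
    refine ⟨b1, by rw [← hwt, ← hwb, b2], fun x hx1 hx2 => ?_⟩
    have l1 := h.lt_iff ti tj tk
    have l2 := h.lt_iff bi bj bk
    have hi := b3 i
    have hj := b3 j
    rw [h.hi', hwt] at hi
    rw [h.hj', hwt] at hj
    by_cases x1 : x = i
    · subst x1
      exact hj (l1.1.2 hx1) (l2.2.2.2.2 (l2.2.2.1.1 hx2))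
    by_cases x2 : x = j
    · subst x2
      exact hi (l1.1.1 hx1) (l2.2.2.1.2 (l2.2.2.2.1 hx2))
    by_cases x3 : x = k
    · subst x3
      rw [h.hki]
      exact hj (l1.1.2 (l1.2.1.1 hx1)) (l2.2.2.2.2 hx2)
    rw [← h.hq' x x1 x2 x3, ← hwt]
    exact b3 x hx1 hx2
  have hoff : ∀ v, v ≠ i → v ≠ j → v ≠ k → lambdaVector w' top v - lambdaVector w' bot v =
      lambdaVector w top v - lambdaVector w bot v := fun v v1 v2 v3 => by
    rw [h.lambda_off ti tj tk v1 v2 v3, h.lambda_off bi bj bk v1 v2 v3]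
  have main : ∀ {x y d : ℤ × ℤ × ℤ}, x ∈ moveTable (P i) (P j) (P k) →
      y ∈ moveTable (Q i) (Q j) (Q k) → x + d = y →
      lambdaVector w top i - lambdaVector w bot i = d.1 →
      lambdaVector w top j - lambdaVector w bot j = d.2.1 →
      lambdaVector w top k - lambdaVector w bot k = d.2.2 →
      x.1 - P k + (d.2.2 - d.2.1) = y.1 - Q k →
      stringCoef (movedCoef w' i j k a) P * movedCoef w' i j k a (Sum.inl top) =
        stringCoef (movedCoef w' i j k a) Q * movedCoef w' i j k a (Sum.inl bot) := by
    intro x y d hx hy hxy hdi hdj hdk he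
    refine h.box_transfer hw ha hbox₀ (movedCoef_of_ne ti tj tk a) (movedCoef_of_ne bi bj bk a)
      hP hQ hPQ hoff hx hy hxy hdi hdj hdk ?_ ?_ ?_
    · rw [replaceAt_of_ne ti tj tk, hPt]
    · rw [replaceAt_of_ne bi bj bk, hQb]
    · rw [← he, ← hdj, ← hdk]
      ring
  -- If the two λ-vectors agree on the triangle, then so do `P` and `Q`, and one table entry serves
  -- for both.
  have same : (∀ x, x = i ∨ x = j ∨ x = k → lambdaVector w top x = lambdaVector w bot x) →
      stringCoef (movedCoef w' i j k a) P * movedCoef w' i j k a (Sum.inl top) =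
        stringCoef (movedCoef w' i j k a) Q * movedCoef w' i j k a (Sum.inl bot) := by
    intro hs
    have hsi := hs i (by simp)
    have hsj := hs j (by simp)
    have hsk := hs k (by simp)
    have e : (P i, P j, P k) + 0 = (Q i, Q j, Q k) := by
      apply lambda_add_eq hPQ <;>
        simp [(h.lambda_of_ne ti tj tk).2, (h.lambda_of_ne bi bj bk).2, replaceAt_left,
          replaceAt_middle hij, replaceAt_right hik hjk, hsj, hsk]
    simp only [add_zero, Prod.mk.injEq] at e
    obtain ⟨x, hx⟩ := List.exists_mem_of_ne_nil _ (h.symm.exchange hw' hP).1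
    refine main (d := 0) hx (by rw [← e.1, ← e.2.1, ← e.2.2]; exact hx) (add_zero x)
      (by simp [hsi]) (by simp [hsj]) (by simp [hsk]) ?_
    rw [e.2.2]
    simp
  rcases lt_or_ge i bot with hib | hib
  · have hkb : k < bot := (h.lt_iff bi bj bk).2.2.1.1 hib
    have hb0 : ∀ x, x = i ∨ x = j ∨ x = k → lambdaVector w bot x = 0 := fun x hx =>
      h.lambda_below hkb hx
    rcases lt_or_ge i top with hit | hit
    · have hkt : k < top := (h.lt_iff ti tj tk).2.2.1.1 hit
      exact same fun x hx => by rw [hb0 x hx, h.lambda_below hkt hx]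
    · have hti : top < i := lt_of_le_of_ne hit ti
      obtain ⟨l1, l2, l3⟩ := h.lt_left
      have ci : w i ≠ w top := hbox₀.2.2 i hti hib
      have cj : w j ≠ w top := hbox₀.2.2 j (hti.trans l1) (l2.trans hkb)
      have vi := h.lambda_above hti (x := i) (by simp)
      have vj := h.lambda_above hti (x := j) (by simp)
      have vk : lambdaVector w top k = lambdaVector w top i := (h.lambda_of_ne ti tj tk).1.symm
      rw [if_neg ci] at vi
      rw [if_neg cj] at vj
      have hadj := h.adjacent
      have b0i := hb0 i (by simp)
      have b0j := hb0 j (by simp)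
      have b0k := hb0 k (by simp)
      have rt := (h.lambda_of_ne ti tj tk).2
      have rb := (h.lambda_of_ne bi bj bk).2
      have ci' : (w i : ℕ) ≠ w top := fun h => ci (Fin.ext h)
      have cj' : (w j : ℕ) ≠ w top := fun h => cj (Fin.ext h)
      -- The triangle now lies at the height of the box and outside its column. At most one of its
      -- two adjacent columns can neighbour that of the box.
      by_cases ai : (w i : ℕ) + 1 = w top ∨ (w top : ℕ) + 1 = w i
      · have aj : ¬ ((w j : ℕ) + 1 = w top ∨ (w top : ℕ) + 1 = w j) := by omega
        rw [if_pos ai] at vi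
        rw [if_neg aj] at vj
        rw [vi] at vk
        obtain ⟨x, hx, y, hy, hxy, -, he⟩ := transfers_around_middle _
          (h.symm.localType_mem hw' hP) _ (h.symm.localType_mem hw' hQ)
          (lambda_add_eq hPQ
            (by simp [rt, rb, replaceAt_left, vj, b0j])
            (by simp [rt, rb, replaceAt_middle hij, vk, b0k])
            (by simp [rt, rb, replaceAt_right hik hjk, vj, b0j]))
        exact main hx hy hxy (by simp [vi, b0i]) (by simp [vj, b0j]) (by simp [vk, b0k])
          (by simpa using he)
      · rw [if_neg ai] at vi
        rw [vi] at vk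
        by_cases aj : (w j : ℕ) + 1 = w top ∨ (w top : ℕ) + 1 = w j
        · rw [if_pos aj] at vj
          -- After the move the crossings `i` and `k` bound the box from the side; the exceptional
          -- pair is excluded by the geometry of the paths.
          have hgood : P k = 0 ∨ Q i = 0 := by
            by_contra! hne
            obtain ⟨st, ty, T⟩ := h.symm.exists_triangleMove hw'
            refine T.source.not_box_pair hw' ⟨b1, b2, b3⟩ hti hkb ?_ ?_ hP hQ hPQ hPt hQb hne.1
              hne.2
            · simp only [Matrix.cons_val_zero, h.hi', hwt]
              omega
            · simp only [Matrix.cons_val_one, Matrix.cons_val_zero, h.hj', hwt]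
              exact ci
          obtain ⟨x, hx, y, hy, hxy, -, he⟩ := transfers_around_left _
            (h.symm.localType_mem hw' hP) _ (h.symm.localType_mem hw' hQ) hgood
            (lambda_add_eq hPQ
              (by simp [rt, rb, replaceAt_left, vj, b0j])
              (by simp [rt, rb, replaceAt_middle hij, vk, b0k])
              (by simp [rt, rb, replaceAt_right hik hjk, vj, b0j]))
          exact main hx hy hxy (by simp [vi, b0i]) (by simp [vj, b0j]) (by simp [vk, b0k])
            (by simpa using he)
        · rw [if_neg aj] at vj
          refine same fun x hx => ?_
          rw [hb0 x hx]
          rcases hx with rfl | rfl | rfl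
          · exact vi
          · exact vj
          · exact vk
  -- The triangle is below the box, so two λ-vectors of the same column have the same entries there.
  · have hbi : bot < i := lt_of_le_of_ne hib bi
    refine same fun x hx => ?_
    rw [h.lambda_above hbi hx, h.lambda_above (b1.trans hbi) hx, hbox₀.2.1]

/-- Before the move the column of `w' i` is met in the triangle at `j` only, so the corresponding
old box is bounded by `top` and `j`. -/
theorem box_above_left (h : IsThreeMove w w' i j k) (hw : IsReducedLongest w)
    {a : Inequality w → ℂˣ} (ha : a ∈ parameterSpace w) {top : Fin N} (hbox : IsBox w' top i)
    {P Q : Fin N → ℤ} (hP : P ∈ stringVectors w') (hQ : Q ∈ stringVectors w')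
    (hPQ : P + lambdaVector w' top = Q + lambdaVector w' i) (hPt : P top = -1) (hQb : Q i = 1) :
    stringCoef (movedCoef w' i j k a) P * movedCoef w' i j k a (Sum.inl top) =
      stringCoef (movedCoef w' i j k a) Q * movedCoef w' i j k a (Sum.inl i) := by
  have hw' := h.isReducedLongest hw
  have hij := h.ne_left_middle
  have hik := h.ne_left_right
  have hjk := h.ne_middle_right
  obtain ⟨l1, l2, l3⟩ := h.lt_left
  obtain ⟨b1, b2, b3⟩ := hbox
  obtain ⟨ti, tj, tk⟩ := h.ne_of_lt_left b1
  have hwt := h.hq' top ti tj tk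
  rw [hwt, h.hi'] at b2
  have hbox₀ : IsBox w top j := by
    refine ⟨b1.trans l1, b2, fun x hx1 hx2 => ?_⟩
    by_cases x1 : x = i
    · rw [x1, b2]
      exact h.columns_ne
    by_cases x3 : x = k
    · exact absurd (x3 ▸ hx2) l2.not_gt
    rw [← h.hq' x x1 hx2.ne x3, ← hwt]
    exact b3 x hx1 ((h.lt_iff x1 hx2.ne x3).1.1 hx2)
  have hadj := h.adjacent
  have vi := h.lambda_above b1 (x := i) (by simp)
  have vj := h.lambda_above b1 (x := j) (by simp)
  have vk : lambdaVector w top k = lambdaVector w top i := (h.lambda_of_ne ti tj tk).1.symm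
  rw [b2, if_neg h.columns_ne, if_pos (by omega)] at vi
  rw [b2, if_pos rfl] at vj
  rw [vi] at vk
  have rt := (h.lambda_of_ne ti tj tk).2
  obtain ⟨e1, e2, e3⟩ := h.symm.lambda_left
  obtain ⟨f1, f2, f3⟩ := h.lambda_middle
  obtain ⟨x, hx, y, hy, hxy, hgood, he⟩ := transfers_above_left _ (h.symm.localType_mem hw' hP) _
    (h.symm.localType_mem hw' hQ) hQb (lambda_add_eq hPQ
      (by simp [rt, replaceAt_left, vj, e1])
      (by simp [rt, replaceAt_middle hij, vk, e2])
      (by simp [rt, replaceAt_right hik hjk, vj, e3]))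
  refine h.box_transfer hw ha hbox₀ (movedCoef_of_ne ti tj tk a) (movedCoef_left a) hP hQ hPQ
    (fun v h1 h2 h3 => ?_) hx hy hxy (by simp [vi, f1]) (by simp [vj, f2]) (by simp [vk, f3])
    (by rw [replaceAt_of_ne ti tj tk, hPt]) (by rw [replaceAt_middle hij, hgood]) ?_
  · rw [h.lambda_off ti tj tk h1 h2 h3, (h.symm.lambda_middle' h1 h2 h3).1]
  · rw [vk, vj]
    simp only at he
    linarith

/-- The column of `w' j` is that of `w i` and `w k`, and from above `i` is met first: the old box is
bounded by `top` and `i`. -/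
theorem box_above_middle (h : IsThreeMove w w' i j k) (hw : IsReducedLongest w)
    {a : Inequality w → ℂˣ} (ha : a ∈ parameterSpace w) {top : Fin N} (hbox : IsBox w' top j)
    {P Q : Fin N → ℤ} (hP : P ∈ stringVectors w') (hQ : Q ∈ stringVectors w')
    (hPQ : P + lambdaVector w' top = Q + lambdaVector w' j) (hPt : P top = -1) (hQb : Q j = 1) :
    stringCoef (movedCoef w' i j k a) P * movedCoef w' i j k a (Sum.inl top) =
      stringCoef (movedCoef w' i j k a) Q * movedCoef w' i j k a (Sum.inl j) := by
  have hw' := h.isReducedLongest hw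
  have hij := h.ne_left_middle
  have hik := h.ne_left_right
  have hjk := h.ne_middle_right
  obtain ⟨l1, l2, l3⟩ := h.lt_left
  obtain ⟨b1, b2, b3⟩ := hbox
  have ti : top ≠ i := by
    rintro rfl
    rw [h.hi', h.hj'] at b2
    exact h.columns_ne b2.symm
  have tj : top ≠ j := b1.ne
  have tk : top ≠ k := (b1.trans l2).ne
  have hti : top < i := (h.lt_iff ti tj tk).1.1 b1
  have hwt := h.hq' top ti tj tk
  rw [hwt, h.hj'] at b2
  have hbox₀ : IsBox w top i := by
    refine ⟨hti, b2, fun x hx1 hx2 => ?_⟩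
    obtain ⟨x1, x2, x3⟩ := h.ne_of_lt_left hx2
    rw [← h.hq' x x1 x2 x3, ← hwt]
    exact b3 x hx1 (hx2.trans l1)
  have hadj := h.adjacent
  have vi := h.lambda_above hti (x := i) (by simp)
  have vj := h.lambda_above hti (x := j) (by simp)
  have vk : lambdaVector w top k = lambdaVector w top i := (h.lambda_of_ne ti tj tk).1.symm
  rw [b2, if_pos rfl] at vi
  rw [b2, if_neg h.columns_ne.symm, if_pos (by omega)] at vj
  rw [vi] at vk
  have rt := (h.lambda_of_ne ti tj tk).2
  obtain ⟨e1, e2, e3⟩ := h.symm.lambda_middle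
  obtain ⟨f1, f2, f3⟩ := h.lambda_left
  obtain ⟨x, hx, y, hy, hxy, hgood, he⟩ := transfers_above_middle _ (h.symm.localType_mem hw' hP) _
    (h.symm.localType_mem hw' hQ) hQb (lambda_add_eq hPQ
      (by simp [rt, replaceAt_left, vj, e1])
      (by simp [rt, replaceAt_middle hij, vk, e2])
      (by simp [rt, replaceAt_right hik hjk, vj, e3]))
  refine h.box_transfer hw ha hbox₀ (movedCoef_of_ne ti tj tk a) (h.movedCoef_middle a) hP hQ hPQ
    (fun v h1 h2 h3 => ?_) hx hy hxy (by simp [vi, f1]) (by simp [vj, f2]) (by simp [vk, f3])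
    (by rw [replaceAt_of_ne ti tj tk, hPt]) (by rw [replaceAt_left, hgood]) ?_
  · rw [h.lambda_off ti tj tk h1 h2 h3, (h.lambda_middle' h1 h2 h3).1]
  · rw [vk, vj]
    simp only at he
    linarith

/-- Seen from below, the first crossing of this column in the old triangle is `k`, so the old box is
bounded by `k` and `bot`. -/
theorem box_below_middle (h : IsThreeMove w w' i j k) (hw : IsReducedLongest w)
    {a : Inequality w → ℂˣ} (ha : a ∈ parameterSpace w) {bot : Fin N} (hbox : IsBox w' j bot)
    {P Q : Fin N → ℤ} (hP : P ∈ stringVectors w') (hQ : Q ∈ stringVectors w')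
    (hPQ : P + lambdaVector w' j = Q + lambdaVector w' bot) (hPt : P j = -1) (hQb : Q bot = 1) :
    stringCoef (movedCoef w' i j k a) P * movedCoef w' i j k a (Sum.inl j) =
      stringCoef (movedCoef w' i j k a) Q * movedCoef w' i j k a (Sum.inl bot) := by
  have hw' := h.isReducedLongest hw
  have hij := h.ne_left_middle
  have hik := h.ne_left_right
  have hjk := h.ne_middle_right
  obtain ⟨l1, l2, l3⟩ := h.lt_left
  obtain ⟨b1, b2, b3⟩ := hbox
  have bk : bot ≠ k := by
    rintro rfl
    rw [h.hk', h.hj'] at b2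
    exact h.columns_ne b2
  have bj : bot ≠ j := b1.ne'
  have bi : bot ≠ i := (l1.trans b1).ne'
  have hkb : k < bot := (h.lt_iff bi bj bk).2.2.2.1 b1
  have hwb := h.hq' bot bi bj bk
  rw [hwb, h.hj'] at b2
  have hbox₀ : IsBox w k bot := by
    refine ⟨hkb, by rw [h.hki, b2], fun x hx1 hx2 => ?_⟩
    obtain ⟨x1, x2, x3⟩ := h.ne_of_right_lt hx1
    rw [← h.hq' x x1 x2 x3, h.hki, ← h.hj']
    exact b3 x (l2.trans hx1) hx2
  have b0 : ∀ x, x = i ∨ x = j ∨ x = k → lambdaVector w bot x = 0 := fun x hx =>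
    h.lambda_below hkb hx
  have b0' : ∀ x, x = i ∨ x = j ∨ x = k → lambdaVector w' bot x = 0 := fun x hx =>
    h.symm.lambda_below hkb hx
  obtain ⟨e1, e2, e3⟩ := h.symm.lambda_middle
  obtain ⟨f1, f2, f3⟩ := h.lambda_right
  obtain ⟨x, hx, y, hy, hxy, hgood, he⟩ := transfers_below_middle _ (h.symm.localType_mem hw' hP) _
    (h.symm.localType_mem hw' hQ) hPt (lambda_add_eq hPQ
      (by simp [e1, b0']) (by simp [e2, b0']) (by simp [e3, b0']))
  refine h.box_transfer hw ha hbox₀ (u := 1) ?_ (h.movedCoef_below a hkb) hP hQ hPQ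
    (fun v h1 h2 h3 => ?_) hx hy hxy (by simp [b0, f1]) (by simp [b0, f2]) (by simp [b0, f3])
    (by rw [replaceAt_right hik hjk, hgood]) (by rw [replaceAt_of_ne bi bj bk, hQb]) ?_
  -- The new coefficient is a_{λ_i} C^2, but the old box starts at `k`; rewriting it as a_{λ_k} C
  -- explains `u = 1`.
  · have : a (Sum.inl k) = a (Sum.inl i) * ratioC a i k := by simp [ratioC]
    rw [h.movedCoef_middle, this, mul_assoc, ← zpow_one_add]
    rfl
  · rw [h.lambda_off bi bj bk h1 h2 h3, (h.lambda_middle' h1 h2 h3).2]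
  · simp only at he
    linarith

/-- The corresponding old box is bounded by `j` and `bot`. -/
theorem box_below_right (h : IsThreeMove w w' i j k) (hw : IsReducedLongest w)
    {a : Inequality w → ℂˣ} (ha : a ∈ parameterSpace w) {bot : Fin N} (hbox : IsBox w' k bot)
    {P Q : Fin N → ℤ} (hP : P ∈ stringVectors w') (hQ : Q ∈ stringVectors w')
    (hPQ : P + lambdaVector w' k = Q + lambdaVector w' bot) (hPt : P k = -1) (hQb : Q bot = 1) :
    stringCoef (movedCoef w' i j k a) P * movedCoef w' i j k a (Sum.inl k) =
      stringCoef (movedCoef w' i j k a) Q * movedCoef w' i j k a (Sum.inl bot) := by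
  have hw' := h.isReducedLongest hw
  have hij := h.ne_left_middle
  have hik := h.ne_left_right
  have hjk := h.ne_middle_right
  obtain ⟨l1, l2, l3⟩ := h.lt_left
  obtain ⟨hkb, b2, b3⟩ := hbox
  obtain ⟨bi, bj, bk⟩ := h.ne_of_right_lt hkb
  have hwb := h.hq' bot bi bj bk
  rw [hwb, h.hk'] at b2
  have hbox₀ : IsBox w j bot := by
    refine ⟨l2.trans hkb, b2, fun x hx1 hx2 => ?_⟩
    have x1 : x ≠ i := (l1.trans hx1).ne'
    by_cases x3 : x = k
    · rw [x3, h.hki]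
      exact h.columns_ne
    rw [← h.hq' x x1 hx1.ne' x3, ← h.hk']
    exact b3 x ((h.lt_iff x1 hx1.ne' x3).2.2.2.1 hx1) hx2
  have b0 : ∀ x, x = i ∨ x = j ∨ x = k → lambdaVector w bot x = 0 := fun x hx =>
    h.lambda_below hkb hx
  have b0' : ∀ x, x = i ∨ x = j ∨ x = k → lambdaVector w' bot x = 0 := fun x hx =>
    h.symm.lambda_below hkb hx
  obtain ⟨e1, e2, e3⟩ := h.symm.lambda_right
  obtain ⟨f1, f2, f3⟩ := h.lambda_middle
  obtain ⟨x, hx, y, hy, hxy, hgood, he⟩ := transfers_below_right _ (h.symm.localType_mem hw' hP) _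
    (h.symm.localType_mem hw' hQ) hPt (lambda_add_eq hPQ
      (by simp [e1, b0']) (by simp [e2, b0']) (by simp [e3, b0']))
  refine h.box_transfer hw ha hbox₀ (h.movedCoef_right a) (h.movedCoef_below a hkb) hP hQ hPQ
    (fun v h1 h2 h3 => ?_) hx hy hxy (by simp [b0, f1]) (by simp [b0, f2]) (by simp [b0, f3])
    (by rw [replaceAt_middle hij, hgood]) (by rw [replaceAt_of_ne bi bj bk, hQb]) ?_
  · rw [h.lambda_off bi bj bk h1 h2 h3, (h.symm.lambda_middle' h1 h2 h3).2]
  · simp only at he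
    linarith

/-- The crossings `i` and `k` bound a box with each other, so no other box begins at `i` or ends at
`k`, and the preceding cases are exhaustive. -/
theorem movedCoef_mem (h : IsThreeMove w w' i j k) (hw : IsReducedLongest w)
    {a : Inequality w → ℂˣ} (ha : a ∈ parameterSpace w) :
    movedCoef w' i j k a ∈ parameterSpace w' := by
  intro top bot P Q hbox hPQ hPt hQb
  obtain ⟨l1, l2, l3⟩ := h.lt_left
  rw [← stringCoef_coe (movedCoef w' i j k a) P, ← stringCoef_coe (movedCoef w' i j k a) Q]
  by_cases ti : top = i
  · subst ti
    have : bot = k := by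
      by_contra bk
      have bj : bot ≠ j := by
        rintro rfl
        have := hbox.2.1
        rw [h.hi', h.hj'] at this
        exact h.columns_ne this.symm
      have hkb := (h.lt_iff hbox.1.ne' bj bk).2.2.1.1 hbox.1
      exact hbox.2.2 k l3 hkb (by rw [h.hk', h.hi'])
    subst this
    exact h.box_inside hw ha P.2 Q.2 hPQ hPt hQb
  by_cases tj : top = j
  · subst tj
    exact h.box_below_middle hw ha hbox P.2 Q.2 hPQ hPt hQb
  by_cases tk : top = k
  · subst tk
    exact h.box_below_right hw ha hbox P.2 Q.2 hPQ hPt hQb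
  by_cases bi : bot = i
  · subst bi
    exact h.box_above_left hw ha hbox P.2 Q.2 hPQ hPt hQb
  by_cases bj : bot = j
  · subst bj
    exact h.box_above_middle hw ha hbox P.2 Q.2 hPQ hPt hQb
  by_cases bk : bot = k
  · subst bk
    exfalso
    have hti := (h.lt_iff ti tj tk).2.1.1 hbox.1
    exact hbox.2.2 i hti l3 (by rw [hbox.2.1, h.hi', h.hk'])
  exact h.box_outside hw ha hbox ⟨ti, tj, tk⟩ ⟨bi, bj, bk⟩ P.2 Q.2 hPQ hPt hQb

end IsThreeMove

end BoxEquations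

/-! ### The rational map is an involution -/

section Involution

variable {N : ℕ} {C : ℂˣ} {i j k : Fin N}

/-- The substitution interchanges the two summands `t_i t_k` and `C t_j`. -/
theorem hPullback_denom (hij : i ≠ j) (hik : i ≠ k) (hjk : j ≠ k) :
    hPullback C i j k (denom C i j k) =
      algebraMap (Laurent N) (LocalizedLaurent C i j k) (denom C i j k) := by
  have e : denom C i j k = monomial (Pi.single i 1 + Pi.single k 1) +
      (C : ℂ) • monomial (Pi.single j 1) := by
    simp [denom, coord, monomial, AddMonoidAlgebra.single_mul_single]
  have e1 : replaceAt ![i, j, k] (Pi.single i 1 + Pi.single k 1 : Fin N → ℤ)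
      ((Pi.single i 1 + Pi.single k 1 : Fin N → ℤ) j, (Pi.single i 1 + Pi.single k 1 : Fin N → ℤ) k,
        (Pi.single i 1 + Pi.single k 1 : Fin N → ℤ) j) = Pi.single j 1 := by
    symm
    apply eq_replaceAt
    · simp [hij, hij.symm, hjk]
    · simp [hik.symm]
    · simp [hjk.symm, hij.symm, hjk]
    · intro v h1 h2 h3
      simp [h1, h2, h3]
  have e2 : replaceAt ![i, j, k] (Pi.single j 1 : Fin N → ℤ)
      ((Pi.single j 1 : Fin N → ℤ) j, (Pi.single j 1 : Fin N → ℤ) k,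
        (Pi.single j 1 : Fin N → ℤ) j) = Pi.single i 1 + Pi.single k 1 := by
    symm
    apply eq_replaceAt
    · simp [hik]
    · simp [hij.symm, hjk.symm, hjk]
    · simp [hik.symm]
    · intro v h1 h2 h3
      simp [h1, h2, h3]
  have key : hPullback C i j k (monomial (Pi.single i 1 + Pi.single k 1) +
      (C : ℂ) • monomial (Pi.single j 1)) = algebraMap (Laurent N) (LocalizedLaurent C i j k)
        (monomial (Pi.single i 1 + Pi.single k 1) + (C : ℂ) • monomial (Pi.single j 1)) := by
    rw [map_add, map_smul, hPullback_swap hij hik hjk (by simp [hik, hik.symm]), e1,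
      hPullback_swap hij hik hjk (by simp [hij, hjk.symm]), e2, map_add, algebraMap_const_smul,
      smul_smul]
    simp [hij.symm, hjk, hjk.symm, hik.symm]
    rw [add_comm]
  exact (congrArg _ e).trans (key.trans (congrArg _ e.symm))

theorem isUnit_hPullback_denom (hij : i ≠ j) (hik : i ≠ k) (hjk : j ≠ k) :
    IsUnit (hPullback C i j k (denom C i j k)) := by
  rw [hPullback_denom hij hik hjk]
  exact IsLocalization.Away.algebraMap_isUnit _

/-- The extension of `h_a^*` to the localized ring. -/
def hInvolution (hij : i ≠ j) (hik : i ≠ k) (hjk : j ≠ k) :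
    LocalizedLaurent C i j k →ₐ[ℂ] LocalizedLaurent C i j k :=
  IsLocalization.Away.liftAlgHom (denom C i j k) (f := hPullback C i j k)
    (isUnit_hPullback_denom hij hik hjk)

theorem hInvolution_algebraMap (hij : i ≠ j) (hik : i ≠ k) (hjk : j ≠ k) (x : Laurent N) :
    hInvolution (C := C) hij hik hjk (algebraMap _ _ x) = hPullback C i j k x :=
  IsLocalization.Away.lift_eq _ (isUnit_hPullback_denom hij hik hjk) x

theorem map_monLoc (hij : i ≠ j) (hik : i ≠ k) (hjk : j ≠ k) (M : Fin N → ℤ) :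
    Units.map (hInvolution (C := C) hij hik hjk : _ →* _) (monLoc C i j k M) =
      ∏ v, hComponent C i j k v ^ M v := by
  apply Units.ext
  rw [← hPullback_monomial_eq_prod, ← hInvolution_algebraMap hij hik hjk, algebraMap_monomial]
  rfl

/-- The constant C and the denominator are fixed, the map of exponents (x, y, z) to (y + z - x, z,
y) is an involution, and the powers of C and of the denominator from the two applications cancel. -/
theorem hInvolution_hPullback (hij : i ≠ j) (hik : i ≠ k) (hjk : j ≠ k) (x : Laurent N) :
    hInvolution (C := C) hij hik hjk (hPullback C i j k x) = algebraMap _ _ x := by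
  have h : (hInvolution (C := C) hij hik hjk).comp (hPullback C i j k) =
      IsScalarTower.toAlgHom ℂ (Laurent N) (LocalizedLaurent C i j k) := by
    refine AddMonoidAlgebra.algHom_ext (fun M => ?_) (by ext)
    change hInvolution (C := C) hij hik hjk (hPullback C i j k (monomial M)) =
      algebraMap _ _ (monomial M)
    rw [hPullback_monomial_eq_prod, algebraMap_monomial]
    change ((Units.map (hInvolution (C := C) hij hik hjk : _ →* _)
      (∏ v, hComponent C i j k v ^ M v) : (LocalizedLaurent C i j k)ˣ) :
        LocalizedLaurent C i j k) = _
    congr 1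
    have hC : Units.map (hInvolution (C := C) hij hik hjk : _ →* _) (constLoc C i j k) =
        constLoc C i j k := by
      apply Units.ext
      change hInvolution (C := C) hij hik hjk (algebraMap ℂ _ (C : ℂ)) = algebraMap ℂ _ (C : ℂ)
      exact AlgHom.commutes _ _
    have hD : Units.map (hInvolution (C := C) hij hik hjk : _ →* _) (denomLoc C i j k) =
        denomLoc C i j k := by
      apply Units.ext
      change hInvolution (C := C) hij hik hjk (algebraMap _ _ (denom C i j k)) =
        algebraMap _ _ (denom C i j k)
      rw [hInvolution_algebraMap, hPullback_denom hij hik hjk]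
    have hM : M = replaceAt ![i, j, k] (replaceAt ![i, j, k] M (M j + M k - M i, M k, M j))
        (M k + M j - (M j + M k - M i), M j, M k) := by
      apply eq_replaceAt
      · simp; ring
      · rfl
      · rfl
      · intro v h1 h2 h3
        rw [replaceAt_of_ne h1 h2 h3]
    rw [prod_hComponent hij hik hjk, map_mul, map_mul, map_zpow, map_zpow, hC, hD, map_monLoc,
      prod_hComponent hij hik hjk]
    simp only [replaceAt_left, replaceAt_middle hij, replaceAt_right hik hjk]
    rw [← hM]
    apply Additive.ofMul.injective
    simp only [ofMul_mul, ofMul_zpow]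
    module
  exact DFunLike.congr_fun h x

theorem hInvolution_hInvolution (hij : i ≠ j) (hik : i ≠ k) (hjk : j ≠ k)
    (x : LocalizedLaurent C i j k) :
    hInvolution (C := C) hij hik hjk (hInvolution (C := C) hij hik hjk x) = x := by
  have h : ((hInvolution (C := C) hij hik hjk).comp (hInvolution (C := C) hij hik hjk)).toRingHom =
      RingHom.id _ := by
    refine IsLocalization.ringHom_ext (Submonoid.powers (denom C i j k)) (RingHom.ext fun y => ?_)
    change hInvolution (C := C) hij hik hjk (hInvolution (C := C) hij hik hjk (algebraMap _ _ y)) =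
      algebraMap _ _ y
    rw [hInvolution_algebraMap, hInvolution_hPullback]
  exact DFunLike.congr_fun h x

end Involution

/-! ### The denominator and the hypersurface -/

section Divisor

variable {N : ℕ} {C : ℂˣ} {i j k : Fin N}

/-- The coordinates restricted to the divisor `t_i t_k + C t_j = 0`. -/
def divisorCoord (C : ℂˣ) (i j k v : Fin N) : (Laurent N)ˣ :=
  if v = j then
    coord i * coord k * Units.map (algebraMap ℂ (Laurent N)).toMonoidHom (-C⁻¹) else coord v

/-- The restriction to the divisor `t_i t_k + C t_j = 0`, on which `t_j` is eliminated. -/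
def divisorRestrict (C : ℂˣ) (i j k : Fin N) : Laurent N →ₐ[ℂ] Laurent N :=
  AddMonoidAlgebra.lift ℂ (Laurent N) (Fin N → ℤ) (unitMonomial (divisorCoord C i j k))

theorem divisorRestrict_monomial_eq_prod (M : Fin N → ℤ) :
    divisorRestrict C i j k (monomial M) =
      ((∏ v, divisorCoord C i j k v ^ M v : (Laurent N)ˣ) : Laurent N) := by
  unfold divisorRestrict monomial
  rw [AddMonoidAlgebra.lift_single, one_smul]
  rfl

theorem divisorRestrict_coord (v : Fin N) :
    divisorRestrict C i j k (coord v) = divisorCoord C i j k v := by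
  change divisorRestrict C i j k (monomial (Pi.single v 1)) = _
  rw [divisorRestrict_monomial_eq_prod]
  congr 1
  rw [Finset.prod_eq_single v (fun u _ hu => by simp [hu]) (by simp)]
  simp

theorem divisorCoord_middle : (divisorCoord C i j k j : Laurent N) =
    ((-C⁻¹ : ℂˣ) : ℂ) • ((coord i : Laurent N) * coord k) := by
  rw [divisorCoord, if_pos rfl, Units.val_mul, Units.val_mul, Algebra.smul_def, mul_comm]
  rfl

theorem divisorRestrict_denom (hij : i ≠ j) (hjk : j ≠ k) :
    divisorRestrict C i j k (denom C i j k) = 0 := by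
  change divisorRestrict C i j k (coord i * coord k + (C : ℂ) • (coord j : Laurent N)) = 0
  rw [map_add, map_mul, map_smul, divisorRestrict_coord, divisorRestrict_coord,
    divisorRestrict_coord, divisorCoord_middle, smul_smul, divisorCoord, if_neg hij, divisorCoord,
    if_neg hjk.symm]
  simp

/-- Modulo the denominator `t_j` equals `-C⁻¹ t_i t_k`, so the substitution does nothing there. In
particular, whatever restricts to zero is a multiple of the denominator. -/
theorem divisorRestrict_sub_mem (x : Laurent N) :
    divisorRestrict C i j k x - x ∈ Ideal.span {denom C i j k} := by
  rw [← Ideal.Quotient.mk_eq_mk_iff_sub_mem]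
  have h : (Ideal.Quotient.mkₐ ℂ (Ideal.span {denom C i j k})).comp (divisorRestrict C i j k) =
      Ideal.Quotient.mkₐ ℂ (Ideal.span {denom C i j k}) := by
    refine AddMonoidAlgebra.algHom_ext (fun M => ?_) (by ext)
    change Ideal.Quotient.mk (Ideal.span {denom C i j k})
      (divisorRestrict C i j k (monomial M)) = Ideal.Quotient.mk _ (monomial M)
    rw [divisorRestrict_monomial_eq_prod, monomial_eq_prod]
    change ((Units.map (Ideal.Quotient.mk (Ideal.span {denom C i j k})).toMonoidHom
      (∏ v, divisorCoord C i j k v ^ M v) : (Laurent N ⧸ Ideal.span {denom C i j k})ˣ) : _) =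
      ((Units.map (Ideal.Quotient.mk (Ideal.span {denom C i j k})).toMonoidHom
      (∏ v, coord v ^ M v) : (Laurent N ⧸ Ideal.span {denom C i j k})ˣ) :
        Laurent N ⧸ Ideal.span {denom C i j k})
    rw [map_prod, map_prod]
    simp only [map_zpow]
    congr 1
    refine Finset.prod_congr rfl fun v _ => ?_
    congr 1
    apply Units.ext
    change Ideal.Quotient.mk (Ideal.span {denom C i j k}) (divisorCoord C i j k v) =
      Ideal.Quotient.mk _ (coord v : Laurent N)
    by_cases hv : v = j
    · subst hv
      rw [divisorCoord_middle, Ideal.Quotient.mk_eq_mk_iff_sub_mem]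
      have e : ((-C⁻¹ : ℂˣ) : ℂ) • ((coord i : Laurent N) * coord k) - (coord v : Laurent N) =
          algebraMap ℂ (Laurent N) ((-C⁻¹ : ℂˣ) : ℂ) * denom C i v k := by
        change _ = _ * (coord i * coord k + (C : ℂ) • (coord v : Laurent N))
        rw [← Algebra.smul_def, smul_add, smul_smul]
        simp [sub_eq_add_neg]
      rw [e]
      exact Ideal.mul_mem_left _ _ (Ideal.mem_span_singleton_self _)
    · rw [divisorCoord, if_neg hv]
  exact DFunLike.congr_fun h x

/-- A Laurent polynomial which does not vanish on the divisor `t_i t_k + C t_j = 0` is a nonzero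
divisor modulo `t_i t_k + C t_j`. -/
theorem mem_span_of_mul_denom_mem (hij : i ≠ j) (hjk : j ≠ k) {f x : Laurent N}
    (hf : divisorRestrict C i j k f ≠ 0) (hx : x * denom C i j k ∈ Ideal.span {f}) :
    x ∈ Ideal.span {f} := by
  have : IsDomain (Laurent N) := {}
  rw [Ideal.mem_span_singleton] at hx ⊢
  obtain ⟨y, hy⟩ := hx
  -- Restricting x D = f y kills the left side. The Laurent ring is a domain and `f` does not
  -- restrict to zero, so `y` does; hence D divides `y` and can be cancelled.
  have h1 := congrArg (divisorRestrict C i j k) hy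
  rw [map_mul, map_mul, divisorRestrict_denom hij hjk, mul_zero, eq_comm, mul_eq_zero] at h1
  have h2 := divisorRestrict_sub_mem (C := C) (i := i) (j := j) (k := k) y
  rw [h1.resolve_left hf, zero_sub, neg_mem_iff, Ideal.mem_span_singleton] at h2
  obtain ⟨z, rfl⟩ := h2
  refine ⟨z, mul_right_cancel₀ (denom_ne_zero C i j k) ?_⟩
  rw [hy]
  ring

theorem divisorRestrict_monomial (hij : i ≠ j) (hik : i ≠ k) (hjk : j ≠ k) (M : Fin N → ℤ) :
    divisorRestrict C i j k (monomial M) = (((-C⁻¹) ^ M j : ℂˣ) : ℂ) •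
      monomial (replaceAt ![i, j, k] M (M i + M j, 0, M k + M j)) := by
  rw [divisorRestrict_monomial_eq_prod, monomial_eq_prod, Algebra.smul_def]
  have e : algebraMap ℂ (Laurent N) (((-C⁻¹) ^ M j : ℂˣ) : ℂ) =
      ((Units.map (algebraMap ℂ (Laurent N)).toMonoidHom (-C⁻¹) ^ M j : (Laurent N)ˣ) :
        Laurent N) := by
    rw [← map_zpow]
    rfl
  rw [e, ← Units.val_mul]
  congr 1
  rw [prod_three hij hik hjk, prod_three hij hik hjk (fun v => _ ^ replaceAt _ _ _ v),
    replaceAt_left, replaceAt_middle hij, replaceAt_right hik hjk, ← mul_assoc]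
  congr 1
  · simp only [divisorCoord, if_true, if_neg hij, if_neg hjk.symm]
    apply Additive.ofMul.injective
    simp only [ofMul_mul, ofMul_zpow]
    module
  · refine Finset.prod_congr rfl fun v hv => ?_
    simp only [Finset.mem_sdiff, Finset.mem_insert, Finset.mem_singleton, not_or] at hv
    obtain ⟨-, h1, h2, h3⟩ := hv
    rw [replaceAt_of_ne h1 h2 h3, divisorCoord, if_neg h2]

/-- No defining monomial becomes constant on the divisor. Otherwise its exponents would be a
multiple of (1, -1, 1) on the triangle and zero elsewhere; for λ-vectors this is visibly false, and
for string vectors `stringVector_ne_proportional` rules it out. -/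
theorem IsThreeMove.vectorOf_ne {n : ℕ} {w w' : Word n N} (h : IsThreeMove w w' i j k)
    (hw : IsReducedLongest w) (d : Inequality w) :
    replaceAt ![i, j, k] (vectorOf w d) (vectorOf w d i + vectorOf w d j, 0,
      vectorOf w d k + vectorOf w d j) ≠ 0 := by
  intro h0
  have hi := congrFun h0 i
  have hk := congrFun h0 k
  have hoff : ∀ v, v ≠ i → v ≠ j → v ≠ k → vectorOf w d v = 0 := fun v h1 h2 h3 => by
    have := congrFun h0 v
    rwa [replaceAt_of_ne h1 h2 h3] at this
  rw [replaceAt_left] at hi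
  rw [replaceAt_right h.ne_left_right h.ne_middle_right] at hk
  simp only [Pi.zero_apply] at hi hk
  rcases d with v | M
  · simp only [vectorOf, Sum.elim_inl] at hi hk hoff
    by_cases vi : v = i
    · subst vi
      obtain ⟨e1, e2, e3⟩ := h.lambda_left
      omega
    by_cases vj : v = j
    · subst vj
      obtain ⟨e1, e2, e3⟩ := h.lambda_middle
      omega
    by_cases vk : v = k
    · subst vk
      obtain ⟨e1, e2, e3⟩ := h.lambda_right
      omega
    have := hoff v vi vj vk
    simp [lambdaVector] at this
  · simp only [vectorOf, Sum.elim_inr] at hi hk hoff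
    obtain ⟨st, ty, T⟩ := h.exists_triangleMove hw
    refine T.source.stringVector_ne_proportional hw M.2 (fun v hv => ?_) ?_ ?_
    · refine hoff v ?_ ?_ ?_ <;> rintro rfl <;> exact hv (by simp)
    · simp only [Matrix.cons_val_one, Matrix.cons_val_zero]
      omega
    · change M.1 k = M.1 i
      omega

/-- The hypersurface does not contain the divisor `t_i t_k + C t_j = 0`. -/
theorem IsThreeMove.divisorRestrict_ne_zero {n : ℕ} {w w' : Word n N}
    (h : IsThreeMove w w' i j k) (hw : IsReducedLongest w) (a : Inequality w → ℂˣ) :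
    divisorRestrict C i j k (laurentPoly w a) ≠ 0 := by
  intro h0
  -- The restriction has constant coefficient 1, from the summand 1 alone.
  have h1 := congrArg (fun x : Laurent N => x.coeff 0) h0
  have h2 : ∀ d, (divisorRestrict C i j k (monomial (vectorOf w d))).coeff 0 = 0 := by
    intro d
    rw [divisorRestrict_monomial h.ne_left_middle h.ne_left_right h.ne_middle_right]
    simp [monomial, h.vectorOf_ne hw d]
  simp only [laurentPoly, map_sub, map_one, map_sum] at h1
  simp [h2, AddMonoidAlgebra.one_def] at h1

end Divisor

/-! ### Birational maps of hypersurfaces -/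

section Birational

/-- If the basic open sets of `g` and `d` are disjoint, then some power of `g * d` is zero;
cancelling the powers of `d` makes `g` nilpotent, so its basic open set is empty. -/
theorem dense_basicOpen_of_nonZeroDivisor {A : Type*} [CommRing A] {d : A}
    (hd : ∀ x, x * d = 0 → x = 0) :
    Dense ((PrimeSpectrum.basicOpen d : TopologicalSpace.Opens (PrimeSpectrum A)) :
      Set (PrimeSpectrum A)) := by
  rw [PrimeSpectrum.isTopologicalBasis_basic_opens.dense_iff]
  rintro _ ⟨g, rfl⟩ hg
  rw [← TopologicalSpace.Opens.coe_inf, ← PrimeSpectrum.basicOpen_mul,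
    Set.nonempty_iff_ne_empty, Ne, ← TopologicalSpace.Opens.coe_bot, SetLike.coe_set_eq,
    PrimeSpectrum.basicOpen_eq_bot_iff] at *
  rintro ⟨m, hm⟩
  refine hg ⟨m, ?_⟩
  rw [mul_pow] at hm
  have key : ∀ m : ℕ, ∀ x, x * d ^ m = 0 → x = 0 := by
    intro m
    induction m with
    | zero => simp
    | succ m ih =>
      intro x hx
      rw [pow_succ, ← mul_assoc] at hx
      exact ih x (hd _ hx)
  exact key m _ hm

variable {R : Type} [CommRing R] (D : R)

theorem isUnit_quotient (f : R) : IsUnit (((algebraMap (R ⧸ Ideal.span {f})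
    (Localization.Away (Ideal.Quotient.mk (Ideal.span {f}) D))).comp
      (Ideal.Quotient.mk (Ideal.span {f}))) D) :=
  IsLocalization.Away.algebraMap_isUnit (Ideal.Quotient.mk (Ideal.span {f}) D)

/-- The map from the localization of `R` to the localization of a quotient. -/
def quotientLoc (f : R) : Localization.Away D →+*
    Localization.Away (Ideal.Quotient.mk (Ideal.span {f}) D) :=
  IsLocalization.Away.lift D (isUnit_quotient D f)

theorem quotientLoc_algebraMap (f x : R) : quotientLoc D f (algebraMap _ _ x) =
    algebraMap _ _ (Ideal.Quotient.mk (Ideal.span {f}) x) :=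
  IsLocalization.Away.lift_eq _ (isUnit_quotient D f) x

variable {D}

theorem quotientLoc_hom_ext {f : R} {S : Type*} [CommRing S]
    {φ ψ : Localization.Away (Ideal.Quotient.mk (Ideal.span {f}) D) →+* S}
    (h : φ.comp (quotientLoc D f) = ψ.comp (quotientLoc D f)) : φ = ψ := by
  refine IsLocalization.ringHom_ext (Submonoid.powers (Ideal.Quotient.mk (Ideal.span {f}) D))
    (Ideal.Quotient.ringHom_ext (RingHom.ext fun x => ?_))
  have := DFunLike.congr_fun h (algebraMap _ _ x)
  simp only [RingHom.comp_apply, quotientLoc_algebraMap] at this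
  exact this

/-- The map from the quotient by `f` to a localization of the quotient by `f'` which is defined by
an endomorphism of the localization of `R` mapping `f` to `f'`. -/
def quotientToLoc {f f' : R} (Θ : Localization.Away D →+* Localization.Away D)
    (hf : Θ (algebraMap _ _ f) = algebraMap _ _ f') :
    R ⧸ Ideal.span {f} →+* Localization.Away (Ideal.Quotient.mk (Ideal.span {f'}) D) :=
  Ideal.Quotient.lift (Ideal.span {f})
    (((quotientLoc D f').comp Θ).comp (algebraMap R (Localization.Away D))) (by
      intro x hx
      obtain ⟨y, rfl⟩ := Ideal.mem_span_singleton.1 hx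
      rw [map_mul]
      have : (((quotientLoc D f').comp Θ).comp (algebraMap R (Localization.Away D))) f = 0 := by
        rw [RingHom.comp_apply, RingHom.comp_apply, hf, quotientLoc_algebraMap,
          Ideal.Quotient.eq_zero_iff_mem.2 (Ideal.mem_span_singleton_self _), map_zero]
      rw [this, zero_mul])

theorem isUnit_quotientToLoc {f f' : R} (Θ : Localization.Away D →+* Localization.Away D)
    (hf : Θ (algebraMap _ _ f) = algebraMap _ _ f') :
    IsUnit (quotientToLoc Θ hf (Ideal.Quotient.mk (Ideal.span {f}) D)) :=
  ((IsLocalization.Away.algebraMap_isUnit D).map Θ).map (quotientLoc D f')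

/-- The extension of `quotientToLoc` to a localization of the quotient by `f`. -/
def quotientLocLift {f f' : R} (Θ : Localization.Away D →+* Localization.Away D)
    (hf : Θ (algebraMap _ _ f) = algebraMap _ _ f') :
    Localization.Away (Ideal.Quotient.mk (Ideal.span {f}) D) →+*
      Localization.Away (Ideal.Quotient.mk (Ideal.span {f'}) D) :=
  IsLocalization.Away.lift (Ideal.Quotient.mk (Ideal.span {f}) D) (isUnit_quotientToLoc Θ hf)

/-- This compatibility shows both that the two lifts are inverse to each other, as `Θ` is an
involution, and that the isomorphism of the hypersurfaces is the restriction of the ambient map. -/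
theorem quotientLocLift_comp {f f' : R} (Θ : Localization.Away D →+* Localization.Away D)
    (hf : Θ (algebraMap _ _ f) = algebraMap _ _ f') :
    (quotientLocLift Θ hf).comp (quotientLoc D f) = (quotientLoc D f').comp Θ := by
  refine IsLocalization.ringHom_ext (Submonoid.powers D) (RingHom.ext fun x => ?_)
  simp only [RingHom.comp_apply, quotientLoc_algebraMap]
  exact IsLocalization.Away.lift_eq _ (isUnit_quotientToLoc Θ hf) _

/-- The isomorphism of localized quotients defined by an involution. -/
def quotientLocEquiv {f f' : R} (Θ : Localization.Away D →+* Localization.Away D)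
    (hΘ : ∀ x, Θ (Θ x) = x) (hf : Θ (algebraMap _ _ f) = algebraMap _ _ f') :
    Localization.Away (Ideal.Quotient.mk (Ideal.span {f}) D) ≃+*
      Localization.Away (Ideal.Quotient.mk (Ideal.span {f'}) D) :=
  have hf' : Θ (algebraMap _ _ f') = algebraMap _ _ f := by rw [← hf, hΘ]
  have hΘ' : Θ.comp Θ = RingHom.id _ := RingHom.ext hΘ
  RingEquiv.ofRingHom (quotientLocLift Θ hf) (quotientLocLift Θ hf')
    (quotientLoc_hom_ext (by
      rw [RingHom.comp_assoc, quotientLocLift_comp, ← RingHom.comp_assoc, quotientLocLift_comp,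
        RingHom.comp_assoc, hΘ', RingHom.comp_id, RingHom.id_comp]))
    (quotientLoc_hom_ext (by
      rw [RingHom.comp_assoc, quotientLocLift_comp, ← RingHom.comp_assoc, quotientLocLift_comp,
        RingHom.comp_assoc, hΘ', RingHom.comp_id, RingHom.id_comp]))

/-- An involution of the localization of `R` which maps `f` to `f'` gives a birational map between
the closed subschemes defined by `f'` and `f`. -/
theorem inducesBirationalMap_of_involution {f f' : R}
    (Θ : Localization.Away D →+* Localization.Away D)
    (hΘ : ∀ x, Θ (Θ x) = x) (hf : Θ (algebraMap _ _ f) = algebraMap _ _ f')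
    (hd : ∀ x, x * D ∈ Ideal.span {f} → x ∈ Ideal.span {f})
    (hd' : ∀ x, x * D ∈ Ideal.span {f'} → x ∈ Ideal.span {f'})
    (hD : Dense ((PrimeSpectrum.basicOpen D : TopologicalSpace.Opens (PrimeSpectrum R)) :
      Set (PrimeSpectrum R))) :
    InducesBirationalMap (X' := Spec (CommRingCat.of R)) (X := Spec (CommRingCat.of R))
      { domain := PrimeSpectrum.basicOpen (R := R) D
        dense_domain := hD
        hom := (basicOpenIsoSpecAway (R := CommRingCat.of R) D).hom ≫
          Spec.map (CommRingCat.ofHom (Θ.comp (algebraMap R (Localization.Away D)))) }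
      (Spec.map (CommRingCat.ofHom (Ideal.Quotient.mk (Ideal.span {f'}))))
      (Spec.map (CommRingCat.ofHom (Ideal.Quotient.mk (Ideal.span {f})))) := by
  have dense : ∀ g : R, (∀ x, x * D ∈ Ideal.span {g} → x ∈ Ideal.span {g}) →
      Dense ((PrimeSpectrum.basicOpen (Ideal.Quotient.mk (Ideal.span {g}) D) :
        TopologicalSpace.Opens (PrimeSpectrum (R ⧸ Ideal.span {g}))) : Set (PrimeSpectrum (R ⧸ Ideal.span {g}))) := by
    intro g hg
    refine dense_basicOpen_of_nonZeroDivisor fun x hx => ?_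
    obtain ⟨x, rfl⟩ := Ideal.Quotient.mk_surjective x
    rw [← map_mul, Ideal.Quotient.eq_zero_iff_mem] at hx
    exact Ideal.Quotient.eq_zero_iff_mem.2 (hg x hx)
  let B := basicOpenIsoSpecAway (R := CommRingCat.of R) D
  let B₁ := basicOpenIsoSpecAway (R := CommRingCat.of (R ⧸ Ideal.span {f}))
    (Ideal.Quotient.mk (Ideal.span {f}) D)
  let B₂ := basicOpenIsoSpecAway (R := CommRingCat.of (R ⧸ Ideal.span {f'}))
    (Ideal.Quotient.mk (Ideal.span {f'}) D)
  let E := quotientLocEquiv Θ hΘ hf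
  refine ⟨{ source := PrimeSpectrum.basicOpen (R := R ⧸ Ideal.span {f'}) (Ideal.Quotient.mk _ D)
            dense_source := dense f' hd'
            target := PrimeSpectrum.basicOpen (R := R ⧸ Ideal.span {f}) (Ideal.Quotient.mk _ D)
            dense_target := dense f hd
            iso := B₂ ≪≫ Scheme.Spec.mapIso E.toCommRingCatIso.op ≪≫ B₁.symm },
    -- The closed immersion of the hypersurface of `f'`, restricted to the locus where `D` is
    -- invertible.
    B₂.hom ≫ Spec.map (CommRingCat.ofHom (quotientLoc D f')) ≫ B.inv, ?_, ?_⟩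
  · have h1 : B.inv ≫ Scheme.Opens.ι (X := Spec (CommRingCat.of R)) (PrimeSpectrum.basicOpen D) =
        Spec.map (CommRingCat.ofHom (algebraMap R (Localization.Away D))) := by
      rw [Iso.inv_comp_eq]
      exact (basicOpenIsoSpecAway_hom_SpecMap (R := CommRingCat.of R) D).symm
    have h2 := basicOpenIsoSpecAway_hom_SpecMap (R := CommRingCat.of (R ⧸ Ideal.span {f'}))
      (Ideal.Quotient.mk (Ideal.span {f'}) D)
    have h3 : Spec.map (CommRingCat.ofHom (quotientLoc D f')) ≫
        Spec.map (CommRingCat.ofHom (algebraMap R (Localization.Away D))) =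
        Spec.map (CommRingCat.ofHom (algebraMap (R ⧸ Ideal.span {f'})
          (Localization.Away (Ideal.Quotient.mk (Ideal.span {f'}) D)))) ≫
          Spec.map (CommRingCat.ofHom (Ideal.Quotient.mk (Ideal.span {f'}))) := by
      rw [← Spec.map_comp, ← Spec.map_comp, ← CommRingCat.ofHom_comp, ← CommRingCat.ofHom_comp]
      congr 2
      exact RingHom.ext fun x => quotientLoc_algebraMap D f' x
    change (B₂.hom ≫ Spec.map (CommRingCat.ofHom (quotientLoc D f')) ≫ B.inv) ≫
      Scheme.Opens.ι (X := Spec (CommRingCat.of R)) (PrimeSpectrum.basicOpen D) = _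
    rw [Category.assoc, Category.assoc, h1, h3, ← Category.assoc]
    exact congrArg (· ≫ _) h2
  · have h1 : B₁.inv ≫ Scheme.Opens.ι (X := Spec (CommRingCat.of (R ⧸ Ideal.span {f})))
        (PrimeSpectrum.basicOpen (Ideal.Quotient.mk (Ideal.span {f}) D)) =
        Spec.map (CommRingCat.ofHom (algebraMap (R ⧸ Ideal.span {f}) (Localization.Away
          (Ideal.Quotient.mk (Ideal.span {f}) D)))) := by
      rw [Iso.inv_comp_eq]
      exact (basicOpenIsoSpecAway_hom_SpecMap (R := CommRingCat.of (R ⧸ Ideal.span {f}))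
        (Ideal.Quotient.mk (Ideal.span {f}) D)).symm
    have h3 : Spec.map (CommRingCat.ofHom (quotientLoc D f')) ≫
        Spec.map (CommRingCat.ofHom (Θ.comp (algebraMap R (Localization.Away D)))) =
        Spec.map (CommRingCat.ofHom (E : _ →+* _)) ≫
          Spec.map (CommRingCat.ofHom (algebraMap (R ⧸ Ideal.span {f})
          (Localization.Away (Ideal.Quotient.mk (Ideal.span {f}) D)))) ≫
          Spec.map (CommRingCat.ofHom (Ideal.Quotient.mk (Ideal.span {f}))) := by
      rw [← Spec.map_comp, ← Spec.map_comp, ← Spec.map_comp, ← CommRingCat.ofHom_comp,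
        ← CommRingCat.ofHom_comp, ← CommRingCat.ofHom_comp]
      congr 2
      refine RingHom.ext fun x => ?_
      have h4 := DFunLike.congr_fun (quotientLocLift_comp Θ hf) (algebraMap _ _ x)
      rw [RingHom.comp_apply, quotientLoc_algebraMap] at h4
      exact h4.symm
    change (B₂.hom ≫ Spec.map (CommRingCat.ofHom (quotientLoc D f')) ≫ B.inv) ≫
      B.hom ≫ Spec.map (CommRingCat.ofHom (Θ.comp (algebraMap R (Localization.Away D)))) =
      (B₂.hom ≫ Spec.map (CommRingCat.ofHom (E : _ →+* _)) ≫ B₁.inv) ≫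
        Scheme.Opens.ι (X := Spec (CommRingCat.of (R ⧸ Ideal.span {f})))
        (PrimeSpectrum.basicOpen (Ideal.Quotient.mk (Ideal.span {f}) D)) ≫ _
    simp only [Category.assoc, Iso.inv_hom_id_assoc]
    rw [h3, ← h1]
    simp only [Category.assoc]

end Birational

end StringMirror

end

/-! ### Assembly of the proposition. -/

theorem proposition4p2 {n N : ℕ} (w w' : Word n N) (hw : IsReducedLongest w)
    (i j k : Fin N) (hmove : IsThreeMove w w' i j k)
    (a : Inequality w → ℂˣ) (ha : a ∈ parameterSpace w) :
    ∃ a' : Inequality w' → ℂˣ, a' ∈ parameterSpace w' ∧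
      hPullback (ratioC a i k) i j k (laurentPoly w a) =
        algebraMap (Laurent N) (LocalizedLaurent (ratioC a i k) i j k) (laurentPoly w' a') ∧
      InducesBirationalMap (hMap (ratioC a i k) i j k)
        (hypersurfaceι w' a') (hypersurfaceι w a) := by
  have hij := hmove.ne_left_middle
  have hik := hmove.ne_left_right
  have hjk := hmove.ne_middle_right
  have hw' := hmove.isReducedLongest hw
  have hpull := hmove.hPullback_laurentPoly hw ha
  refine ⟨movedCoef w' i j k a, hmove.movedCoef_mem hw ha, hpull, ?_⟩
  have hcomp : (hInvolution (C := ratioC a i k) hij hik hjk).toRingHom.comp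
      (algebraMap (Laurent N) _) = (hPullback (ratioC a i k) i j k).toRingHom :=
    RingHom.ext fun x => hInvolution_algebraMap hij hik hjk x
  have hmain := inducesBirationalMap_of_involution (D := denom (ratioC a i k) i j k)
    (hInvolution hij hik hjk).toRingHom (hInvolution_hInvolution hij hik hjk)
    ((hInvolution_algebraMap hij hik hjk _).trans hpull)
    (fun x => mem_span_of_mul_denom_mem hij hjk (hmove.divisorRestrict_ne_zero hw a))
    -- For `w'` the reversed move is used. `divisorRestrict_ne_zero` holds for every constant C and
    -- all coefficients, so the same denominator works on both sides.
    (fun x => mem_span_of_mul_denom_mem hij hjk (hmove.symm.divisorRestrict_ne_zero hw' _))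
    (dense_basicOpen (ratioC a i k) i j k)
  rw [hcomp] at hmain
  exact hmain
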